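/- Let $X$ be a closed oriented Riemannian four-manifold with a $\mathrm{Spin}^c$ structure $\mathfrak{s}$, i.e. Hermitian rank 2 bundles $S^\pm$ with Clifford multiplication $\gamma: T^*X\to\mathrm{Hom}(S^+,S^-)$, normalized by $\gamma(v)^*\gamma(v)=|v|^2$, extended by $-\gamma^*$ to $S^-$ and to forms, such that self-dual 2-forms act trivially on $S^-$. Let $B$ be a fixed $\mathrm{Spin}^c$ connection (unitary connections on $S^\pm$ for which $\gamma$ is parallel with respect to the Levi-Civita connection), and let $\eta\in\Omega^2_+(X;i\mathbb{R})$ be a smooth imaginary-valued self-dual 2-form. For a Hermitian bundle $E$ of rank $n$ and $\tau\in\mathbb{R}$, a $U(n)$ monopole is a pair $(\Psi,\hat A)$ of a smooth section $\Psi$ of $S^+\otimes E$ and a smooth unitary connection $\hat A$ on $E$ with $$D_{\hat A}\Psi=0,\qquad \gamma(F_{\hat A}^+)-\mu_{0,\tau}(\Psi)=\gamma(\eta)\,\mathrm{id}_E .$$ Here $D_{\hat A}$ is the Dirac operator of $\nabla_B\otimes\nabla_{\hat A}$, $F_{\hat A}^+$ is the self-dual part of the curvature, and $\mu_{0,\tau}(\Psi)=P(\Psi\Psi^*)+\tau\,Q(\Psi\Psi^*)$,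 where $P$ and $Q$ are the orthogonal projections of $\mathfrak{gl}(S^+\otimes E)$ onto $\mathfrak{sl}(S^+)\otimes\mathfrak{sl}(E)$ and onto $\mathfrak{sl}(S^+)\otimes\mathbb{C}\,\mathrm{id}_E$. There is a universal constant $c>0$ such that, for all $X,\mathfrak{s},B,\eta$ as above, the following holds. Let $s$ be the scalar curvature, $F_B$ the curvature of $B$ on $S^+$, and let $$K=\max_X\Big(-\frac{s}{4}+\frac12\,|\mathrm{tr}\,F_B^+|+|\eta|\Big),$$ with the norm $|\omega|^2=\sum_{a,b}|\omega(e_a,e_b)|^2$ (over an orthonormal frame) on 2-forms; thus $K$ depends only on the metric, on the background $\mathrm{Spin}^c$ connection and on $\eta$. Then for every $n\ge2$, every Hermitian bundle $E$ of rank $n$, every $\tau\ge0$ and every $U(n)$ monopole $(\Psi,\hat A)$, $$\max_X|\Psi|^2\le\max\{0,K/c^2\}.$$ In particular the bound is uniform in $\tau\in[0,1]$. If $K<0$, then every such monopole has $\Psi=0$. -/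

import Mathlib

open Bundle Module
open scoped Manifold ContDiff Topology TensorProduct InnerProductSpace

universe u v

noncomputable section

namespace UnMonopole

/-! ## Linear algebra: the quadratic map in the spinor -/

section Algebra

/-- The endomorphism `a ↦ (tr a / dim V) • id` of `gl(V)`: the orthogonal projection onto the
scalar endomorphisms. -/
def scalarPart (V : Type*) [AddCommGroup V] [Module ℂ V] : End ℂ V →ₗ[ℂ] End ℂ V :=
  ((finrank ℂ V : ℂ)⁻¹ • LinearMap.trace ℂ V).smulRight (LinearMap.id : End ℂ V)

/-- The endomorphism `a ↦ a - (tr a / dim V) • id` of `gl(V)`: the orthogonal projection onto the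
trace-free endomorphisms. -/
def traceFreePart (V : Type*) [AddCommGroup V] [Module ℂ V] : End ℂ V →ₗ[ℂ] End ℂ V :=
  LinearMap.id - scalarPart V

variable (S E : Type*) [NormedAddCommGroup S] [InnerProductSpace ℂ S] [FiniteDimensional ℂ S]
  [NormedAddCommGroup E] [InnerProductSpace ℂ E] [FiniteDimensional ℂ E]

/-- The map `f ⊗ g` of `gl(S ⊗ E)` obtained from maps `f` of `gl(S)` and `g` of `gl(E)` through the
canonical isomorphism `gl(S) ⊗ gl(E) ≅ gl(S ⊗ E)`. -/
def glTensorMap (f : End ℂ S →ₗ[ℂ] End ℂ S) (g : End ℂ E →ₗ[ℂ] End ℂ E) :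
    End ℂ (S ⊗[ℂ] E) →ₗ[ℂ] End ℂ (S ⊗[ℂ] E) :=
  (homTensorHomEquiv ℂ S E S E).toLinearMap ∘ₗ TensorProduct.map f g ∘ₗ
    (homTensorHomEquiv ℂ S E S E).symm.toLinearMap

/-- The orthogonal projection `P` of `gl(S ⊗ E)` onto `sl(S) ⊗ sl(E)`. -/
def projP : End ℂ (S ⊗[ℂ] E) →ₗ[ℂ] End ℂ (S ⊗[ℂ] E) :=
  glTensorMap S E (traceFreePart S) (traceFreePart E)

/-- The orthogonal projection `Q` of `gl(S ⊗ E)` onto `sl(S) ⊗ ℂ id`. -/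
def projQ : End ℂ (S ⊗[ℂ] E) →ₗ[ℂ] End ℂ (S ⊗[ℂ] E) :=
  glTensorMap S E (traceFreePart S) (scalarPart E)

variable {S E}

/-- The endomorphism `Ψ Φ^* : Ξ ↦ (Φ, Ξ) Ψ`. -/
def outer (Ψ Φ : S ⊗[ℂ] E) : End ℂ (S ⊗[ℂ] E) :=
  (innerₛₗ ℂ Φ).smulRight Ψ

/-- The quadratic map `μ_{0,τ}(Ψ) = P(Ψ Ψ^*) + τ Q(Ψ Ψ^*)`. -/
def mu (τ : ℝ) (Ψ : S ⊗[ℂ] E) : End ℂ (S ⊗[ℂ] E) :=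
  projP S E (outer Ψ Ψ) + (τ : ℂ) • projQ S E (outer Ψ Ψ)

end Algebra

/-! ## Riemannian four-manifolds -/

section Manifold

/-- The model space of four-manifolds. -/
abbrev R4 : Type := EuclideanSpace ℝ (Fin 4)

variable {X : Type u} [TopologicalSpace X] [ChartedSpace R4 X]

section Sections

variable (F : Type*) [NormedAddCommGroup F] [NormedSpace ℝ F] {V : X → Type*}
  [∀ x, TopologicalSpace (V x)] [TopologicalSpace (TotalSpace F V)] [FiberBundle F V]

/-- The section `σ` of the bundle `V` with fibre `F` is differentiable at `x`. -/
abbrev DiffSecAt (σ : Π x : X, V x) (x : X) : Prop :=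
  MDifferentiableAt (𝓡 4) ((𝓡 4).prod 𝓘(ℝ, F)) (fun y ↦ TotalSpace.mk' F y (σ y)) x

/-- The section `σ` of the bundle `V` with fibre `F` is smooth on the set `U`. -/
abbrev SmoothSecOn (σ : Π x : X, V x) (U : Set X) : Prop :=
  ContMDiffOn (𝓡 4) ((𝓡 4).prod 𝓘(ℝ, F)) ∞ (fun y ↦ TotalSpace.mk' F y (σ y)) U

/-- The section `σ` of the bundle `V` with fibre `F` is smooth. -/
abbrev SmoothSec (σ : Π x : X, V x) : Prop :=
  ContMDiff (𝓡 4) ((𝓡 4).prod 𝓘(ℝ, F)) ∞ (fun y ↦ TotalSpace.mk' F y (σ y))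

end Sections

variable [RiemannianBundle (TangentSpace (𝓡 4) : X → Type)]

instance (x : X) : FiniteDimensional ℝ (TangentSpace (𝓡 4) x) := inferInstanceAs (FiniteDimensional ℝ R4)

instance (x : X) : Fact (finrank ℝ (TangentSpace (𝓡 4) x) = 4) := ⟨(finrank_euclideanSpace_fin : finrank ℝ R4 = 4)⟩

/-- An orthonormal basis of the tangent space at `x`; it is used only in expressions which do not
depend on its choice. -/
def onb (x : X) : OrthonormalBasis (Fin 4) ℝ (TangentSpace (𝓡 4) x) :=
  (stdOrthonormalBasis ℝ (TangentSpace (𝓡 4) x)).reindex (finCongr Fact.out)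

variable [IsManifold (𝓡 4) ∞ X]

/-- The `a`-th vector of an orthonormal basis of the tangent space at `x`, extended to a vector
field which is smooth near `x`. -/
def frame (x : X) (a : Fin 4) : Π y : X, TangentSpace (𝓡 4) y :=
  FiberBundle.extend R4 (onb x a)

theorem frame_mdiff (x : X) (a : Fin 4) : DiffSecAt R4 ((frame x a)) x :=
  FiberBundle.mdifferentiableAt_extend (𝓡 4) R4 _

/-- The right-hand side of Koszul's formula, i.e. the function `2 ⟨∇_U Y, Z⟩` for the Levi-Civita
connection `∇`. -/
def koszul (U Y Z : Π x : X, TangentSpace (𝓡 4) x) (x : X) : ℝ :=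
  mvfderiv (𝓡 4) (fun y ↦ ⟪Y y, Z y⟫_ℝ) x (U x)
    + mvfderiv (𝓡 4) (fun y ↦ ⟪Z y, U y⟫_ℝ) x (Y x)
    - mvfderiv (𝓡 4) (fun y ↦ ⟪U y, Y y⟫_ℝ) x (Z x)
    + ⟪VectorField.mlieBracket (𝓡 4) U Y x, Z x⟫_ℝ
    - ⟪VectorField.mlieBracket (𝓡 4) Y Z x, U x⟫_ℝ
    + ⟪VectorField.mlieBracket (𝓡 4) Z U x, Y x⟫_ℝ

variable [IsContMDiffRiemannianBundle (𝓡 4) ∞ R4 (TangentSpace (𝓡 4) : X → Type)]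

theorem diff_inner {x : X} {Y Z : Π x : X, TangentSpace (𝓡 4) x} (hY : DiffSecAt R4 Y x)
    (hZ : DiffSecAt R4 Z x) : MDifferentiableAt (𝓡 4) 𝓘(ℝ, ℝ) (fun y ↦ ⟪Y y, Z y⟫_ℝ) x := by
  have : IsContMDiffRiemannianBundle (𝓡 4) 1 R4 (TangentSpace (𝓡 4) : X → Type) :=
    IsContMDiffRiemannianBundle.of_le (n := ∞) (by simp)
  exact MDifferentiableAt.inner_bundle hY hZ

theorem koszul_add (x : X) (U Y Y' Z : Π x : X, TangentSpace (𝓡 4) x) (hU : DiffSecAt R4 U x)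
    (hY : DiffSecAt R4 Y x) (hY' : DiffSecAt R4 Y' x) (hZ : DiffSecAt R4 Z x) :
    koszul U (Y + Y') Z x = koszul U Y Z x + koszul U Y' Z x := by
  simp only [koszul, Pi.add_apply, inner_add_left, inner_add_right, map_add]
  rw [mvfderiv_fun_add (diff_inner hY hZ) (diff_inner hY' hZ),
    mvfderiv_fun_add (diff_inner hU hY) (diff_inner hU hY'),
    VectorField.mlieBracket_add_left hY hY', VectorField.mlieBracket_add_right hY hY']
  simp only [add_apply, inner_add_left]
  ring

theorem koszul_smul (x : X) (U Y Z : Π x : X, TangentSpace (𝓡 4) x) (f : X → ℝ) (hU : DiffSecAt R4 U x)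
    (hY : DiffSecAt R4 Y x) (hZ : DiffSecAt R4 Z x) (hf : MDifferentiableAt (𝓡 4) 𝓘(ℝ, ℝ) f x) :
    koszul U (f • Y) Z x
      = f x * koszul U Y Z x + 2 * (mvfderiv (𝓡 4) f x (U x) * ⟪Y x, Z x⟫_ℝ) := by
  simp only [koszul, Pi.smul_apply', inner_smul_left, inner_smul_right, map_smul]
  simp only [conj_trivial]
  rw [mvfderiv_fun_mul hf (diff_inner hY hZ), mvfderiv_fun_mul hf (diff_inner hU hY),
    VectorField.mlieBracket_smul_left hf hY, VectorField.mlieBracket_smul_right hf hY]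
  simp only [add_apply, inner_add_left, inner_smul_left,
    smul_apply, smul_eq_mul, real_inner_comm]
  simp
  ring

/-- The Levi-Civita connection of `X`, by Koszul's formula:
`∇_v Y = ∑ a b, ⟨e_b, v⟩ ⟨∇_{e_b} Y, e_a⟩ e_a` in an orthonormal basis of the tangent space. -/
def leviCivita : CovariantDerivative (𝓡 4) R4 (TangentSpace (𝓡 4) : X → Type) where
  toFun Y x := ∑ a, ∑ b, (2⁻¹ * koszul (frame x b) Y (frame x a) x) •
    (innerSL ℝ (onb x b)).smulRight (onb x a)
  isCovariantDerivativeOnUniv :=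
    { add := by
        intro Y Y' x hY hY' _
        simp only [koszul_add x _ Y Y' _ (frame_mdiff x _) hY hY' (frame_mdiff x _), mul_add,
          add_smul, Finset.sum_add_distrib]
      leibniz := by
        intro Y f x hY hf _
        simp only [koszul_smul x _ Y _ f (frame_mdiff x _) hY (frame_mdiff x _) hf]
        ext v
        simp only [mul_add, add_smul, Finset.sum_add_distrib]
        have hf1 : ∀ a, frame x a x = onb x a := fun a ↦ FiberBundle.extend_apply_self R4 _
        have h1 : ∑ b, ⟪onb x b, v⟫_ℝ * mvfderiv (𝓡 4) f x (onb x b)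
            = mvfderiv (𝓡 4) f x v := by
          conv_rhs => rw [← (onb x).sum_repr' v, map_sum]
          simp only [map_smul, smul_eq_mul]
        have h2 : ∑ a, ⟪Y x, onb x a⟫_ℝ • onb x a = Y x := by
          conv_rhs => rw [← (onb x).sum_repr' (Y x)]
          simp only [real_inner_comm]
        have h3 : ∑ a, ∑ b, (2⁻¹ * (2 * (mvfderiv (𝓡 4) f x (frame x b x)
              * ⟪Y x, frame x a x⟫_ℝ))) • ⟪onb x b, v⟫_ℝ • onb x a
            = mvfderiv (𝓡 4) f x v • Y x := by
          rw [← h1]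
          conv_rhs => rw [← h2]
          rw [Finset.smul_sum]
          refine Finset.sum_congr rfl fun a _ ↦ ?_
          rw [smul_smul, Finset.sum_mul, Finset.sum_smul]
          refine Finset.sum_congr rfl fun b _ ↦ ?_
          rw [smul_smul, hf1, hf1]
          congr 1
          ring
        simp only [add_apply, smul_apply, sum_apply, ContinuousLinearMap.smulRight_apply,
          innerSL_apply_apply]
        rw [h3]
        congr 1
        simp only [Finset.smul_sum, smul_smul]
        refine Finset.sum_congr rfl fun a _ ↦ Finset.sum_congr rfl fun b _ ↦ ?_
        congr 1
        ring }

end Manifold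

section Curvature

variable {X : Type u} [TopologicalSpace X] [ChartedSpace R4 X] [IsManifold (𝓡 4) ∞ X]

/-- The curvature of a connection `∇` at `x`: for tangent vectors `w, z` at `x`, extended to vector
fields `W, Z`, and a section `σ`, this is `∇_W ∇_Z σ - ∇_Z ∇_W σ - ∇_{[W, Z]} σ` at `x`. -/
def curv {F : Type*} [NormedAddCommGroup F] [NormedSpace ℝ F] {V : X → Type*}
    [TopologicalSpace (TotalSpace F V)] [∀ x, AddCommGroup (V x)] [∀ x, Module ℝ (V x)]
    [∀ x, TopologicalSpace (V x)] [∀ x, IsTopologicalAddGroup (V x)]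
    [∀ x, ContinuousSMul ℝ (V x)] [FiberBundle F V]
    (D : CovariantDerivative (𝓡 4) F V) (σ : Π x : X, V x) (x : X)
    (w z : TangentSpace (𝓡 4) x) : V x :=
  D (fun y ↦ D σ y (FiberBundle.extend R4 z y)) x w
    - D (fun y ↦ D σ y (FiberBundle.extend R4 w y)) x z
    - D σ x (VectorField.mlieBracket (𝓡 4) (FiberBundle.extend R4 w) (FiberBundle.extend R4 z) x)

variable [RiemannianBundle (TangentSpace (𝓡 4) : X → Type)]

/-- The scalar curvature `s = ∑ a b, ⟨R(e_a, e_b) e_b, e_a⟩` of `X`. -/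
def scalarCurvature [IsContMDiffRiemannianBundle (𝓡 4) ∞ R4 (TangentSpace (𝓡 4) : X → Type)]
    (x : X) : ℝ :=
  ∑ a, ∑ b, ⟪curv leviCivita (frame x b) x (onb x a) (onb x b), onb x a⟫_ℝ

variable (X) in
/-- An orientation of `X`: an orientation of each tangent space such that there are positively
oriented smooth local frames around each point. -/
structure ManifoldOrientation where
  orient (x : X) : Orientation ℝ (TangentSpace (𝓡 4) x) (Fin 4)
  locallyConstant (x₀ : X) : ∃ U ∈ 𝓝 x₀, ∃ s : Fin 4 → Π x : X, TangentSpace (𝓡 4) x,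
    ∃ hs : IsLocalFrameOn (𝓡 4) R4 ∞ s U,
      ∀ (x : X) (hx : x ∈ U), (hs.toBasisAt hx).orientation = orient x

/-- The Hodge star of a 2-form `θ` at `x` with values in `A`. -/
def hodgeStar (o : ManifoldOrientation X) {A : Type*} [AddCommGroup A] [Module ℝ A] {x : X}
    (θ : TangentSpace (𝓡 4) x → TangentSpace (𝓡 4) x → A) (w z : TangentSpace (𝓡 4) x) : A :=
  (2⁻¹ : ℝ) • ∑ a, ∑ b,
    (o.orient x).volumeForm ![w, z, onb x a, onb x b] • θ (onb x a) (onb x b)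

/-- The self-dual part `θ⁺ = (θ + *θ) / 2` of a 2-form `θ` at `x` with values in `A`. -/
def selfDualPart (o : ManifoldOrientation X) {A : Type*} [AddCommGroup A] [Module ℝ A] {x : X}
    (θ : TangentSpace (𝓡 4) x → TangentSpace (𝓡 4) x → A) (w z : TangentSpace (𝓡 4) x) : A :=
  (2⁻¹ : ℝ) • (θ w z + hodgeStar o θ w z)

/-- The norm `|θ| = (∑ a b, |θ(e_a, e_b)|²)^{1/2}` of a 2-form `θ` at `x`, as a tensor. With the
convention `γ(v)² = -|v|²`, this is for an imaginary-valued self-dual form `θ` the operator norm of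
`γ(θ)` on the positive spinors. -/
def formNorm {x : X} (θ : TangentSpace (𝓡 4) x → TangentSpace (𝓡 4) x → ℂ) : ℝ :=
  √(∑ a, ∑ b, ‖θ (onb x a) (onb x b)‖ ^ 2)

/-- The space `Ω²₊(X; iℝ)` of smooth imaginary-valued self-dual 2-forms on `X`. -/
structure ImagSelfDualForm (o : ManifoldOrientation X) where
  form (x : X) : TangentSpace (𝓡 4) x →ₗ[ℝ] TangentSpace (𝓡 4) x →ₗ[ℝ] ℂ
  alternating (x : X) (w : TangentSpace (𝓡 4) x) : form x w w = 0
  imaginary (x : X) (w z : TangentSpace (𝓡 4) x) : (form x w z).re = 0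
  selfDual (x : X) (w z : TangentSpace (𝓡 4) x) :
    hodgeStar o (fun w z ↦ form x w z) w z = form x w z
  smooth (W Z : Π x : X, TangentSpace (𝓡 4) x) (hW : SmoothSec R4 W) (hZ : SmoothSec R4 Z) :
    ContMDiff (𝓡 4) 𝓘(ℝ, ℂ) ∞ (fun x ↦ form x (W x) (Z x))

end Curvature

/-! ## Hermitian bundles and unitary connections -/

section Bundles

/-- The Hermitian vector space `ℂⁿ`. -/
abbrev Cn (n : ℕ) : Type := EuclideanSpace ℂ (Fin n)

/-- A smooth Hermitian vector bundle of rank `n` over `X`. -/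
structure HermitianBundle (X : Type u) [TopologicalSpace X] [ChartedSpace R4 X] (n : ℕ) where
  fiber : X → Type v
  [normed : ∀ x, NormedAddCommGroup (fiber x)]
  [inner : ∀ x, InnerProductSpace ℂ (fiber x)]
  [topology : TopologicalSpace (TotalSpace (Cn n) fiber)]
  [fiberBundle : FiberBundle (Cn n) fiber]
  [complexBundle : VectorBundle ℂ (Cn n) fiber]
  [realBundle : VectorBundle ℝ (Cn n) fiber]
  [smoothBundle : ContMDiffVectorBundle ∞ (Cn n) fiber (𝓡 4)]
  smoothMetric :
    letI (x : X) : InnerProductSpace ℝ (fiber x) := InnerProductSpace.complexToReal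
    IsContMDiffRiemannianBundle (𝓡 4) ∞ (Cn n) fiber

attribute [instance] HermitianBundle.normed HermitianBundle.inner HermitianBundle.topology
  HermitianBundle.fiberBundle HermitianBundle.complexBundle HermitianBundle.realBundle
  HermitianBundle.smoothBundle

variable {X : Type u} [TopologicalSpace X] [ChartedSpace R4 X] {n : ℕ}

instance (V : HermitianBundle.{u, v} X n) (x : X) : FiniteDimensional ℂ (V.fiber x) :=
  FiniteDimensional.of_injective
    ((trivializationAt (Cn n) V.fiber x).continuousLinearEquivAt ℂ x
      (FiberBundle.mem_baseSet_trivializationAt' x)).toLinearMap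
    (ContinuousLinearEquiv.injective _)

/-- A smooth unitary connection on the Hermitian bundle `V`. -/
structure UnitaryConnection (V : HermitianBundle.{u, v} X n) [IsManifold (𝓡 4) ∞ X] where
  cov : CovariantDerivative (𝓡 4) (Cn n) V.fiber
  smooth : CovariantDerivative.ContMDiffCovariantDerivative cov ∞
  complexLinear (σ : Π x : X, V.fiber x) (x : X) (hσ : DiffSecAt (Cn n) σ x)
    (w : TangentSpace (𝓡 4) x) :
    cov (fun y ↦ Complex.I • σ y) x w = Complex.I • cov σ x w
  unitary (σ σ' : Π x : X, V.fiber x) (x : X) (hσ : DiffSecAt (Cn n) σ x)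
    (hσ' : DiffSecAt (Cn n) σ' x) (w : TangentSpace (𝓡 4) x) :
    mvfderiv (𝓡 4) (fun y ↦ ⟪σ y, σ' y⟫_ℂ) x w = ⟪cov σ x w, σ' x⟫_ℂ + ⟪σ x, cov σ' x w⟫_ℂ

/-- The `j`-th section of the local frame of `V` around `x₀` given by a local trivialization. -/
def locFrame (V : HermitianBundle.{u, v} X n) (x₀ : X) (j : Fin n) (x : X) : V.fiber x :=
  (trivializationAt (Cn n) V.fiber x₀).symm x (EuclideanSpace.basisFun (Fin n) ℂ j)

/-- The `j`-th coordinate of vectors of `V` in the local frame `locFrame V x₀`. -/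
def locCoord (V : HermitianBundle.{u, v} X n) (x₀ : X) (j : Fin n) (x : X) :
    V.fiber x →ₗ[ℂ] ℂ :=
  (EuclideanSpace.basisFun (Fin n) ℂ).toBasis.coord j ∘ₗ
    (trivializationAt (Cn n) V.fiber x₀).linearMapAt ℂ x

variable [IsManifold (𝓡 4) ∞ X]

/-- The curvature `F(w, z) ∈ End(V_x)` of the unitary connection `A`. -/
def UnitaryConnection.curvature {V : HermitianBundle.{u, v} X n} (A : UnitaryConnection V) (x : X)
    (w z : TangentSpace (𝓡 4) x) : End ℂ (V.fiber x) :=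
  ∑ j, (locCoord V x j x).smulRight (curv A.cov (locFrame V x j) x w z)

variable {m : ℕ}

/-- The component `ψ_j` of the section `Ψ` of `S ⊗ E`, where `Ψ = ∑ j, ψ_j ⊗ f_j` for the local
frame `f_j` of `E` around `x₀`. -/
def component {S : HermitianBundle.{u, v} X m} {E : HermitianBundle.{u, v} X n}
    (Ψ : Π x : X, S.fiber x ⊗[ℂ] E.fiber x) (x₀ : X) (j : Fin n) (x : X) : S.fiber x :=
  TensorProduct.rid ℂ (S.fiber x) ((locCoord E x₀ j x).lTensor (S.fiber x) (Ψ x))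

/-- A section `Ψ` of `S ⊗ E` is smooth if its components with respect to local frames of `E` are
smooth sections of `S`. -/
def SmoothTensorSec {S : HermitianBundle.{u, v} X m} {E : HermitianBundle.{u, v} X n}
    (Ψ : Π x : X, S.fiber x ⊗[ℂ] E.fiber x) : Prop :=
  ∀ (x₀ : X) (j : Fin n),
    SmoothSecOn (Cn m) (component Ψ x₀ j) (trivializationAt (Cn n) E.fiber x₀).baseSet

/-- The tensor product connection `∇_B ⊗ ∇_A` on `S ⊗ E`: if `Ψ = ∑ j, ψ_j ⊗ f_j` near `x`, then
`∇_w Ψ = ∑ j, ∇_w ψ_j ⊗ f_j + ψ_j ⊗ ∇_w f_j`. -/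
def tensorCov {S : HermitianBundle.{u, v} X m} {E : HermitianBundle.{u, v} X n}
    (B : UnitaryConnection S) (A : UnitaryConnection E)
    (Ψ : Π x : X, S.fiber x ⊗[ℂ] E.fiber x) (x : X) (w : TangentSpace (𝓡 4) x) :
    S.fiber x ⊗[ℂ] E.fiber x :=
  ∑ j, (B.cov (component Ψ x j) x w ⊗ₜ[ℂ] locFrame E x j x
    + component Ψ x j x ⊗ₜ[ℂ] A.cov (locFrame E x j) x w)

end Bundles

/-! ## `Spin^c` structures, the Dirac operator and the monopole equations -/

section SpinC

variable {X : Type u} [TopologicalSpace X] [ChartedSpace R4 X] [IsManifold (𝓡 4) ∞ X]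
  [RiemannianBundle (TangentSpace (𝓡 4) : X → Type)]
  {o : ManifoldOrientation X}

/-- A `Spin^c` structure on `X`: Hermitian rank 2 bundles `S⁺` and `S⁻` with a Clifford
multiplication `γ` by tangent vectors (identified with covectors through the metric) which maps
`S⁺` to `S⁻`, and `S⁻` to `S⁺` by `- γ^*`. It is normalized by `γ(v)^* γ(v) = |v|²`, and it is
compatible with the orientation: `γ(e₁) γ(e₂) γ(e₃) γ(e₄) = -1` on `S⁺` for positively oriented
orthonormal bases, i.e. self-dual 2-forms act trivially on `S⁻`. -/
structure SpinCStructure (o : ManifoldOrientation X) where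
  plus : HermitianBundle.{u, v} X 2
  minus : HermitianBundle.{u, v} X 2
  gammaPlus (x : X) : TangentSpace (𝓡 4) x →ₗ[ℝ] plus.fiber x →ₗ[ℂ] minus.fiber x
  gammaMinus (x : X) : TangentSpace (𝓡 4) x →ₗ[ℝ] minus.fiber x →ₗ[ℂ] plus.fiber x
  smooth (W : Π x : X, TangentSpace (𝓡 4) x) (s : Π x : X, plus.fiber x)
    (hW : SmoothSec R4 W) (hs : SmoothSec (Cn 2) s) :
    SmoothSec (Cn 2) (fun x ↦ gammaPlus x (W x) (s x))
  skew (x : X) (w : TangentSpace (𝓡 4) x) (s : plus.fiber x) (t : minus.fiber x) :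
    ⟪gammaPlus x w s, t⟫_ℂ = -⟪s, gammaMinus x w t⟫_ℂ
  clifford (x : X) (w : TangentSpace (𝓡 4) x) (s : plus.fiber x) :
    gammaMinus x w (gammaPlus x w s) = -((‖w‖ ^ 2 : ℝ) : ℂ) • s
  oriented (x : X) (e : OrthonormalBasis (Fin 4) ℝ (TangentSpace (𝓡 4) x))
    (he : e.toBasis.orientation = o.orient x) (s : plus.fiber x) :
    gammaMinus x (e 0) (gammaPlus x (e 1) (gammaMinus x (e 2) (gammaPlus x (e 3) s))) = -s

/-- A `Spin^c` connection: unitary connections on `S⁺` and `S⁻` for which, together with the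
Levi-Civita connection, Clifford multiplication is parallel. -/
structure SpinCConnection [IsContMDiffRiemannianBundle (𝓡 4) ∞ R4 (TangentSpace (𝓡 4) : X → Type)]
    (𝔰 : SpinCStructure.{u, v} o) where
  plus : UnitaryConnection 𝔰.plus
  minus : UnitaryConnection 𝔰.minus
  parallel (W : Π x : X, TangentSpace (𝓡 4) x) (s : Π x : X, 𝔰.plus.fiber x) (x : X)
    (hW : DiffSecAt R4 W x) (hs : DiffSecAt (Cn 2) s x) (w : TangentSpace (𝓡 4) x) :
    minus.cov (fun y ↦ 𝔰.gammaPlus y (W y) (s y)) x w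
      = 𝔰.gammaPlus x (leviCivita W x w) (s x) + 𝔰.gammaPlus x (W x) (plus.cov s x w)

variable {𝔰 : SpinCStructure.{u, v} o} {n : ℕ} {E : HermitianBundle.{u, v} X n}

/-- Clifford multiplication `γ(w) γ(z)` on `S⁺`. -/
def gammaTwo (𝔰 : SpinCStructure.{u, v} o) (x : X) (w z : TangentSpace (𝓡 4) x) :
    End ℂ (𝔰.plus.fiber x) :=
  𝔰.gammaMinus x w ∘ₗ 𝔰.gammaPlus x z

/-- Clifford multiplication `γ(θ) = ∑ a < b, θ(e_a, e_b) γ(e_a) γ(e_b)` on `S⁺` by a complex-valued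
2-form `θ`. -/
def gammaForm (𝔰 : SpinCStructure.{u, v} o) {x : X}
    (θ : TangentSpace (𝓡 4) x → TangentSpace (𝓡 4) x → ℂ) : End ℂ (𝔰.plus.fiber x) :=
  (2⁻¹ : ℂ) • ∑ a, ∑ b, θ (onb x a) (onb x b) • gammaTwo 𝔰 x (onb x a) (onb x b)

/-- Clifford multiplication `γ(F) = ∑ a < b, γ(e_a) γ(e_b) ⊗ F(e_a, e_b)` on `S⁺ ⊗ E` by a 2-form
`F` with values in `End(E)`. -/
def gammaEndForm (𝔰 : SpinCStructure.{u, v} o) (E : HermitianBundle.{u, v} X n) {x : X}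
    (F : TangentSpace (𝓡 4) x → TangentSpace (𝓡 4) x → End ℂ (E.fiber x)) :
    End ℂ (𝔰.plus.fiber x ⊗[ℂ] E.fiber x) :=
  (2⁻¹ : ℂ) • ∑ a, ∑ b,
    TensorProduct.map (gammaTwo 𝔰 x (onb x a) (onb x b)) (F (onb x a) (onb x b))

variable [IsContMDiffRiemannianBundle (𝓡 4) ∞ R4 (TangentSpace (𝓡 4) : X → Type)]

/-- The Dirac operator `D_A Ψ = ∑ a, γ(e_a) ∇_{e_a} Ψ` for the connection `∇_B ⊗ ∇_A`. -/
def dirac (B : SpinCConnection 𝔰) (A : UnitaryConnection E)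
    (Ψ : Π x : X, 𝔰.plus.fiber x ⊗[ℂ] E.fiber x) (x : X) :
    𝔰.minus.fiber x ⊗[ℂ] E.fiber x :=
  ∑ a, (𝔰.gammaPlus x (onb x a)).rTensor (E.fiber x) (tensorCov B.plus A Ψ x (onb x a))

/-- `(Ψ, A)`, with `Ψ` a smooth section of `S⁺ ⊗ E` and `A` a smooth unitary connection on `E`, is
a solution of the `U(n)` monopole equations with parameter `τ` and perturbation `η`. -/
structure IsMonopole (B : SpinCConnection 𝔰) (η : ImagSelfDualForm o) (τ : ℝ)
    (Ψ : Π x : X, 𝔰.plus.fiber x ⊗[ℂ] E.fiber x) (A : UnitaryConnection E) : Prop where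
  smooth : SmoothTensorSec Ψ
  dirac_eq (x : X) : dirac B A Ψ x = 0
  curvature_eq (x : X) :
    gammaEndForm 𝔰 E (selfDualPart o (A.curvature x)) - mu τ (Ψ x)
      = TensorProduct.map (gammaForm 𝔰 (fun w z ↦ η.form x w z)) LinearMap.id

/-- The function `-s/4 + |tr F_B⁺|/2 + |η|` on `X`. -/
def boundFunction (B : SpinCConnection 𝔰) (η : ImagSelfDualForm o) (x : X) : ℝ :=
  -scalarCurvature x / 4
    + formNorm (selfDualPart o
        (fun w z ↦ LinearMap.trace ℂ (𝔰.plus.fiber x) (B.plus.curvature x w z))) / 2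
    + formNorm (fun w z ↦ η.form x w z)

end SpinC

end UnMonopole

end

set_option linter.unusedSectionVars false
set_option linter.unusedSimpArgs false

noncomputable section

namespace UnMonopole

/-! ### Cut-off of local sections and functions -/

section SmoothSections

variable {X : Type u} [TopologicalSpace X] [ChartedSpace R4 X]
  {F : Type*} [NormedAddCommGroup F] [NormedSpace ℝ F] {V : X → Type*}
  [TopologicalSpace (TotalSpace F V)] [∀ x, AddCommGroup (V x)] [∀ x, Module ℝ (V x)]
  [∀ x, TopologicalSpace (V x)] [FiberBundle F V] [VectorBundle ℝ F V]

/-! The bound is the maximum principle for |Ψ|², with c = 1/2. For a solution of the Dirac equation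
the Weitzenböck formula computes the rough Laplacian: in an orthonormal frame, Σ_a ∇²_{e_a,e_a}Ψ
equals (s/4)Ψ + ½γ(tr F_B⁺)Ψ + γ(F_A)Ψ, and the curvature equation replaces γ(F_A) by μ_{0,τ}(Ψ) +
γ(η) (`IsMonopole.sum_secondCov`). At a local maximum of |Ψ|² the real inner product of Ψ with the
left side is at most 0 (`re_inner_tensorCov_of_isLocalMax`). On the right, γ(θ) for an imaginary
2-form θ has norm at most |θ| (`norm_gammaForm_le`), and Re⟨Ψ, μ_{0,τ}(Ψ)Ψ⟩ ≥ |Ψ|⁴/4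
(`norm_pow_four_le_mu`). Hence |Ψ|⁴/4 ≤ K|Ψ|² at the maximum, so either Ψ vanishes there, and then
everywhere, or |Ψ|² ≤ 4K.

Uniformity in τ and n holds because the P-part alone supplies the constant 1/4 for every n ≥ 2,
while the Q-part is nonnegative.

The scalar curvature term rests on S⁺ having rank 2: the products γ(e₀)γ(e_a), a = 1, 2, 3, satisfy
the quaternion relations (`gammaTwo_quaternionic`). Parallelism of Clifford multiplication
prescribes the commutators of F_B with them, so F_B is determined by the Riemann tensor and its own
trace (`curvature_eq`). The contraction of F_B with Clifford multiplication then sees only the trace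
of the self-dual block of the Riemann tensor, which the Bianchi identity evaluates to −s/2.

Two devices carry the analysis. Quantities defined pointwise, through chosen bases and extensions of
vectors, are identified by tensoriality with operators on globally smooth fields (`covCurv`,
`inner_leviCivita`). Smooth sections of S ⊗ E are locally finite sums of products φ ⊗ g
(`exists_tensorSections_eq`), and identities for the tensor product connection are checked on
products. -/

theorem SmoothSec.diffSecAt {σ : Π x : X, V x} (h : SmoothSec F σ) (x : X) : DiffSecAt F σ x :=
  (h x).mdifferentiableAt (by simp)

/-- Multiplication by a bump function that is 1 near `x₀` and supported in `U`. Covariant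
derivatives at a point depend only on germs, so local frames and extensions can be traded for global
sections. -/
theorem exists_smoothSec_eventuallyEq [T2Space X] [IsManifold (𝓡 4) ∞ X]
    {σ : Π x : X, V x} {x₀ : X} {U : Set X}
    (hU : U ∈ 𝓝 x₀) (hσ : SmoothSecOn F σ U) :
    ∃ σ' : Π x : X, V x, SmoothSec F σ' ∧ ∀ᶠ y in 𝓝 x₀, σ' y = σ y := by
  obtain ⟨U', hU', hU'o, hx⟩ := mem_nhds_iff.1 hU
  obtain ⟨f, -, hf⟩ := (SmoothBumpFunction.nhds_basis_tsupport (I := 𝓡 4) x₀).mem_iff.1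
    (hU'o.mem_nhds hx)
  refine ⟨(f : X → ℝ) • σ, ContMDiffOn.smul_section_of_tsupport (u := U') f.contMDiff.contMDiffOn
    hU'o hf (hσ.mono hU'), ?_⟩
  filter_upwards [f.eventuallyEq_one] with y hy
  simp [hy]

theorem exists_contMDiff_eventuallyEq {G : Type*} [NormedAddCommGroup G] [NormedSpace ℝ G]
    [T2Space X] [IsManifold (𝓡 4) ∞ X] {f : X → G} {x₀ : X} {U : Set X}
    (hU : U ∈ 𝓝 x₀) (hf : ContMDiffOn (𝓡 4) 𝓘(ℝ, G) ∞ f U) :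
    ∃ f' : X → G, ContMDiff (𝓡 4) 𝓘(ℝ, G) ∞ f' ∧ ∀ᶠ y in 𝓝 x₀, f' y = f y := by
  obtain ⟨U', hU', hU'o, hx⟩ := mem_nhds_iff.1 hU
  obtain ⟨g, -, hg⟩ := (SmoothBumpFunction.nhds_basis_tsupport (I := 𝓡 4) x₀).mem_iff.1
    (hU'o.mem_nhds hx)
  refine ⟨fun y ↦ g y • f y, contMDiff_of_tsupport fun x hxt ↦ ?_, ?_⟩
  · have hxU : x ∈ U' := hg (tsupport_smul_subset_left _ _ hxt)
    exact (g.contMDiff x).smul (((hf.mono hU') x hxU).contMDiffAt (hU'o.mem_nhds hxU))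
  · filter_upwards [g.eventuallyEq_one] with y hy
    simp [hy]

end SmoothSections

/-! ### Smooth oriented orthonormal frames -/

section OrthonormalFrame

variable {X : Type u} [TopologicalSpace X] [ChartedSpace R4 X] [IsManifold (𝓡 4) ∞ X]
  [RiemannianBundle (TangentSpace (𝓡 4) : X → Type)]
  [IsContMDiffRiemannianBundle (𝓡 4) ∞ R4 (TangentSpace (𝓡 4) : X → Type)]

/-- Each Gram–Schmidt vector is a rational expression in inner products with earlier ones, and the
denominators do not vanish on linearly independent vectors. -/
theorem smoothSecOn_gramSchmidt {s : Fin 4 → Π x : X, TangentSpace (𝓡 4) x} {U : Set X}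
    (hs : ∀ a, SmoothSecOn R4 (s a) U) (hl : ∀ y ∈ U, LinearIndependent ℝ (s · y)) (n : Fin 4) :
    SmoothSecOn R4 (fun y ↦ InnerProductSpace.gramSchmidt ℝ (s · y) n) U := by
  induction n using WellFoundedLT.induction with
  | ind n ih =>
    have h : SmoothSecOn R4 (s n - fun y ↦ ∑ i ∈ Finset.Iio n,
        (⟪InnerProductSpace.gramSchmidt ℝ (s · y) i, s n y⟫_ℝ
          / ⟪InnerProductSpace.gramSchmidt ℝ (s · y) i,
            InnerProductSpace.gramSchmidt ℝ (s · y) i⟫_ℝ) •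
          InnerProductSpace.gramSchmidt ℝ (s · y) i) U := by
      refine (hs n).sub_section (ContMDiffOn.sum_section fun i hi ↦ ?_)
      have hi' := ih i (Finset.mem_Iio.1 hi)
      refine ContMDiffOn.smul_section (f := fun y ↦
        ⟪InnerProductSpace.gramSchmidt ℝ (s · y) i, s n y⟫_ℝ
          / ⟪InnerProductSpace.gramSchmidt ℝ (s · y) i,
            InnerProductSpace.gramSchmidt ℝ (s · y) i⟫_ℝ) ?_ hi'
      refine ContMDiffOn.div₀ (hi'.inner_bundle (hs n)) (hi'.inner_bundle hi') fun y hy ↦ ?_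
      rw [ne_eq, inner_self_eq_zero]
      exact InnerProductSpace.gramSchmidt_ne_zero i (hl y hy)
    refine h.congr fun y hy ↦ ?_
    simp only [Pi.sub_apply]
    rw [InnerProductSpace.gramSchmidt_def]
    simp only [Submodule.starProjection_singleton, real_inner_self_eq_norm_sq]
    rfl

/-- Gram–Schmidt applied to an oriented local frame and then cut off: the fields are smooth
everywhere, but orthonormal only near `x₀`. -/
theorem exists_orthonormal_frame [T2Space X] (o : ManifoldOrientation X) (x₀ : X) :
    ∃ E : Fin 4 → Π x : X, TangentSpace (𝓡 4) x, (∀ a, SmoothSec R4 (E a)) ∧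
      ∀ᶠ y in 𝓝 x₀, ∃ e : OrthonormalBasis (Fin 4) ℝ (TangentSpace (𝓡 4) y),
        (∀ a, E a y = e a) ∧ e.toBasis.orientation = o.orient y := by
  obtain ⟨U, hU, s, hs, ho⟩ := o.locallyConstant x₀
  have hg := smoothSecOn_gramSchmidt hs.contMDiffOn (fun y hy ↦ hs.linearIndependent hy)
  have hne : ∀ n, ∀ y ∈ U, InnerProductSpace.gramSchmidt ℝ (s · y) n ≠ 0 := fun n y hy ↦
    InnerProductSpace.gramSchmidt_ne_zero n (hs.linearIndependent hy)
  have hn : ∀ n, SmoothSecOn R4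
      (fun y ↦ InnerProductSpace.gramSchmidtNormed ℝ (s · y) n) U := by
    intro n
    have h : SmoothSecOn R4 ((fun y ↦ (Real.sqrt ⟪InnerProductSpace.gramSchmidt ℝ (s · y) n,
        InnerProductSpace.gramSchmidt ℝ (s · y) n⟫_ℝ)⁻¹) •
        fun y ↦ InnerProductSpace.gramSchmidt ℝ (s · y) n) U := by
      refine ContMDiffOn.smul_section (ContMDiffOn.inv₀ ?_ ?_) (hg n)
      · intro y hy
        have h0 : ⟪InnerProductSpace.gramSchmidt ℝ (s · y) n,
            InnerProductSpace.gramSchmidt ℝ (s · y) n⟫_ℝ ≠ 0 := by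
          rw [ne_eq, inner_self_eq_zero]
          exact hne n y hy
        exact (Real.contDiffAt_sqrt h0).contMDiffAt.comp_contMDiffWithinAt y
          (((hg n).inner_bundle (hg n)) y hy)
      · intro y hy
        rw [real_inner_self_eq_norm_sq, Real.sqrt_sq (norm_nonneg _)]
        exact norm_ne_zero_iff.2 (hne n y hy)
    refine h.congr fun y hy ↦ ?_
    simp only [InnerProductSpace.gramSchmidtNormed, Pi.smul_apply', real_inner_self_eq_norm_sq,
      Real.sqrt_sq (norm_nonneg _)]
    rfl
  choose E hE hEe using fun n ↦ exists_smoothSec_eventuallyEq hU (hn n)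
  refine ⟨E, hE, ?_⟩
  filter_upwards [Filter.eventually_all.2 hEe, hU] with y hy hyU
  have hfin : finrank ℝ (TangentSpace (𝓡 4) y) = Fintype.card (Fin 4) := by
    rw [Fintype.card_fin]; exact Fact.out
  have hne' : ∀ n, InnerProductSpace.gramSchmidtNormed ℝ (s · y) n ≠ 0 := by
    intro n
    rw [← norm_ne_zero_iff,
      InnerProductSpace.gramSchmidtNormed_unit_length n (hs.linearIndependent hyU)]
    norm_num
  refine ⟨InnerProductSpace.gramSchmidtOrthonormalBasis hfin (s · y), fun a ↦ ?_, ?_⟩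
  · rw [hy, InnerProductSpace.gramSchmidtOrthonormalBasis_apply hfin (hne' a)]
  · rw [← ho y hyU]
    rw [Basis.orientation_eq_iff_det_pos]
    -- The change of basis is triangular, so its determinant is the product of its diagonal entries.
    -- Each entry is positive, since the original vector is its unnormalized Gram–Schmidt vector
    -- plus a combination of earlier directions.
    have hob : ((InnerProductSpace.gramSchmidtOrthonormalBasis hfin (s · y)).toBasis).det
        (hs.toBasisAt hyU) = ∏ i, ⟪InnerProductSpace.gramSchmidtOrthonormalBasis hfin (s · y) i,
          s i y⟫_ℝ := by
      rw [← InnerProductSpace.gramSchmidtOrthonormalBasis_det hfin (s · y)]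
      congr 1
      ext i
      exact hs.toBasisAt_coe hyU i
    rw [hob]
    refine Finset.prod_pos fun i _ ↦ ?_
    rw [InnerProductSpace.gramSchmidtOrthonormalBasis_apply hfin (hne' i),
      InnerProductSpace.gramSchmidtNormed, inner_smul_left]
    refine mul_pos (by simpa using hne i y hyU) ?_
    conv_rhs => rw [InnerProductSpace.gramSchmidt_def'' ℝ (s · y) i]
    rw [inner_add_right, inner_sum, Finset.sum_eq_zero, add_zero]
    · exact real_inner_self_pos.2 (hne i y hyU)
    · intro j hj
      rw [inner_smul_right, InnerProductSpace.gramSchmidt_orthogonal ℝ _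
        (Finset.mem_Iio.1 hj).ne', mul_zero]

end OrthonormalFrame

theorem two_le_infty : (2 : ℕ∞ω) ≤ ∞ := ENat.LEInfty.out

theorem three_le_infty : (3 : ℕ∞ω) ≤ ∞ := ENat.LEInfty.out

/-! ### Regularity exponents for Lie brackets -/

section Regularity

variable {X : Type u} [TopologicalSpace X] [ChartedSpace R4 X] [IsManifold (𝓡 4) ∞ X]

theorem isManifold_minSmoothness_two : IsManifold (𝓡 4) (minSmoothness ℝ 2) X := by
  rw [minSmoothness_of_isRCLikeNormedField]
  exact IsManifold.of_le two_le_infty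

theorem isManifold_minSmoothness_three : IsManifold (𝓡 4) (minSmoothness ℝ 3) X := by
  rw [minSmoothness_of_isRCLikeNormedField]
  exact IsManifold.of_le three_le_infty

theorem isManifold_infty_add_one : IsManifold (𝓡 4) (∞ + 1) X :=
  inferInstanceAs (IsManifold (𝓡 4) ∞ X)

end Regularity

attribute [local instance] isManifold_minSmoothness_two isManifold_minSmoothness_three
  isManifold_infty_add_one

/-! ### Vector fields as derivations -/

section Derivations

variable {X : Type u} [TopologicalSpace X] [ChartedSpace R4 X] [IsManifold (𝓡 4) ∞ X]

theorem contMDiff_mvfderiv_apply {G : Type*} [NormedAddCommGroup G] [NormedSpace ℝ G] {f : X → G}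
    (hf : ContMDiff (𝓡 4) 𝓘(ℝ, G) ∞ f) {W : Π x : X, TangentSpace (𝓡 4) x} (hW : SmoothSec R4 W) :
    ContMDiff (𝓡 4) 𝓘(ℝ, G) ∞ (fun y ↦ mvfderiv (𝓡 4) f y (W y)) :=
  (contMDiff_snd_tangentBundle_modelSpace G 𝓘(ℝ, G)).comp
    ((hf.contMDiff_tangentMap (m := ∞) (by simp)).comp hW)

theorem SmoothSec.mlieBracket {W Z : Π x : X, TangentSpace (𝓡 4) x} (hW : SmoothSec R4 W)
    (hZ : SmoothSec R4 Z) : SmoothSec R4 (VectorField.mlieBracket (𝓡 4) W Z) := fun x ↦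
  ContMDiffAt.mlieBracket_vectorField (m := ⊤) (n := ⊤) (hW x) (hZ x)
    (by rw [minSmoothness_of_isRCLikeNormedField]; simp)

theorem SmoothSec.mdiff {G : Type*} [NormedAddCommGroup G] [NormedSpace ℝ G] {f : X → G}
    (hf : ContMDiff (𝓡 4) 𝓘(ℝ, G) ∞ f) (x : X) : MDifferentiableAt (𝓡 4) 𝓘(ℝ, G) f x :=
  (hf x).mdifferentiableAt (by simp)

/-- The Lie bracket acts on functions as the commutator of derivations. -/
theorem mvfderiv_mlieBracket_of_ne_zero {f : X → ℝ} (hf : ContMDiff (𝓡 4) 𝓘(ℝ, ℝ) ∞ f)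
    {W Z : Π x : X, TangentSpace (𝓡 4) x} (hW : SmoothSec R4 W) (hZ : SmoothSec R4 Z)
    {V : Π x : X, TangentSpace (𝓡 4) x} (hV : SmoothSec R4 V) {x : X} (hx : V x ≠ 0) :
    mvfderiv (𝓡 4) f x (VectorField.mlieBracket (𝓡 4) W Z x)
      = mvfderiv (𝓡 4) (fun y ↦ mvfderiv (𝓡 4) f y (Z y)) x (W x)
        - mvfderiv (𝓡 4) (fun y ↦ mvfderiv (𝓡 4) f y (W y)) x (Z x) := by
  have h2 : ∀ {U : Π x : X, TangentSpace (𝓡 4) x}, SmoothSec R4 U → ∀ y,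
      ContMDiffAt (𝓡 4) ((𝓡 4).prod 𝓘(ℝ, R4)) (minSmoothness ℝ 2)
        (fun y ↦ TotalSpace.mk' R4 y (U y)) y := fun hU y ↦ by
    rw [minSmoothness_of_isRCLikeNormedField]
    exact (hU y).of_le two_le_infty
  -- The Jacobi identity for W, Z, fV, expanded by this Leibniz rule, minus f times the one for W,
  -- Z, V leaves the asserted identity multiplied by the vector `V x`, which is nonzero.
  have key : ∀ {A B : Π x : X, TangentSpace (𝓡 4) x}, SmoothSec R4 A → SmoothSec R4 B →
      VectorField.mlieBracket (𝓡 4) A (VectorField.mlieBracket (𝓡 4) B (f • V)) x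
        = mvfderiv (𝓡 4) (fun y ↦ mvfderiv (𝓡 4) f y (B y)) x (A x) • V x
          + mvfderiv (𝓡 4) f x (B x) • VectorField.mlieBracket (𝓡 4) A V x
          + (mvfderiv (𝓡 4) f x (A x) • VectorField.mlieBracket (𝓡 4) B V x
          + f x • VectorField.mlieBracket (𝓡 4) A (VectorField.mlieBracket (𝓡 4) B V) x) := by
    intro A B hA hB
    have h1 : VectorField.mlieBracket (𝓡 4) B (f • V)
        = (fun y ↦ mvfderiv (𝓡 4) f y (B y)) • V + f • VectorField.mlieBracket (𝓡 4) B V := by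
      funext y
      exact VectorField.mlieBracket_smul_right (SmoothSec.mdiff hf y) (hV.diffSecAt y)
    have h3 := SmoothSec.mdiff (contMDiff_mvfderiv_apply hf hB) x
    have h4 := SmoothSec.mdiff hf x
    rw [h1, VectorField.mlieBracket_add_right (h3.smul_section (hV.diffSecAt x))
      (h4.smul_section ((hB.mlieBracket hV).diffSecAt x)),
      VectorField.mlieBracket_smul_right h3 (hV.diffSecAt x),
      VectorField.mlieBracket_smul_right h4 ((hB.mlieBracket hV).diffSecAt x)]
  have hJ := VectorField.leibniz_identity_mlieBracket_apply (h2 hW x) (h2 hZ x)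
    (h2 (hf.smul_section hV) x)
  have hJ' := VectorField.leibniz_identity_mlieBracket_apply (h2 hW x) (h2 hZ x) (h2 hV x)
  rw [key hW hZ, key hZ hW, VectorField.mlieBracket_smul_right (SmoothSec.mdiff hf x)
    (hV.diffSecAt x), hJ'] at hJ
  rw [← sub_eq_zero]
  refine (smul_eq_zero.1 ?_).resolve_right hx
  rw [← sub_eq_zero] at hJ
  rw [← neg_eq_zero, ← hJ]
  module

theorem exists_smoothSec_ne_zero [T2Space X] (x : X) :
    ∃ V : Π x : X, TangentSpace (𝓡 4) x, SmoothSec R4 V ∧ V x ≠ 0 := by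
  obtain ⟨v, hv⟩ : ∃ v : TangentSpace (𝓡 4) x, v ≠ 0 := exists_ne (α := R4) 0
  obtain ⟨s, hs, h⟩ := FiberBundle.exists_contMDiffOn_extend (𝓡 4) R4 (k := ∞)
    (V := (TangentSpace (𝓡 4) : X → Type)) (x₀ := x) v
  obtain ⟨V, hV, hVe⟩ := exists_smoothSec_eventuallyEq hs h
  refine ⟨V, hV, ?_⟩
  rw [hVe.self_of_nhds, FiberBundle.extend_apply_self]
  exact hv

theorem mvfderiv_mlieBracket [T2Space X] {f : X → ℝ} (hf : ContMDiff (𝓡 4) 𝓘(ℝ, ℝ) ∞ f)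
    {W Z : Π x : X, TangentSpace (𝓡 4) x} (hW : SmoothSec R4 W) (hZ : SmoothSec R4 Z) (x : X) :
    mvfderiv (𝓡 4) f x (VectorField.mlieBracket (𝓡 4) W Z x)
      = mvfderiv (𝓡 4) (fun y ↦ mvfderiv (𝓡 4) f y (Z y)) x (W x)
        - mvfderiv (𝓡 4) (fun y ↦ mvfderiv (𝓡 4) f y (W y)) x (Z x) := by
  obtain ⟨V, hV, hx⟩ := exists_smoothSec_ne_zero x
  exact mvfderiv_mlieBracket_of_ne_zero hf hW hZ hV hx

theorem mvfderiv_congr {G : Type*} [NormedAddCommGroup G] [NormedSpace ℝ G] {f g : X → G} {x : X}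
    (h : f =ᶠ[𝓝 x] g) : mvfderiv (𝓡 4) f x = mvfderiv (𝓡 4) g x := by
  ext v
  simp only [mvfderiv, h.mfderiv_eq]
  rfl

end Derivations

/-! ### Koszul's formula and the Levi-Civita connection -/

section LeviCivita

variable {X : Type u} [TopologicalSpace X] [ChartedSpace R4 X] [IsManifold (𝓡 4) ∞ X]
  [RiemannianBundle (TangentSpace (𝓡 4) : X → Type)]
  [IsContMDiffRiemannianBundle (𝓡 4) ∞ R4 (TangentSpace (𝓡 4) : X → Type)]

/-- Metric compatibility in Koszul form: all bracket terms cancel, and so do the derivatives along Y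
and Z. -/
theorem koszul_rotate (U Y Z : Π x : X, TangentSpace (𝓡 4) x) (x : X) :
    koszul U Y Z x + koszul U Z Y x = 2 * mvfderiv (𝓡 4) (fun y ↦ ⟪Y y, Z y⟫_ℝ) x (U x) := by
  have h1 : ∀ A B : Π x : X, TangentSpace (𝓡 4) x,
      (fun y ↦ ⟪A y, B y⟫_ℝ) = fun y ↦ ⟪B y, A y⟫_ℝ := fun A B ↦
    funext fun y ↦ real_inner_comm _ _
  simp only [koszul]
  rw [VectorField.mlieBracket_swap_apply (V := U) (W := Y),
    VectorField.mlieBracket_swap_apply (V := Y) (W := Z),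
    VectorField.mlieBracket_swap_apply (V := U) (W := Z), h1 Z U, h1 U Y, h1 Z Y]
  simp only [inner_neg_left]
  ring

/-- Vanishing torsion in Koszul form: all derivative terms cancel and only the bracket of U and Y
survives. -/
theorem koszul_swap_sub (U Y Z : Π x : X, TangentSpace (𝓡 4) x) (x : X) :
    koszul U Y Z x - koszul Y U Z x = 2 * ⟪VectorField.mlieBracket (𝓡 4) U Y x, Z x⟫_ℝ := by
  have h1 : ∀ A B : Π x : X, TangentSpace (𝓡 4) x,
      (fun y ↦ ⟪A y, B y⟫_ℝ) = fun y ↦ ⟪B y, A y⟫_ℝ := fun A B ↦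
    funext fun y ↦ real_inner_comm _ _
  simp only [koszul]
  rw [VectorField.mlieBracket_swap_apply (V := Y) (W := U),
    VectorField.mlieBracket_swap_apply (V := Z) (W := Y),
    VectorField.mlieBracket_swap_apply (V := U) (W := Z), h1 Z U, h1 U Y, h1 Z Y]
  simp only [inner_neg_left]
  ring

/-- `koszul_rotate` exchanges the last two slots, so the Leibniz rule already known in the middle
slot applies; the derivative of f it produces cancels against the one in U⟨fZ, Y⟩. -/
theorem tensorialAt_koszul_right {x : X} {U Y : Π x : X, TangentSpace (𝓡 4) x}
    (hU : DiffSecAt R4 U x) (hY : DiffSecAt R4 Y x) :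
    TensorialAt (𝓡 4) R4 (fun Z ↦ koszul U Y Z x) x where
  smul {f Z} hf hZ := by
    have h1 := koszul_smul x U Z Y f hU hZ hY hf
    have h2 := koszul_rotate U (f • Z) Y x
    have h3 := koszul_rotate U Z Y x
    have h4 : (fun y ↦ ⟪(f • Z) y, Y y⟫_ℝ) = fun y ↦ f y * ⟪Z y, Y y⟫_ℝ := by
      funext y
      simp only [Pi.smul_apply', inner_smul_left, conj_trivial]
    rw [h4, mvfderiv_fun_mul hf (diff_inner hZ hY)] at h2
    simp only [add_apply, smul_apply, smul_eq_mul] at h2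
    rw [smul_eq_mul]
    linear_combination h2 - h1 - f x * h3
  add {Z Z'} hZ hZ' := by
    have h1 := koszul_add x U Z Z' Y hU hZ hZ' hY
    have h2 := koszul_rotate U (Z + Z') Y x
    have h3 := koszul_rotate U Z Y x
    have h3' := koszul_rotate U Z' Y x
    have h4 : (fun y ↦ ⟪(Z + Z') y, Y y⟫_ℝ) = fun y ↦ ⟪Z y, Y y⟫_ℝ + ⟪Z' y, Y y⟫_ℝ := by
      funext y
      simp only [Pi.add_apply, inner_add_left]
    rw [h4, mvfderiv_fun_add (diff_inner hZ hY) (diff_inner hZ' hY)] at h2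
    simp only [add_apply] at h2
    linear_combination h2 - h1 - h3 - h3'

/-- The same argument with `koszul_swap_sub`, which exchanges the first two slots; here the
derivative of f cancels against the one in the bracket. -/
theorem tensorialAt_koszul_left {x : X} {Y Z : Π x : X, TangentSpace (𝓡 4) x}
    (hY : DiffSecAt R4 Y x) (hZ : DiffSecAt R4 Z x) :
    TensorialAt (𝓡 4) R4 (fun U ↦ koszul U Y Z x) x where
  smul {f U} hf hU := by
    have h1 := koszul_smul x Y U Z f hY hU hZ hf
    have h2 := koszul_swap_sub (f • U) Y Z x
    have h3 := koszul_swap_sub U Y Z x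
    rw [VectorField.mlieBracket_smul_left hf hU] at h2
    simp only [inner_add_left, inner_smul_left, conj_trivial] at h2
    rw [smul_eq_mul]
    simp at h2
    linear_combination h2 + h1 - f x * h3
  add {U U'} hU hU' := by
    have h1 := koszul_add x Y U U' Z hY hU hU' hZ
    have h2 := koszul_swap_sub (U + U') Y Z x
    have h3 := koszul_swap_sub U Y Z x
    have h3' := koszul_swap_sub U' Y Z x
    rw [VectorField.mlieBracket_add_left hU hU'] at h2
    simp only [inner_add_left] at h2
    linear_combination h2 + h1 - h3 - h3'

/-- `leviCivita` is defined with extensions of a basis at the single point x. Tensoriality of the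
Koszul expression in its first and third slots permits arbitrary differentiable fields instead. -/
theorem inner_leviCivita {x : X} {U Y Z : Π x : X, TangentSpace (𝓡 4) x}
    (hU : DiffSecAt R4 U x) (hY : DiffSecAt R4 Y x) (hZ : DiffSecAt R4 Z x) :
    ⟪leviCivita Y x (U x), Z x⟫_ℝ = 2⁻¹ * koszul U Y Z x := by
  have h := fun (σ : Π x : X, TangentSpace (𝓡 4) x) (hσ : DiffSecAt R4 σ x)
      (τ : Π x : X, TangentSpace (𝓡 4) x) (hτ : DiffSecAt R4 τ x) ↦
    TensorialAt.mkHom₂_apply (Φ := fun U Z ↦ koszul U Y Z x)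
      (fun τ hτ ↦ tensorialAt_koszul_left hY hτ) (fun σ hσ ↦ tensorialAt_koszul_right hσ hY) hσ hτ
  set B := TensorialAt.mkHom₂ (fun U Z ↦ koszul U Y Z x) x
    (fun τ hτ ↦ tensorialAt_koszul_left hY hτ) (fun σ hσ ↦ tensorialAt_koszul_right hσ hY)
  have hf1 : ∀ a, frame x a x = onb x a := fun a ↦ FiberBundle.extend_apply_self R4 _
  rw [← h U hU Z hZ]
  have hU' : ∑ b, ⟪onb x b, U x⟫_ℝ • onb x b = U x := (onb x).sum_repr' (U x)
  have hZ' : ∑ b, ⟪onb x b, Z x⟫_ℝ • onb x b = Z x := (onb x).sum_repr' (Z x)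
  conv_rhs => rw [← hU', ← hZ']
  simp only [leviCivita, sum_apply, smul_apply,
    ContinuousLinearMap.smulRight_apply, innerSL_apply_apply, map_sum, map_smul, sum_inner,
    inner_smul_left, conj_trivial, smul_eq_mul, Finset.mul_sum]
  refine Finset.sum_congr rfl fun a _ ↦ Finset.sum_congr rfl fun b _ ↦ ?_
  rw [← hf1 b, ← hf1 a, h _ (frame_mdiff x b) _ (frame_mdiff x a)]
  ring

/-- The Levi-Civita connection is compatible with the metric. -/
theorem leviCivita_metric {x : X} {U Y Z : Π x : X, TangentSpace (𝓡 4) x}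
    (hU : DiffSecAt R4 U x) (hY : DiffSecAt R4 Y x) (hZ : DiffSecAt R4 Z x) :
    mvfderiv (𝓡 4) (fun y ↦ ⟪Y y, Z y⟫_ℝ) x (U x)
      = ⟪leviCivita Y x (U x), Z x⟫_ℝ + ⟪Y x, leviCivita Z x (U x)⟫_ℝ := by
  rw [inner_leviCivita hU hY hZ, real_inner_comm, inner_leviCivita hU hZ hY]
  linear_combination -(2⁻¹ : ℝ) * koszul_rotate U Y Z x

/-- The Levi-Civita connection is torsion free. -/
theorem leviCivita_torsion {x : X} {U Y : Π x : X, TangentSpace (𝓡 4) x}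
    (hU : DiffSecAt R4 U x) (hY : DiffSecAt R4 Y x) :
    leviCivita Y x (U x) - leviCivita U x (Y x) = VectorField.mlieBracket (𝓡 4) U Y x := by
  refine ext_inner_right ℝ fun v ↦ ?_
  have hZ := FiberBundle.mdifferentiableAt_extend (𝓡 4) R4 v
  have h := FiberBundle.extend_apply_self R4 v
  rw [← h, inner_sub_left, inner_leviCivita hU hY hZ, inner_leviCivita hY hU hZ]
  linear_combination (2⁻¹ : ℝ) * koszul_swap_sub U Y (FiberBundle.extend R4 v) x

theorem SmoothSec.inner {Y Z : Π x : X, TangentSpace (𝓡 4) x} (hY : SmoothSec R4 Y)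
    (hZ : SmoothSec R4 Z) : ContMDiff (𝓡 4) 𝓘(ℝ, ℝ) ∞ (fun y ↦ ⟪Y y, Z y⟫_ℝ) :=
  ContMDiff.inner_bundle hY hZ

theorem contMDiff_koszul {U Y Z : Π x : X, TangentSpace (𝓡 4) x} (hU : SmoothSec R4 U)
    (hY : SmoothSec R4 Y) (hZ : SmoothSec R4 Z) :
    ContMDiff (𝓡 4) 𝓘(ℝ, ℝ) ∞ (koszul U Y Z) := by
  refine ContMDiff.add (ContMDiff.sub (ContMDiff.add (ContMDiff.sub (ContMDiff.add ?_ ?_) ?_)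
    ?_) ?_) ?_
  · exact contMDiff_mvfderiv_apply (hY.inner hZ) hU
  · exact contMDiff_mvfderiv_apply (hZ.inner hU) hY
  · exact contMDiff_mvfderiv_apply (hU.inner hY) hZ
  · exact (hU.mlieBracket hY).inner hZ
  · exact (hY.mlieBracket hZ).inner hU
  · exact (hZ.mlieBracket hU).inner hY

end LeviCivita

/-! ### Curvature as an operator on vector fields and sections -/

section Curvature

variable {X : Type u} [TopologicalSpace X] [ChartedSpace R4 X] [IsManifold (𝓡 4) ∞ X]
  {F : Type*} [NormedAddCommGroup F] [NormedSpace ℝ F] {V : X → Type*}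
  [TopologicalSpace (TotalSpace F V)] [∀ x, AddCommGroup (V x)] [∀ x, Module ℝ (V x)]
  [∀ x, TopologicalSpace (V x)] [∀ x, IsTopologicalAddGroup (V x)]
  [∀ x, ContinuousSMul ℝ (V x)] [FiberBundle F V] [VectorBundle ℝ F V]

/-- The connection `D` maps smooth sections to smooth sections. -/
def IsSmoothCov (D : CovariantDerivative (𝓡 4) F V) : Prop :=
  ∀ (W : Π x : X, TangentSpace (𝓡 4) x) (σ : Π x : X, V x), SmoothSec R4 W → SmoothSec F σ →
    SmoothSec F (fun y ↦ D σ y (W y))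

/-- The curvature of `D` as an operator on vector fields and sections. -/
def covCurv (D : CovariantDerivative (𝓡 4) F V) (W Z : Π x : X, TangentSpace (𝓡 4) x)
    (σ : Π x : X, V x) (x : X) : V x :=
  D (fun y ↦ D σ y (Z y)) x (W x) - D (fun y ↦ D σ y (W y)) x (Z x)
    - D σ x (VectorField.mlieBracket (𝓡 4) W Z x)

variable {D : CovariantDerivative (𝓡 4) F V} {x : X}

theorem cov_add {σ τ : Π x : X, V x} (hσ : DiffSecAt F σ x) (hτ : DiffSecAt F τ x) :
    D (fun y ↦ σ y + τ y) x = D σ x + D τ x :=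
  D.isCovariantDerivativeOnUniv.add hσ hτ

theorem cov_smul {f : X → ℝ} {σ : Π x : X, V x} (hσ : DiffSecAt F σ x)
    (hf : MDifferentiableAt (𝓡 4) 𝓘(ℝ, ℝ) f x) (w : TangentSpace (𝓡 4) x) :
    D (fun y ↦ f y • σ y) x w = f x • D σ x w + mvfderiv (𝓡 4) f x w • σ x := by
  have h := D.isCovariantDerivativeOnUniv.leibniz hσ hf
  exact congrArg (fun L ↦ L w) h

theorem DiffSecAt.smul {f : X → ℝ} {σ : Π x : X, V x}
    (hf : MDifferentiableAt (𝓡 4) 𝓘(ℝ, ℝ) f x) (hσ : DiffSecAt F σ x) :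
    DiffSecAt F (fun y ↦ f y • σ y) x :=
  hf.smul_section hσ

theorem cov_congr {σ τ : Π x : X, V x} (hσ : DiffSecAt F σ x) (hτ : DiffSecAt F τ x)
    (h : ∀ᶠ y in 𝓝 x, σ y = τ y) : D σ x = D τ x :=
  D.isCovariantDerivativeOnUniv.congr_of_eventuallyEq hσ hτ Filter.univ_mem h

theorem covCurv_swap (W Z : Π x : X, TangentSpace (𝓡 4) x) (σ : Π x : X, V x) :
    covCurv D W Z σ x = -covCurv D Z W σ x := by
  simp only [covCurv]
  rw [VectorField.mlieBracket_swap_apply, map_neg]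
  abel

section Tensorial

variable [RiemannianBundle (TangentSpace (𝓡 4) : X → Type)]
  [IsContMDiffRiemannianBundle (𝓡 4) ∞ R4 (TangentSpace (𝓡 4) : X → Type)] [T2Space X]

/-- `IsSmoothCov` concerns smooth vector fields only. Expanding W in a smooth orthonormal frame
leaves its lower regularity in the scalar coefficients. -/
theorem diffSecAt_cov (o : ManifoldOrientation X) (hD : IsSmoothCov D)
    {W : Π x : X, TangentSpace (𝓡 4) x} {σ : Π x : X, V x} (hW : DiffSecAt R4 W x)
    (hσ : SmoothSec F σ) : DiffSecAt F (fun y ↦ D σ y (W y)) x := by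
  obtain ⟨E, hE, he⟩ := exists_orthonormal_frame o x
  have h : DiffSecAt F (fun y ↦ ∑ a, ⟪E a y, W y⟫_ℝ • D σ y (E a y)) x :=
    MDifferentiableAt.sum_section fun a _ ↦ (diff_inner ((hE a).diffSecAt x) hW).smul_section
      ((hD _ _ (hE a) hσ).diffSecAt x)
  refine h.congr_of_eventuallyEq ?_
  filter_upwards [he] with y ⟨e, hy, _⟩
  congr 1
  conv_lhs => rw [← e.sum_repr' (W y), map_sum]
  simp only [map_smul, hy]

/-- The term with the derivative of f along Z cancels against the one in the bracket of fW and Z. -/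
theorem tensorialAt_covCurv (o : ManifoldOrientation X) (hD : IsSmoothCov D)
    {Z : Π x : X, TangentSpace (𝓡 4) x} {σ : Π x : X, V x} (hσ : SmoothSec F σ) :
    TensorialAt (𝓡 4) R4 (fun W ↦ covCurv D W Z σ x) x where
  smul {f W} hf hW := by
    have h1 := cov_smul (D := D) (diffSecAt_cov o hD hW hσ) hf (Z x)
    simp only [covCurv, Pi.smul_apply', map_smul]
    rw [h1, VectorField.mlieBracket_smul_left hf hW]
    simp only [map_add, map_smul, map_neg, neg_smul]
    module
  add {W W'} hW hW' := by
    have h1 := cov_add (D := D) (diffSecAt_cov o hD hW hσ) (diffSecAt_cov o hD hW' hσ)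
    simp only [covCurv, Pi.add_apply, map_add]
    rw [h1, VectorField.mlieBracket_add_left hW hW']
    simp only [map_add, add_apply]
    abel

theorem tensorialAt_covCurv' (o : ManifoldOrientation X) (hD : IsSmoothCov D)
    {Z : Π x : X, TangentSpace (𝓡 4) x} {σ : Π x : X, V x} (hσ : SmoothSec F σ) :
    TensorialAt (𝓡 4) R4 (fun W ↦ covCurv D Z W σ x) x where
  smul {f W} hf hW := by
    rw [covCurv_swap, (tensorialAt_covCurv o hD hσ).smul hf hW, covCurv_swap Z W, smul_neg]
  add {W W'} hW hW' := by
    rw [covCurv_swap, (tensorialAt_covCurv o hD hσ).add hW hW', covCurv_swap Z W, covCurv_swap Z W',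
      neg_add]

/-- `curv` uses one particular extension of each tangent vector; by tensoriality in both arguments
any extension gives the same value. -/
theorem curv_eq_covCurv (o : ManifoldOrientation X) (hD : IsSmoothCov D)
    {W Z : Π x : X, TangentSpace (𝓡 4) x} {σ : Π x : X, V x} (hσ : SmoothSec F σ)
    (hW : DiffSecAt R4 W x) (hZ : DiffSecAt R4 Z x) :
    curv D σ x (W x) (Z x) = covCurv D W Z σ x := by
  have h := TensorialAt.pointwise₂ (Φ := fun W Z ↦ covCurv D W Z σ x)
    (fun _ _ ↦ tensorialAt_covCurv o hD hσ) (fun _ _ ↦ tensorialAt_covCurv' o hD hσ)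
    (FiberBundle.mdifferentiableAt_extend (𝓡 4) R4 (W x)) hW
    (FiberBundle.mdifferentiableAt_extend (𝓡 4) R4 (Z x)) hZ
    (FiberBundle.extend_apply_self R4 _) (FiberBundle.extend_apply_self R4 _)
  rw [← h]
  simp only [curv, covCurv, FiberBundle.extend_apply_self]

/-- Locality in the section. Since τ is smooth only near x, as a local frame is, differentiability
of its covariant derivative is transported from the global section σ. -/
theorem curv_congr (o : ManifoldOrientation X)
    (hD : IsSmoothCov D) {σ τ : Π x : X, V x} (hσ : SmoothSec F σ) {U : Set X}
    (hU : U ∈ 𝓝 x) (hτ : SmoothSecOn F τ U) (h : ∀ᶠ y in 𝓝 x, σ y = τ y)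
    (w z : TangentSpace (𝓡 4) x) : curv D σ x w z = curv D τ x w z := by
  have hτ' : ∀ᶠ y in 𝓝 x, DiffSecAt F τ y := by
    filter_upwards [eventually_mem_nhds_iff.2 hU] with y hy
    exact (hτ.contMDiffAt hy).mdifferentiableAt (by simp)
  have h1 : ∀ᶠ y in 𝓝 x, D σ y = D τ y := by
    filter_upwards [eventually_eventually_nhds.2 h, hτ'] with y hy hy'
    exact cov_congr (hσ.diffSecAt y) hy' hy
  have h2 : ∀ z : TangentSpace (𝓡 4) x, D (fun y ↦ D σ y (FiberBundle.extend R4 z y)) x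
      = D (fun y ↦ D τ y (FiberBundle.extend R4 z y)) x := fun z ↦ by
    have hd := diffSecAt_cov o hD (FiberBundle.mdifferentiableAt_extend (𝓡 4) R4 z) hσ
    refine cov_congr hd (hd.congr_of_eventuallyEq ?_) (h1.mono fun y hy ↦ by rw [hy])
    exact h1.mono fun y hy ↦ by simp only [hy]
  simp only [curv, h2, h1.self_of_nhds]

theorem exists_curv_bilinear (o : ManifoldOrientation X) (hD : IsSmoothCov D)
    {σ : Π x : X, V x} (hσ : SmoothSec F σ) (x : X) :
    ∃ B : TangentSpace (𝓡 4) x →ₗ[ℝ] TangentSpace (𝓡 4) x →ₗ[ℝ] V x,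
      ∀ w z, curv D σ x w z = B w z := by
  have H : IsBilinearMap ℝ (fun w z ↦ curv D σ x w z) := by
    have hd := fun w : TangentSpace (𝓡 4) x ↦ FiberBundle.mdifferentiableAt_extend (𝓡 4) R4 w
    have he := fun w : TangentSpace (𝓡 4) x ↦ FiberBundle.extend_apply_self R4 w
    constructor
    · intro w w' z
      have h := (tensorialAt_covCurv (Z := FiberBundle.extend R4 z) o hD hσ).add (hd w) (hd w')
      rw [← curv_eq_covCurv o hD hσ (mdifferentiableAt_add_section (hd w) (hd w')) (hd z),
        ← curv_eq_covCurv o hD hσ (hd w) (hd z), ← curv_eq_covCurv o hD hσ (hd w') (hd z)] at h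
      simpa only [Pi.add_apply, he] using h
    · intro r w z
      have h := (tensorialAt_covCurv (Z := FiberBundle.extend R4 z) o hD hσ).smul
        (f := fun _ ↦ r) mdifferentiableAt_const (hd w)
      rw [← curv_eq_covCurv o hD hσ (mdifferentiableAt_const.smul_section (hd w)) (hd z),
        ← curv_eq_covCurv o hD hσ (hd w) (hd z)] at h
      simpa only [Pi.smul_apply', he] using h
    · intro w z z'
      have h := (tensorialAt_covCurv' (Z := FiberBundle.extend R4 w) o hD hσ).add (hd z) (hd z')
      rw [← curv_eq_covCurv o hD hσ (hd w) (mdifferentiableAt_add_section (hd z) (hd z')),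
        ← curv_eq_covCurv o hD hσ (hd w) (hd z), ← curv_eq_covCurv o hD hσ (hd w) (hd z')] at h
      simpa only [Pi.add_apply, he] using h
    · intro r w z
      have h := (tensorialAt_covCurv' (Z := FiberBundle.extend R4 w) o hD hσ).smul
        (f := fun _ ↦ r) mdifferentiableAt_const (hd z)
      rw [← curv_eq_covCurv o hD hσ (hd w) (mdifferentiableAt_const.smul_section (hd z)),
        ← curv_eq_covCurv o hD hσ (hd w) (hd z)] at h
      simpa only [Pi.smul_apply', he] using h
  exact ⟨H.toLinearMap, fun w z ↦ rfl⟩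

end Tensorial

theorem covCurv_congr (hD : IsSmoothCov D) {W Z : Π x : X, TangentSpace (𝓡 4) x}
    (hW : SmoothSec R4 W) (hZ : SmoothSec R4 Z) {σ τ : Π x : X, V x} (hσ : SmoothSec F σ)
    (hτ : SmoothSec F τ) (h : ∀ᶠ y in 𝓝 x, σ y = τ y) : covCurv D W Z σ x = covCurv D W Z τ x := by
  have h1 : ∀ᶠ y in 𝓝 x, D σ y = D τ y := by
    filter_upwards [eventually_eventually_nhds.2 h] with y hy
    exact cov_congr (hσ.diffSecAt y) (hτ.diffSecAt y) hy
  have h2 : ∀ {U : Π x : X, TangentSpace (𝓡 4) x}, SmoothSec R4 U →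
      D (fun y ↦ D σ y (U y)) x = D (fun y ↦ D τ y (U y)) x := fun hU ↦
    cov_congr ((hD _ _ hU hσ).diffSecAt x) ((hD _ _ hU hτ).diffSecAt x)
      (h1.mono fun y hy ↦ by rw [hy])
  simp only [covCurv, h2 hW, h2 hZ, h1.self_of_nhds]

theorem covCurv_add (hD : IsSmoothCov D) {W Z : Π x : X, TangentSpace (𝓡 4) x}
    (hW : SmoothSec R4 W) (hZ : SmoothSec R4 Z) {σ τ : Π x : X, V x} (hσ : SmoothSec F σ)
    (hτ : SmoothSec F τ) :
    covCurv D W Z (fun y ↦ σ y + τ y) x = covCurv D W Z σ x + covCurv D W Z τ x := by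
  have h1 : ∀ y, D (fun y ↦ σ y + τ y) y = D σ y + D τ y := fun y ↦
    cov_add (hσ.diffSecAt y) (hτ.diffSecAt y)
  have h2 : ∀ {U : Π x : X, TangentSpace (𝓡 4) x}, SmoothSec R4 U →
      D (fun y ↦ D σ y (U y) + D τ y (U y)) x
        = D (fun y ↦ D σ y (U y)) x + D (fun y ↦ D τ y (U y)) x := fun hU ↦
    cov_add ((hD _ _ hU hσ).diffSecAt x) ((hD _ _ hU hτ).diffSecAt x)
  simp only [covCurv, h1, add_apply, h2 hW, h2 hZ]
  abel

/-- The mixed first-order terms cancel on antisymmetrization. The second derivatives of f leave [W,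
Z]f, which the bracket term removes. -/
theorem covCurv_smul [T2Space X] (hD : IsSmoothCov D) {W Z : Π x : X, TangentSpace (𝓡 4) x}
    (hW : SmoothSec R4 W) (hZ : SmoothSec R4 Z) {f : X → ℝ}
    (hf : ContMDiff (𝓡 4) 𝓘(ℝ, ℝ) ∞ f) {σ : Π x : X, V x} (hσ : SmoothSec F σ) :
    covCurv D W Z (fun y ↦ f y • σ y) x = f x • covCurv D W Z σ x := by
  have h1 : ∀ y w, D (fun y ↦ f y • σ y) y w = f y • D σ y w + mvfderiv (𝓡 4) f y w • σ y :=
    fun y w ↦ cov_smul (hσ.diffSecAt y) (SmoothSec.mdiff hf y) w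
  have h2 : ∀ {U : Π x : X, TangentSpace (𝓡 4) x}, SmoothSec R4 U → ∀ w,
      D (fun y ↦ f y • D σ y (U y) + mvfderiv (𝓡 4) f y (U y) • σ y) x w
        = (f x • D (fun y ↦ D σ y (U y)) x w + mvfderiv (𝓡 4) f x w • D σ x (U x))
        + (mvfderiv (𝓡 4) f x (U x) • D σ x w
          + mvfderiv (𝓡 4) (fun y ↦ mvfderiv (𝓡 4) f y (U y)) x w • σ x) := by
    intro U hU w
    have h3 := SmoothSec.mdiff (contMDiff_mvfderiv_apply hf hU) x
    rw [cov_add (DiffSecAt.smul (SmoothSec.mdiff hf x) ((hD _ _ hU hσ).diffSecAt x))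
      (DiffSecAt.smul h3 (hσ.diffSecAt x)), add_apply,
      cov_smul ((hD _ _ hU hσ).diffSecAt x) (SmoothSec.mdiff hf x),
      cov_smul (hσ.diffSecAt x) h3]
  simp only [covCurv, h1, h2 hW, h2 hZ, mvfderiv_mlieBracket hf hW hZ x]
  module

/-- The curvature of a connection compatible with a pairing is skew. -/
theorem covCurv_skew [T2Space X] (hD : IsSmoothCov D) (g : Π y : X, V y →+ V y →+ ℝ)
    (hg : ∀ σ τ : Π x : X, V x, SmoothSec F σ → SmoothSec F τ →
      ContMDiff (𝓡 4) 𝓘(ℝ, ℝ) ∞ (fun y ↦ g y (σ y) (τ y)))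
    (hDg : ∀ (W : Π x : X, TangentSpace (𝓡 4) x) (σ τ : Π x : X, V x) (y : X), SmoothSec R4 W →
      SmoothSec F σ → SmoothSec F τ →
      mvfderiv (𝓡 4) (fun y ↦ g y (σ y) (τ y)) y (W y)
        = g y (D σ y (W y)) (τ y) + g y (σ y) (D τ y (W y)))
    {W Z : Π x : X, TangentSpace (𝓡 4) x} (hW : SmoothSec R4 W) (hZ : SmoothSec R4 Z)
    {σ τ : Π x : X, V x} (hσ : SmoothSec F σ) (hτ : SmoothSec F τ) :
    g x (covCurv D W Z σ x) (τ x) + g x (σ x) (covCurv D W Z τ x) = 0 := by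
  -- The commutator of derivations is applied to the function g(σ, τ) and expanded twice by
  -- compatibility; terms with one derivative on each section are symmetric and drop out.
  have h := mvfderiv_mlieBracket (hg σ τ hσ hτ) hW hZ x
  have h1 : ∀ {A B : Π x : X, TangentSpace (𝓡 4) x}, SmoothSec R4 A → SmoothSec R4 B →
      mvfderiv (𝓡 4) (fun y ↦ mvfderiv (𝓡 4) (fun y ↦ g y (σ y) (τ y)) y (B y)) x (A x)
        = (g x (D (fun y ↦ D σ y (B y)) x (A x)) (τ x) + g x (D σ x (B x)) (D τ x (A x)))
        + (g x (D σ x (A x)) (D τ x (B x)) + g x (σ x) (D (fun y ↦ D τ y (B y)) x (A x))) := by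
    intro A B hA hB
    have h2 := fun y ↦ hDg B σ τ y hB hσ hτ
    simp only [h2]
    rw [mvfderiv_fun_add (SmoothSec.mdiff (hg _ _ (hD _ _ hB hσ) hτ) x)
      (SmoothSec.mdiff (hg _ _ hσ (hD _ _ hB hτ)) x), add_apply,
      hDg A _ _ x hA (hD _ _ hB hσ) hτ, hDg A _ _ x hA hσ (hD _ _ hB hτ)]
  rw [hDg _ σ τ x (hW.mlieBracket hZ) hσ hτ, h1 hW hZ, h1 hZ hW] at h
  simp only [covCurv, map_sub, AddMonoidHom.sub_apply]
  linarith

end Curvature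

/-- The real part of an inner product, as a biadditive map. -/
def reInner (𝕜 H : Type*) [RCLike 𝕜] [NormedAddCommGroup H] [InnerProductSpace 𝕜 H] :
    H →+ H →+ ℝ :=
  AddMonoidHom.mk' (fun v ↦ AddMonoidHom.mk' (fun w ↦ RCLike.re (inner 𝕜 v w))
    (fun w w' ↦ by rw [inner_add_right, map_add]))
    (fun v v' ↦ by ext w; simp [inner_add_left])

/-! ### Symmetries of the Levi-Civita curvature -/

section LeviCivita

variable {X : Type u} [TopologicalSpace X] [T2Space X] [ChartedSpace R4 X] [IsManifold (𝓡 4) ∞ X]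
  [RiemannianBundle (TangentSpace (𝓡 4) : X → Type)]
  [IsContMDiffRiemannianBundle (𝓡 4) ∞ R4 (TangentSpace (𝓡 4) : X → Type)]

/-- In a smooth orthonormal frame near a point, the coefficients of the derivative are half the
Koszul expressions, which are smooth. -/
theorem isSmoothCov_leviCivita (o : ManifoldOrientation X) :
    IsSmoothCov (leviCivita (X := X)) := by
  intro W Y hW hY x
  obtain ⟨E, hE, he⟩ := exists_orthonormal_frame o x
  have h : SmoothSec R4 (fun y ↦ ∑ a, (2⁻¹ * koszul W Y (E a) y) • E a y) :=
    ContMDiff.sum_section fun a _ ↦ ContMDiff.smul_section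
      (contMDiff_const.mul (contMDiff_koszul hW hY (hE a))) (hE a)
  refine (h x).congr_of_eventuallyEq ?_
  filter_upwards [he] with y ⟨e, hy, _⟩
  congr 1
  rw [← e.sum_repr' (leviCivita Y y (W y))]
  refine Finset.sum_congr rfl fun a _ ↦ ?_
  rw [real_inner_comm, ← hy, inner_leviCivita (hW.diffSecAt y) (hY.diffSecAt y)
    ((hE a).diffSecAt y)]

theorem leviCivita_curv_skew (o : ManifoldOrientation X) {W Z Y Y' : Π x : X, TangentSpace (𝓡 4) x}
    (hW : SmoothSec R4 W) (hZ : SmoothSec R4 Z) (hY : SmoothSec R4 Y) (hY' : SmoothSec R4 Y')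
    (x : X) :
    ⟪covCurv leviCivita W Z Y x, Y' x⟫_ℝ + ⟪Y x, covCurv leviCivita W Z Y' x⟫_ℝ = 0 :=
  covCurv_skew (isSmoothCov_leviCivita o)
    (fun y ↦ reInner ℝ (TangentSpace (𝓡 4) y))
    (fun _ _ hσ hτ ↦ hσ.inner hτ)
    (fun _ _ _ y hW hσ hτ ↦ leviCivita_metric (hW.diffSecAt y) (hσ.diffSecAt y) (hτ.diffSecAt y))
    hW hZ hY hY'

/-- The first Bianchi identity. -/
theorem leviCivita_bianchi (o : ManifoldOrientation X) {U V W : Π x : X, TangentSpace (𝓡 4) x}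
    (hU : SmoothSec R4 U) (hV : SmoothSec R4 V) (hW : SmoothSec R4 W) (x : X) :
    covCurv leviCivita U V W x + covCurv leviCivita V W U x + covCurv leviCivita W U V x = 0 := by
  have hD := isSmoothCov_leviCivita o
  have h2 : ∀ {U : Π x : X, TangentSpace (𝓡 4) x}, SmoothSec R4 U → ∀ y,
      ContMDiffAt (𝓡 4) ((𝓡 4).prod 𝓘(ℝ, R4)) (minSmoothness ℝ 2)
        (fun y ↦ TotalSpace.mk' R4 y (U y)) y := fun hU y ↦ by
    rw [minSmoothness_of_isRCLikeNormedField]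
    exact (hU y).of_le two_le_infty
  -- Vanishing torsion is used for B, C inside and for A, [B, C] outside. Summed cyclically, the
  -- left sides rearrange into the three curvature terms and the right sides into the Jacobi sum.
  have key : ∀ {A B C : Π x : X, TangentSpace (𝓡 4) x}, SmoothSec R4 A → SmoothSec R4 B →
      SmoothSec R4 C → leviCivita (fun y ↦ leviCivita C y (B y)) x (A x)
        - leviCivita (fun y ↦ leviCivita B y (C y)) x (A x)
        - leviCivita A x (VectorField.mlieBracket (𝓡 4) B C x)
        = VectorField.mlieBracket (𝓡 4) A (VectorField.mlieBracket (𝓡 4) B C) x := by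
    intro A B C hA hB hC
    have h1 : ∀ y, leviCivita C y (B y)
        = leviCivita B y (C y) + VectorField.mlieBracket (𝓡 4) B C y := fun y ↦ by
      rw [← leviCivita_torsion (hB.diffSecAt y) (hC.diffSecAt y)]
      abel
    simp only [h1]
    rw [cov_add ((hD _ _ hC hB).diffSecAt x) ((hB.mlieBracket hC).diffSecAt x),
      ← leviCivita_torsion (hA.diffSecAt x) ((hB.mlieBracket hC).diffSecAt x), add_apply]
    abel
  have hJ := VectorField.leibniz_identity_mlieBracket_apply (h2 hU x) (h2 hV x) (h2 hW x)
  rw [VectorField.mlieBracket_swap_apply (V := VectorField.mlieBracket (𝓡 4) U V),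
    VectorField.mlieBracket_swap (V := U) (W := W)] at hJ
  have hneg : VectorField.mlieBracket (𝓡 4) V (-VectorField.mlieBracket (𝓡 4) W U) x
      = -VectorField.mlieBracket (𝓡 4) V (VectorField.mlieBracket (𝓡 4) W U) x := by
    have := VectorField.mlieBracket_const_smul_right (I := 𝓡 4) (V := V) (c := (-1 : ℝ))
      ((hW.mlieBracket hU).diffSecAt x)
    simpa using this
  rw [hneg, ← key hU hV hW, ← key hV hW hU, ← key hW hU hV] at hJ
  simp only [covCurv]
  rw [← sub_eq_zero] at hJ
  rw [← hJ]
  abel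

end LeviCivita

/-! ### Complex scalars and local frames of Hermitian bundles -/

section Hermitian

variable {X : Type u} [TopologicalSpace X] [ChartedSpace R4 X] {n : ℕ}
  {V : HermitianBundle.{u, v} X n} {x : X}

theorem contMDiffAt_complex_smul {h : X → ℂ} {σ : Π x : X, V.fiber x} {k : ℕ∞ω}
    (hh : ContMDiffAt (𝓡 4) 𝓘(ℝ, ℂ) k h x)
    (hσ : ContMDiffAt (𝓡 4) ((𝓡 4).prod 𝓘(ℝ, Cn n)) k (fun y ↦ TotalSpace.mk' (Cn n) y (σ y)) x) :
    ContMDiffAt (𝓡 4) ((𝓡 4).prod 𝓘(ℝ, Cn n)) k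
      (fun y ↦ TotalSpace.mk' (Cn n) y (h y • σ y)) x := by
  rw [contMDiffAt_section] at hσ ⊢
  set e := trivializationAt (Cn n) V.fiber x
  have hs : ContMDiffAt (𝓡 4) 𝓘(ℝ, Cn n) k (fun y ↦ h y • (e ⟨y, σ y⟩).2) x := by
    have h1 : ContDiff ℝ k (fun p : ℂ × Cn n ↦ p.1 • p.2) := contDiff_smul
    exact (h1.contMDiff.contMDiffAt (x := (h x, (e ⟨x, σ x⟩).2))).comp x
      (f := fun y ↦ (h y, (e ⟨y, σ y⟩).2)) (hh.prodMk_space hσ)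
  refine hs.congr_of_eventuallyEq ?_
  filter_upwards [e.open_baseSet.mem_nhds (FiberBundle.mem_baseSet_trivializationAt' x)] with y hy
  exact (e.linear ℂ hy).2 _ _

theorem SmoothSec.complex_smul {h : X → ℂ} {σ : Π x : X, V.fiber x}
    (hh : ContMDiff (𝓡 4) 𝓘(ℝ, ℂ) ∞ h) (hσ : SmoothSec (Cn n) σ) :
    SmoothSec (Cn n) (fun y ↦ h y • σ y) := fun x ↦ contMDiffAt_complex_smul (hh x) (hσ x)

theorem DiffSecAt.complex_smul {h : X → ℂ} {σ : Π x : X, V.fiber x}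
    (hh : MDifferentiableAt (𝓡 4) 𝓘(ℝ, ℂ) h x) (hσ : DiffSecAt (Cn n) σ x) :
    DiffSecAt (Cn n) (fun y ↦ h y • σ y) x := by
  rw [DiffSecAt, mdifferentiableAt_section] at hσ ⊢
  set e := trivializationAt (Cn n) V.fiber x
  have hs : MDifferentiableAt (𝓡 4) 𝓘(ℝ, Cn n) (fun y ↦ h y • (e ⟨y, σ y⟩).2) x := by
    have h1 : ContDiff ℝ 1 (fun p : ℂ × Cn n ↦ p.1 • p.2) := contDiff_smul
    exact ((h1.contMDiff.contMDiffAt (x := (h x, (e ⟨x, σ x⟩).2))).mdifferentiableAt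
      (by simp)).comp x (f := fun y ↦ (h y, (e ⟨y, σ y⟩).2)) (hh.prodMk_space hσ)
  refine hs.congr_of_eventuallyEq ?_
  filter_upwards [e.open_baseSet.mem_nhds (FiberBundle.mem_baseSet_trivializationAt' x)] with y hy
  exact (e.linear ℂ hy).2 _ _

theorem SmoothSec.contMDiff_re_inner {σ τ : Π x : X, V.fiber x} (hσ : SmoothSec (Cn n) σ)
    (hτ : SmoothSec (Cn n) τ) :
    ContMDiff (𝓡 4) 𝓘(ℝ, ℝ) ∞ (fun y ↦ (⟪σ y, τ y⟫_ℂ).re) := by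
  let (x : X) : InnerProductSpace ℝ (V.fiber x) := InnerProductSpace.complexToReal
  have := V.smoothMetric
  exact ContMDiff.inner_bundle (B := X) (F := Cn n) (E := V.fiber) hσ hτ

/-- The smooth real metric controls only the real part; the imaginary part is recovered as Re⟨iσ,
τ⟩. -/
theorem SmoothSec.contMDiff_inner {σ τ : Π x : X, V.fiber x} (hσ : SmoothSec (Cn n) σ)
    (hτ : SmoothSec (Cn n) τ) :
    ContMDiff (𝓡 4) 𝓘(ℝ, ℂ) ∞ (fun y ↦ ⟪σ y, τ y⟫_ℂ) := by
  have h1 := hσ.contMDiff_re_inner hτ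
  have h2 := (SmoothSec.complex_smul (h := fun _ ↦ Complex.I) contMDiff_const hσ).contMDiff_re_inner
    hτ
  have h3 : ContDiff ℝ ∞ (fun p : ℝ × ℝ ↦ (p.1 : ℂ) + p.2 * Complex.I) := by
    have := Complex.ofRealCLM.contDiff (n := ∞)
    exact (this.comp contDiff_fst).add ((this.comp contDiff_snd).mul contDiff_const)
  refine (h3.contMDiff.comp (h1.prodMk_space h2)).congr fun y ↦ ?_
  simp only [Function.comp, inner_smul_left, Complex.conj_I]
  apply Complex.ext <;> simp

theorem SmoothSec.zero : SmoothSec (Cn n) (fun y ↦ (0 : V.fiber y)) :=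
  contMDiff_zeroSection ℝ V.fiber

theorem smoothSecOn_locFrame (V : HermitianBundle.{u, v} X n) (x₀ : X) (j : Fin n) :
    SmoothSecOn (Cn n) (locFrame V x₀ j) (trivializationAt (Cn n) V.fiber x₀).baseSet := by
  rw [SmoothSecOn, Trivialization.contMDiffOn_section_baseSet_iff]
  refine (contMDiffOn_const (c := EuclideanSpace.basisFun (Fin n) ℂ j)).congr fun y hy ↦ ?_
  exact congrArg Prod.snd ((trivializationAt (Cn n) V.fiber x₀).apply_mk_symm hy _)

theorem baseSet_mem_nhds (V : HermitianBundle.{u, v} X n) (x₀ : X) :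
    (trivializationAt (Cn n) V.fiber x₀).baseSet ∈ 𝓝 x₀ :=
  (trivializationAt (Cn n) V.fiber x₀).open_baseSet.mem_nhds
    (FiberBundle.mem_baseSet_trivializationAt' x₀)

theorem locCoord_apply (x₀ : X) (j : Fin n) {y : X}
    (hy : y ∈ (trivializationAt (Cn n) V.fiber x₀).baseSet) (s : V.fiber y) :
    locCoord V x₀ j y s = (trivializationAt (Cn n) V.fiber x₀ ⟨y, s⟩).2 j := by
  simp [locCoord, hy]

theorem contMDiffAt_locCoord {x₀ : X} {j : Fin n} {k : ℕ∞} {σ : Π x : X, V.fiber x}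
    (hx : x ∈ (trivializationAt (Cn n) V.fiber x₀).baseSet)
    (hσ : ContMDiffAt (𝓡 4) ((𝓡 4).prod 𝓘(ℝ, Cn n)) k (fun y ↦ TotalSpace.mk' (Cn n) y (σ y)) x) :
    ContMDiffAt (𝓡 4) 𝓘(ℝ, ℂ) k (fun y ↦ locCoord V x₀ j y (σ y)) x := by
  have : ContMDiffVectorBundle k (Cn n) V.fiber (𝓡 4) :=
    ContMDiffVectorBundle.of_le (n := ∞) ENat.LEInfty.out
  have h := ((trivializationAt (Cn n) V.fiber x₀).contMDiffAt_section_iff hx).1 hσ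
  have hp : ContDiff ℝ k (fun v : Cn n ↦ v j) := by fun_prop
  refine ((hp.contMDiff.contMDiffAt
    (x := (trivializationAt (Cn n) V.fiber x₀ ⟨x, σ x⟩).2)).comp x h).congr_of_eventuallyEq ?_
  filter_upwards [(trivializationAt (Cn n) V.fiber x₀).open_baseSet.mem_nhds hx] with y hy
  exact locCoord_apply x₀ j hy _

theorem mdifferentiableAt_locCoord {x₀ : X} {j : Fin n} {σ : Π x : X, V.fiber x}
    (hx : x ∈ (trivializationAt (Cn n) V.fiber x₀).baseSet) (hσ : DiffSecAt (Cn n) σ x) :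
    MDifferentiableAt (𝓡 4) 𝓘(ℝ, ℂ) (fun y ↦ locCoord V x₀ j y (σ y)) x := by
  have h := ((trivializationAt (Cn n) V.fiber x₀).mdifferentiableAt_section_iff (𝓡 4) σ hx).1 hσ
  have hp : ContDiff ℝ 1 (fun v : Cn n ↦ v j) := by fun_prop
  refine (((hp.contMDiff.contMDiffAt
    (x := (trivializationAt (Cn n) V.fiber x₀ ⟨x, σ x⟩).2)).mdifferentiableAt
      (by simp)).comp x h).congr_of_eventuallyEq ?_
  filter_upwards [(trivializationAt (Cn n) V.fiber x₀).open_baseSet.mem_nhds hx] with y hy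
  exact locCoord_apply x₀ j hy _

theorem sum_locCoord_smul (x₀ : X) {y : X}
    (hy : y ∈ (trivializationAt (Cn n) V.fiber x₀).baseSet) (s : V.fiber y) :
    ∑ j, locCoord V x₀ j y s • locFrame V x₀ j y = s := by
  have h := (EuclideanSpace.basisFun (Fin n) ℂ).toBasis.sum_repr
    ((trivializationAt (Cn n) V.fiber x₀ ⟨y, s⟩).2)
  have h2 := congrArg ((trivializationAt (Cn n) V.fiber x₀).symmₗ ℂ y) h
  rw [map_sum] at h2
  simp only [map_smul] at h2
  have h4 : ∀ v, (trivializationAt (Cn n) V.fiber x₀).symmₗ ℂ y v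
      = (trivializationAt (Cn n) V.fiber x₀).symm y v := fun v ↦
    (trivializationAt (Cn n) V.fiber x₀).symmₗ_apply hy v
  have h3 : (trivializationAt (Cn n) V.fiber x₀).symmₗ ℂ y
      (trivializationAt (Cn n) V.fiber x₀ ⟨y, s⟩).2 = s := by
    rw [h4]
    exact (trivializationAt (Cn n) V.fiber x₀).symm_apply_apply_mk hy s
  rw [h3] at h2
  conv_rhs => rw [← h2]
  refine Finset.sum_congr rfl fun j _ ↦ ?_
  rw [locCoord_apply x₀ j hy, h4]
  simp [locFrame]

theorem exists_smooth_locFrame [T2Space X] [IsManifold (𝓡 4) ∞ X] (V : HermitianBundle.{u, v} X n)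
    (x₀ : X) : ∃ f : Fin n → Π x : X, V.fiber x, (∀ j, SmoothSec (Cn n) (f j)) ∧
      ∀ᶠ y in 𝓝 x₀, ∀ j, f j y = locFrame V x₀ j y := by
  choose f hf hfe using fun j ↦
    exists_smoothSec_eventuallyEq (baseSet_mem_nhds V x₀) (smoothSecOn_locFrame V x₀ j)
  exact ⟨f, hf, Filter.eventually_all.2 hfe⟩

theorem exists_smoothSec_eq [T2Space X] [IsManifold (𝓡 4) ∞ X] (s : V.fiber x) :
    ∃ σ : Π x : X, V.fiber x, SmoothSec (Cn n) σ ∧ σ x = s := by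
  obtain ⟨U, hU, h⟩ := FiberBundle.exists_contMDiffOn_extend (𝓡 4) (Cn n) (k := ∞)
    (V := V.fiber) s
  obtain ⟨σ, hσ, hσe⟩ := exists_smoothSec_eventuallyEq hU h
  exact ⟨σ, hσ, by rw [hσe.self_of_nhds, FiberBundle.extend_apply_self]⟩

theorem exists_smooth_coord [T2Space X] [IsManifold (𝓡 4) ∞ X] {σ : Π x : X, V.fiber x}
    (hσ : SmoothSec (Cn n) σ) (x₀ : X) : ∃ c : Fin n → X → ℂ,
      (∀ j, ContMDiff (𝓡 4) 𝓘(ℝ, ℂ) ∞ (c j)) ∧ ∀ᶠ y in 𝓝 x₀, ∀ j, c j y = locCoord V x₀ j y (σ y) := by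
  choose c hc hce using fun j ↦
    exists_contMDiff_eventuallyEq (f := fun y ↦ locCoord V x₀ j y (σ y)) (baseSet_mem_nhds V x₀)
      fun y hy ↦ (contMDiffAt_locCoord (k := ⊤) hy (hσ y)).contMDiffWithinAt
  exact ⟨c, hc, Filter.eventually_all.2 hce⟩

theorem exists_smooth_tangent [T2Space X] [IsManifold (𝓡 4) ∞ X] (w : TangentSpace (𝓡 4) x) :
    ∃ W : Π x : X, TangentSpace (𝓡 4) x, SmoothSec R4 W ∧ W x = w := by
  obtain ⟨U, hU, h⟩ := FiberBundle.exists_contMDiffOn_extend (𝓡 4) R4 (k := ∞)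
    (V := (TangentSpace (𝓡 4) : X → Type)) w
  obtain ⟨σ, hσ, hσe⟩ := exists_smoothSec_eventuallyEq hU h
  exact ⟨σ, hσ, by rw [hσe.self_of_nhds, FiberBundle.extend_apply_self]⟩

end Hermitian

/-! ### Unitary connections and their curvature endomorphisms -/

section Unitary

variable {X : Type u} [TopologicalSpace X] [ChartedSpace R4 X] [IsManifold (𝓡 4) ∞ X] {n : ℕ}
  {V : HermitianBundle.{u, v} X n} {x : X} (A : UnitaryConnection V)

theorem UnitaryConnection.isSmoothCov : IsSmoothCov A.cov := by
  intro W σ hW hσ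
  have h := A.smooth.contMDiff.contMDiff (σ := σ) (by exact hσ.contMDiffOn)
  rw [contMDiffOn_univ] at h
  exact ContMDiff.clm_bundle_apply (F₁ := R4) (F₂ := Cn n) (E₁ := TangentSpace (𝓡 4))
    (E₂ := V.fiber) (b := fun y ↦ y) (ϕ := fun y ↦ A.cov σ y) h hW

theorem mvfderiv_clm_comp {G G' : Type*} [NormedAddCommGroup G] [NormedSpace ℝ G]
    [NormedAddCommGroup G'] [NormedSpace ℝ G'] (L : G →L[ℝ] G') {f : X → G}
    (hf : MDifferentiableAt (𝓡 4) 𝓘(ℝ, G) f x) (w : TangentSpace (𝓡 4) x) :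
    mvfderiv (𝓡 4) (fun y ↦ L (f y)) x w = L (mvfderiv (𝓡 4) f x w) := by
  have hL : MDifferentiableAt 𝓘(ℝ, G) 𝓘(ℝ, G') L (f x) :=
    L.differentiableAt.mdifferentiableAt
  have h := mfderiv_comp x hL hf
  rw [mfderiv_eq_fderiv, L.fderiv] at h
  have h2 := congrArg (fun T ↦ T w) h
  exact h2

/-- The Leibniz rule is given for real functions only. Splitting h into real and imaginary parts,
with iσ as a second section, extends it to complex ones through `complexLinear`. -/
theorem UnitaryConnection.cov_complex_smul {h : X → ℂ} {σ : Π x : X, V.fiber x}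
    (hσ : DiffSecAt (Cn n) σ x) (hh : MDifferentiableAt (𝓡 4) 𝓘(ℝ, ℂ) h x)
    (w : TangentSpace (𝓡 4) x) :
    A.cov (fun y ↦ h y • σ y) x w = h x • A.cov σ x w + mvfderiv (𝓡 4) h x w • σ x := by
  have hI : DiffSecAt (Cn n) (fun y ↦ Complex.I • σ y) x :=
    DiffSecAt.complex_smul (h := fun _ ↦ Complex.I) mdifferentiableAt_const hσ
  have hre : MDifferentiableAt (𝓡 4) 𝓘(ℝ, ℝ) (fun y ↦ (h y).re) x :=
    (Complex.reCLM.differentiableAt.mdifferentiableAt).comp x hh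
  have him : MDifferentiableAt (𝓡 4) 𝓘(ℝ, ℝ) (fun y ↦ (h y).im) x :=
    (Complex.imCLM.differentiableAt.mdifferentiableAt).comp x hh
  have he : (fun y ↦ h y • σ y)
      = fun y ↦ (h y).re • σ y + (h y).im • (Complex.I • σ y) := by
    funext y
    conv_lhs => rw [← Complex.re_add_im (h y)]
    rw [add_smul, mul_smul]
    rfl
  rw [he, cov_add (DiffSecAt.smul hre hσ) (DiffSecAt.smul him hI), add_apply,
    cov_smul hσ hre, cov_smul hI him, A.complexLinear σ x hσ w]
  have h1 := mvfderiv_clm_comp Complex.reCLM hh w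
  have h2 := mvfderiv_clm_comp Complex.imCLM hh w
  simp only [Complex.reCLM_apply, Complex.imCLM_apply] at h1 h2
  rw [h1, h2]
  conv_rhs => rw [← Complex.re_add_im (h x), ← Complex.re_add_im (mvfderiv (𝓡 4) h x w)]
  simp only [add_smul, mul_smul]
  simp only [Complex.coe_smul]
  abel

variable [T2Space X]

theorem UnitaryConnection.covCurv_I_smul {W Z : Π x : X, TangentSpace (𝓡 4) x}
    (hW : SmoothSec R4 W) (hZ : SmoothSec R4 Z) {σ : Π x : X, V.fiber x}
    (hσ : SmoothSec (Cn n) σ) :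
    covCurv A.cov W Z (fun y ↦ Complex.I • σ y) x = Complex.I • covCurv A.cov W Z σ x := by
  have h1 : ∀ y w, A.cov (fun y ↦ Complex.I • σ y) y w = Complex.I • A.cov σ y w := fun y w ↦
    A.complexLinear σ y (hσ.diffSecAt y) w
  simp only [covCurv, h1]
  rw [A.complexLinear _ x ((A.isSmoothCov _ _ hZ hσ).diffSecAt x),
    A.complexLinear _ x ((A.isSmoothCov _ _ hW hσ).diffSecAt x)]
  simp only [smul_sub]

theorem contMDiff_re {h : X → ℂ} (hh : ContMDiff (𝓡 4) 𝓘(ℝ, ℂ) ∞ h) :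
    ContMDiff (𝓡 4) 𝓘(ℝ, ℝ) ∞ (fun y ↦ (h y).re) :=
  Complex.reCLM.contDiff.contMDiff.comp hh

theorem contMDiff_im {h : X → ℂ} (hh : ContMDiff (𝓡 4) 𝓘(ℝ, ℂ) ∞ h) :
    ContMDiff (𝓡 4) 𝓘(ℝ, ℝ) ∞ (fun y ↦ (h y).im) :=
  Complex.imCLM.contDiff.contMDiff.comp hh

theorem SmoothSec.real_smul {h : X → ℝ} {σ : Π x : X, V.fiber x}
    (hh : ContMDiff (𝓡 4) 𝓘(ℝ, ℝ) ∞ h) (hσ : SmoothSec (Cn n) σ) :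
    SmoothSec (Cn n) (fun y ↦ h y • σ y) := ContMDiff.smul_section hh hσ

theorem SmoothSec.I_smul {σ : Π x : X, V.fiber x} (hσ : SmoothSec (Cn n) σ) :
    SmoothSec (Cn n) (fun y ↦ Complex.I • σ y) :=
  SmoothSec.complex_smul (h := fun _ ↦ Complex.I) contMDiff_const hσ

theorem UnitaryConnection.covCurv_complex_smul {W Z : Π x : X, TangentSpace (𝓡 4) x}
    (hW : SmoothSec R4 W) (hZ : SmoothSec R4 Z) {h : X → ℂ} (hh : ContMDiff (𝓡 4) 𝓘(ℝ, ℂ) ∞ h)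
    {σ : Π x : X, V.fiber x} (hσ : SmoothSec (Cn n) σ) :
    covCurv A.cov W Z (fun y ↦ h y • σ y) x = h x • covCurv A.cov W Z σ x := by
  have he : (fun y ↦ h y • σ y)
      = fun y ↦ (h y).re • σ y + (h y).im • (Complex.I • σ y) := by
    funext y
    conv_lhs => rw [← Complex.re_add_im (h y)]
    rw [add_smul, mul_smul]
    rfl
  have hD := A.isSmoothCov
  rw [he, covCurv_add hD hW hZ (hσ.real_smul (contMDiff_re hh))
      (hσ.I_smul.real_smul (contMDiff_im hh)), covCurv_smul hD hW hZ (contMDiff_re hh) hσ,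
    covCurv_smul hD hW hZ (contMDiff_im hh) hσ.I_smul, A.covCurv_I_smul hW hZ hσ]
  conv_rhs => rw [← Complex.re_add_im (h x)]
  simp only [add_smul, mul_smul, Complex.coe_smul]

theorem UnitaryConnection.covCurv_sum {W Z : Π x : X, TangentSpace (𝓡 4) x}
    (hW : SmoothSec R4 W) (hZ : SmoothSec R4 Z) {ι : Type*} (s : Finset ι)
    {σ : ι → Π x : X, V.fiber x} (hσ : ∀ i, SmoothSec (Cn n) (σ i)) :
    covCurv A.cov W Z (fun y ↦ ∑ i ∈ s, σ i y) x = ∑ i ∈ s, covCurv A.cov W Z (σ i) x := by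
  classical
  induction s using Finset.induction_on with
  | empty =>
    have h := A.covCurv_complex_smul (x := x) hW hZ (h := fun _ ↦ 0) contMDiff_const
      (SmoothSec.zero (V := V))
    simpa using h
  | insert i s hi ih =>
    simp only [Finset.sum_insert hi]
    rw [covCurv_add A.isSmoothCov hW hZ (hσ i) (ContMDiff.sum_section fun j _ ↦ hσ j), ih]

variable [RiemannianBundle (TangentSpace (𝓡 4) : X → Type)]
  [IsContMDiffRiemannianBundle (𝓡 4) ∞ R4 (TangentSpace (𝓡 4) : X → Type)]

/-- The curvature endomorphism computes the commutator of covariant derivatives. -/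
theorem UnitaryConnection.curvature_apply (o : ManifoldOrientation X)
    {W Z : Π x : X, TangentSpace (𝓡 4) x} (hW : SmoothSec R4 W) (hZ : SmoothSec R4 Z)
    {σ : Π x : X, V.fiber x} (hσ : SmoothSec (Cn n) σ) :
    A.curvature x (W x) (Z x) (σ x) = covCurv A.cov W Z σ x := by
  obtain ⟨f, hf, hfe⟩ := exists_smooth_locFrame V x
  obtain ⟨c, hc, hce⟩ := exists_smooth_coord hσ x
  -- Linearity of `covCurv` over functions reduces the claim to the local frame, on which
  -- `curvature` is defined.
  have h1 : ∀ᶠ y in 𝓝 x, σ y = ∑ j, c j y • f j y := by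
    filter_upwards [hfe, hce, baseSet_mem_nhds V x] with y h1 h2 h3
    simp only [h1, h2]
    exact (sum_locCoord_smul x h3 _).symm
  have hcf : ∀ j, SmoothSec (Cn n) (fun y ↦ c j y • f j y) := fun j ↦ (hf j).complex_smul (hc j)
  rw [covCurv_congr A.isSmoothCov hW hZ hσ (ContMDiff.sum_section fun j _ ↦ hcf j) h1,
    A.covCurv_sum hW hZ _ hcf]
  simp only [UnitaryConnection.curvature, LinearMap.sum_apply, LinearMap.smulRight_apply]
  refine Finset.sum_congr rfl fun j _ ↦ ?_
  rw [A.covCurv_complex_smul hW hZ (hc j) (hf j), ← hce.self_of_nhds j,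
    ← curv_eq_covCurv o A.isSmoothCov (hf j) (hW.diffSecAt x) (hZ.diffSecAt x),
    curv_congr o A.isSmoothCov (hf j) (baseSet_mem_nhds V x) (smoothSecOn_locFrame V x j)
      (hfe.mono fun y hy ↦ hy j)]

theorem UnitaryConnection.exists_curvature_bilinear (o : ManifoldOrientation X) (x : X) :
    ∃ B : TangentSpace (𝓡 4) x →ₗ[ℝ] TangentSpace (𝓡 4) x →ₗ[ℝ] End ℂ (V.fiber x),
      ∀ w z, A.curvature x w z = B w z := by
  have key : ∀ s : V.fiber x, ∃ B : TangentSpace (𝓡 4) x →ₗ[ℝ] TangentSpace (𝓡 4) x →ₗ[ℝ] V.fiber x,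
      ∀ w z, A.curvature x w z s = B w z := by
    intro s
    obtain ⟨σ, hσ, rfl⟩ := exists_smoothSec_eq s
    obtain ⟨B, hB⟩ := exists_curv_bilinear o A.isSmoothCov hσ x
    refine ⟨B, fun w z ↦ ?_⟩
    obtain ⟨W, hW, rfl⟩ := exists_smooth_tangent w
    obtain ⟨Z, hZ, rfl⟩ := exists_smooth_tangent z
    rw [A.curvature_apply o hW hZ hσ, ← hB,
      curv_eq_covCurv o A.isSmoothCov hσ (hW.diffSecAt x) (hZ.diffSecAt x)]
  choose B hB using key
  have H : IsBilinearMap ℝ (fun w z ↦ A.curvature x w z) := by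
    constructor <;> intros <;> ext s <;> simp [hB]
  exact ⟨H.toLinearMap, fun _ _ ↦ rfl⟩

theorem UnitaryConnection.curvature_swap (o : ManifoldOrientation X)
    (w z : TangentSpace (𝓡 4) x) : A.curvature x w z = -A.curvature x z w := by
  obtain ⟨W, hW, rfl⟩ := exists_smooth_tangent w
  obtain ⟨Z, hZ, rfl⟩ := exists_smooth_tangent z
  ext s
  obtain ⟨σ, hσ, rfl⟩ := exists_smoothSec_eq s
  rw [LinearMap.neg_apply, A.curvature_apply o hW hZ hσ, A.curvature_apply o hZ hW hσ, covCurv_swap]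

theorem UnitaryConnection.re_curvature_skew (o : ManifoldOrientation X)
    (w z : TangentSpace (𝓡 4) x) (s t : V.fiber x) :
    (⟪A.curvature x w z s, t⟫_ℂ).re + (⟪s, A.curvature x w z t⟫_ℂ).re = 0 := by
  obtain ⟨W, hW, rfl⟩ := exists_smooth_tangent w
  obtain ⟨Z, hZ, rfl⟩ := exists_smooth_tangent z
  obtain ⟨σ, hσ, rfl⟩ := exists_smoothSec_eq s
  obtain ⟨τ, hτ, rfl⟩ := exists_smoothSec_eq t
  rw [A.curvature_apply o hW hZ hσ, A.curvature_apply o hW hZ hτ]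
  refine covCurv_skew A.isSmoothCov (fun y ↦ reInner ℂ (V.fiber y))
    (fun _ _ hσ hτ ↦ hσ.contMDiff_re_inner hτ) (fun W σ τ y hW hσ hτ ↦ ?_) hW hZ hσ hτ
  have h1 := A.unitary σ τ y (hσ.diffSecAt y) (hτ.diffSecAt y) (W y)
  have h2 := mvfderiv_clm_comp Complex.reCLM (SmoothSec.mdiff (hσ.contMDiff_inner hτ) y) (W y)
  rw [h1] at h2
  exact h2

theorem UnitaryConnection.curvature_skew (o : ManifoldOrientation X)
    (w z : TangentSpace (𝓡 4) x) (s t : V.fiber x) :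
    ⟪A.curvature x w z s, t⟫_ℂ = -⟪s, A.curvature x w z t⟫_ℂ := by
  have h1 := A.re_curvature_skew o w z s t
  -- Replacing s by is in the real identity yields the imaginary part.
  have h2 := A.re_curvature_skew o w z (Complex.I • s) t
  rw [map_smul, inner_smul_left, inner_smul_left, Complex.conj_I] at h2
  simp at h2
  apply Complex.ext
  · rw [Complex.neg_re]; linarith
  · rw [Complex.neg_im]; linarith

end Unitary

/-! ### Sections of S ⊗ E and the tensor product connection -/

section TensorSections

variable {X : Type u} [TopologicalSpace X] [ChartedSpace R4 X] [IsManifold (𝓡 4) ∞ X] {m n : ℕ}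
  {S : HermitianBundle.{u, v} X m} {E : HermitianBundle.{u, v} X n} {x : X}

variable (S E) in
/-- Finite sums of products of smooth sections of `S` and `E`. -/
def tensorSections : AddSubmonoid (Π x : X, S.fiber x ⊗[ℂ] E.fiber x) :=
  AddSubmonoid.closure {Ψ | ∃ φ g, SmoothSec (Cn m) φ ∧ SmoothSec (Cn n) g ∧
    Ψ = fun y ↦ φ y ⊗ₜ[ℂ] g y}

theorem tmul_mem_tensorSections {φ : Π x : X, S.fiber x} {g : Π x : X, E.fiber x}
    (hφ : SmoothSec (Cn m) φ) (hg : SmoothSec (Cn n) g) :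
    (fun y ↦ φ y ⊗ₜ[ℂ] g y) ∈ tensorSections S E :=
  AddSubmonoid.subset_closure ⟨φ, g, hφ, hg, rfl⟩

/-- No separate case for the zero section is needed, because it is the product of two zero sections.
-/
theorem tensorSections_induction
    {p : (Ψ : Π x : X, S.fiber x ⊗[ℂ] E.fiber x) → Ψ ∈ tensorSections S E → Prop}
    (tmul : ∀ φ g (hφ : SmoothSec (Cn m) φ) (hg : SmoothSec (Cn n) g),
      p (fun y ↦ φ y ⊗ₜ[ℂ] g y) (tmul_mem_tensorSections hφ hg))
    (add : ∀ Ψ Φ (hΨ : Ψ ∈ tensorSections S E) (hΦ : Φ ∈ tensorSections S E), p Ψ hΨ → p Φ hΦ →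
      p (fun y ↦ Ψ y + Φ y) (AddSubmonoid.add_mem _ hΨ hΦ))
    {Ψ : Π x : X, S.fiber x ⊗[ℂ] E.fiber x} (hΨ : Ψ ∈ tensorSections S E) : p Ψ hΨ := by
  induction hΨ using AddSubmonoid.closure_induction with
  | mem Ψ h =>
    obtain ⟨φ, g, hφ, hg, rfl⟩ := h
    exact tmul φ g hφ hg
  | zero =>
    have h := tmul _ _ (SmoothSec.zero (V := S)) (SmoothSec.zero (V := E))
    simp only [TensorProduct.zero_tmul] at h
    exact h
  | add Ψ Φ h1 h2 h3 h4 => exact add Ψ Φ h1 h2 h3 h4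

theorem component_tmul (φ : Π x : X, S.fiber x) (g : Π x : X, E.fiber x) (x₀ : X) (j : Fin n) :
    component (fun y ↦ φ y ⊗ₜ[ℂ] g y) x₀ j = fun y ↦ locCoord E x₀ j y (g y) • φ y := by
  funext y
  simp [component]

theorem component_add (Ψ Φ : Π x : X, S.fiber x ⊗[ℂ] E.fiber x) (x₀ : X) (j : Fin n) :
    component (fun y ↦ Ψ y + Φ y) x₀ j = fun y ↦ component Ψ x₀ j y + component Φ x₀ j y := by
  funext y
  simp [component]

theorem diffSecAt_component {Ψ : Π x : X, S.fiber x ⊗[ℂ] E.fiber x}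
    (hΨ : Ψ ∈ tensorSections S E) (x : X) (j : Fin n) : DiffSecAt (Cn m) (component Ψ x j) x := by
  induction hΨ using tensorSections_induction with
  | tmul φ g hφ hg =>
    rw [component_tmul]
    exact DiffSecAt.complex_smul (mdifferentiableAt_locCoord
      (FiberBundle.mem_baseSet_trivializationAt' x) (hg.diffSecAt x)) (hφ.diffSecAt x)
  | add Ψ Φ h1 h2 h3 h4 =>
    rw [component_add]
    exact mdifferentiableAt_add_section h3 h4

variable (B : UnitaryConnection S) (A : UnitaryConnection E)

theorem tensorCov_congr {Ψ Φ : Π x : X, S.fiber x ⊗[ℂ] E.fiber x}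
    (hΨ : ∀ j, DiffSecAt (Cn m) (component Ψ x j) x)
    (hΦ : ∀ j, DiffSecAt (Cn m) (component Φ x j) x) (h : ∀ᶠ y in 𝓝 x, Ψ y = Φ y) :
    tensorCov B A Ψ x = tensorCov B A Φ x := by
  have h1 : ∀ j, ∀ᶠ y in 𝓝 x, component Ψ x j y = component Φ x j y := fun j ↦
    h.mono fun y hy ↦ by simp only [component, hy]
  funext w
  simp only [tensorCov]
  refine Finset.sum_congr rfl fun j _ ↦ ?_
  rw [cov_congr (hΨ j) (hΦ j) (h1 j), (h1 j).self_of_nhds]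

theorem tensorCov_add {Ψ Φ : Π x : X, S.fiber x ⊗[ℂ] E.fiber x}
    (hΨ : Ψ ∈ tensorSections S E) (hΦ : Φ ∈ tensorSections S E) (x : X)
    (w : TangentSpace (𝓡 4) x) :
    tensorCov B A (fun y ↦ Ψ y + Φ y) x w = tensorCov B A Ψ x w + tensorCov B A Φ x w := by
  simp only [tensorCov, component_add]
  rw [← Finset.sum_add_distrib]
  refine Finset.sum_congr rfl fun j _ ↦ ?_
  rw [cov_add (diffSecAt_component hΨ x j) (diffSecAt_component hΦ x j), add_apply,
    TensorProduct.add_tmul, TensorProduct.add_tmul]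
  abel

theorem tensorCov_sum_smul (Ψ : Π x : X, S.fiber x ⊗[ℂ] E.fiber x) (x : X) {ι : Type*}
    (s : Finset ι) (r : ι → ℝ) (w : ι → TangentSpace (𝓡 4) x) :
    tensorCov B A Ψ x (∑ i ∈ s, r i • w i) = ∑ i ∈ s, (r i : ℂ) • tensorCov B A Ψ x (w i) := by
  simp only [tensorCov, map_sum, map_smul, Finset.smul_sum]
  rw [Finset.sum_comm]
  refine Finset.sum_congr rfl fun j _ ↦ ?_
  rw [TensorProduct.sum_tmul, TensorProduct.tmul_sum, ← Finset.sum_add_distrib]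
  refine Finset.sum_congr rfl fun i _ ↦ ?_
  rw [smul_add, TensorProduct.smul_tmul', ← TensorProduct.tmul_smul, Complex.coe_smul,
    Complex.coe_smul]

theorem tensorCov_add_right (Ψ : Π x : X, S.fiber x ⊗[ℂ] E.fiber x) (x : X)
    (w z : TangentSpace (𝓡 4) x) :
    tensorCov B A Ψ x (w + z) = tensorCov B A Ψ x w + tensorCov B A Ψ x z := by
  have h := tensorCov_sum_smul B A Ψ x Finset.univ (fun _ : Fin 2 ↦ (1 : ℝ)) ![w, z]
  simpa using h

theorem tensorCov_sub_right (Ψ : Π x : X, S.fiber x ⊗[ℂ] E.fiber x) (x : X)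
    (w z : TangentSpace (𝓡 4) x) :
    tensorCov B A Ψ x (w - z) = tensorCov B A Ψ x w - tensorCov B A Ψ x z := by
  rw [eq_sub_iff_add_eq, ← tensorCov_add_right, sub_add_cancel]

variable [T2Space X]

/-- In the definition the coordinates of g sit on the S factor. Moving them, and their derivatives,
across the tensor sign reassembles the covariant derivative of g from its expansion in the local
frame. -/
theorem tensorCov_tmul {φ : Π x : X, S.fiber x} {g : Π x : X, E.fiber x}
    (hφ : SmoothSec (Cn m) φ) (hg : SmoothSec (Cn n) g) (x : X) (w : TangentSpace (𝓡 4) x) :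
    tensorCov B A (fun y ↦ φ y ⊗ₜ[ℂ] g y) x w
      = B.cov φ x w ⊗ₜ[ℂ] g x + φ x ⊗ₜ[ℂ] A.cov g x w := by
  have hx := FiberBundle.mem_baseSet_trivializationAt' (F := Cn n) (E := E.fiber) x
  have hc := fun j ↦ mdifferentiableAt_locCoord (j := j) hx (hg.diffSecAt x)
  obtain ⟨f, hf, hfe⟩ := exists_smooth_locFrame E x
  have hfd : ∀ j, DiffSecAt (Cn n) (locFrame E x j) x := fun j ↦
    (((smoothSecOn_locFrame E x j).contMDiffAt (baseSet_mem_nhds E x)).mdifferentiableAt (by simp))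
  have hcf : ∀ j, DiffSecAt (Cn n) (fun y ↦ locCoord E x j y (g y) • locFrame E x j y) x :=
    fun j ↦ DiffSecAt.complex_smul (hc j) (hfd j)
  have hsum : A.cov g x w = ∑ j, (locCoord E x j x (g x) • A.cov (locFrame E x j) x w
      + mvfderiv (𝓡 4) (fun y ↦ locCoord E x j y (g y)) x w • locFrame E x j x) := by
    have h1 : A.cov g x = A.cov (fun y ↦ ∑ j, locCoord E x j y (g y) • locFrame E x j y) x := by
      refine cov_congr (hg.diffSecAt x) (MDifferentiableAt.sum_section fun j _ ↦ hcf j) ?_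
      filter_upwards [baseSet_mem_nhds E x] with y hy
      exact (sum_locCoord_smul x hy _).symm
    have h2 : ∀ s : Finset (Fin n),
        A.cov (fun y ↦ ∑ j ∈ s, locCoord E x j y (g y) • locFrame E x j y) x w
          = ∑ j ∈ s, (locCoord E x j x (g x) • A.cov (locFrame E x j) x w
            + mvfderiv (𝓡 4) (fun y ↦ locCoord E x j y (g y)) x w • locFrame E x j x) := by
      intro s
      induction s using Finset.induction_on with
      | empty =>
        have h0 := A.cov_complex_smul (h := fun _ ↦ 0) (hg.diffSecAt x) mdifferentiableAt_const w
        simpa [mvfderiv_const] using h0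
      | insert i s hi ih =>
        simp only [Finset.sum_insert hi]
        rw [cov_add (hcf i) (MDifferentiableAt.sum_section fun j _ ↦ hcf j), add_apply, ih,
          A.cov_complex_smul (hfd i) (hc i)]
    rw [h1, h2]
  simp only [tensorCov, component_tmul]
  rw [hsum, TensorProduct.tmul_sum]
  conv_rhs => rw [← sum_locCoord_smul x hx (g x)]
  rw [TensorProduct.tmul_sum, ← Finset.sum_add_distrib]
  refine Finset.sum_congr rfl fun j _ ↦ ?_
  rw [B.cov_complex_smul (hφ.diffSecAt x) (hc j), sum_locCoord_smul x hx (g x)]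
  simp only [TensorProduct.add_tmul, TensorProduct.tmul_add, TensorProduct.tmul_smul,
    TensorProduct.smul_tmul']
  abel

theorem tensorCov_mem {Ψ : Π x : X, S.fiber x ⊗[ℂ] E.fiber x} (hΨ : Ψ ∈ tensorSections S E)
    {W : Π x : X, TangentSpace (𝓡 4) x} (hW : SmoothSec R4 W) :
    (fun y ↦ tensorCov B A Ψ y (W y)) ∈ tensorSections S E := by
  induction hΨ using tensorSections_induction with
  | tmul φ g hφ hg =>
    simp only [tensorCov_tmul B A hφ hg]
    exact AddSubmonoid.add_mem _ (tmul_mem_tensorSections (B.isSmoothCov _ _ hW hφ) hg)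
      (tmul_mem_tensorSections hφ (A.isSmoothCov _ _ hW hg))
  | add Ψ Φ h1 h2 h3 h4 =>
    simp only [tensorCov_add B A h1 h2]
    exact AddSubmonoid.add_mem _ h3 h4

theorem contMDiff_complex_mul {f g : X → ℂ} (hf : ContMDiff (𝓡 4) 𝓘(ℝ, ℂ) ∞ f)
    (hg : ContMDiff (𝓡 4) 𝓘(ℝ, ℂ) ∞ g) : ContMDiff (𝓡 4) 𝓘(ℝ, ℂ) ∞ (fun y ↦ f y * g y) := by
  have h1 : ContDiff ℝ ∞ (fun p : ℂ × ℂ ↦ p.1 * p.2) := contDiff_mul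
  exact h1.contMDiff.comp (hf.prodMk_space hg)

theorem contMDiff_tensor_inner {Ψ Φ : Π x : X, S.fiber x ⊗[ℂ] E.fiber x}
    (hΨ : Ψ ∈ tensorSections S E) (hΦ : Φ ∈ tensorSections S E) :
    ContMDiff (𝓡 4) 𝓘(ℝ, ℂ) ∞ (fun y ↦ ⟪Ψ y, Φ y⟫_ℂ) := by
  induction hΨ using tensorSections_induction with
  | tmul φ g hφ hg =>
    induction hΦ using tensorSections_induction with
    | tmul φ' g' hφ' hg' =>
      simp only [TensorProduct.inner_tmul]
      exact contMDiff_complex_mul (hφ.contMDiff_inner hφ') (hg.contMDiff_inner hg')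
    | add Ψ Φ h1 h2 h3 h4 =>
      simp only [inner_add_right]
      exact h3.add h4
  | add Ψ Φ h1 h2 h3 h4 =>
    simp only [inner_add_left]
    exact h3.add h4

/-- The tensor product connection is unitary. -/
theorem tensorCov_unitary {Ψ Φ : Π x : X, S.fiber x ⊗[ℂ] E.fiber x}
    (hΨ : Ψ ∈ tensorSections S E) (hΦ : Φ ∈ tensorSections S E) (x : X)
    (w : TangentSpace (𝓡 4) x) :
    mvfderiv (𝓡 4) (fun y ↦ ⟪Ψ y, Φ y⟫_ℂ) x w
      = ⟪tensorCov B A Ψ x w, Φ x⟫_ℂ + ⟪Ψ x, tensorCov B A Φ x w⟫_ℂ := by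
  induction hΨ using tensorSections_induction with
  | tmul φ g hφ hg =>
    induction hΦ using tensorSections_induction with
    | tmul φ' g' hφ' hg' =>
      have hh := hg.contMDiff_inner hg'
      have h1 : (fun y ↦ ⟪φ y ⊗ₜ[ℂ] g y, φ' y ⊗ₜ[ℂ] g' y⟫_ℂ)
          = fun y ↦ ⟪φ y, ⟪g y, g' y⟫_ℂ • φ' y⟫_ℂ := by
        funext y
        rw [TensorProduct.inner_tmul, inner_smul_right, mul_comm]
      rw [h1, B.unitary _ _ x (hφ.diffSecAt x) ((hφ'.complex_smul hh).diffSecAt x),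
        B.cov_complex_smul (hφ'.diffSecAt x) (SmoothSec.mdiff hh x),
        A.unitary _ _ x (hg.diffSecAt x) (hg'.diffSecAt x),
        tensorCov_tmul B A hφ hg, tensorCov_tmul B A hφ' hg']
      simp only [inner_add_left, inner_add_right, inner_smul_right, TensorProduct.inner_tmul]
      ring
    | add Φ Φ' h1 h2 h3 h4 =>
      have hp := tmul_mem_tensorSections hφ hg
      simp only [inner_add_right, tensorCov_add B A h1 h2]
      rw [mvfderiv_fun_add (SmoothSec.mdiff (contMDiff_tensor_inner hp h1) x)
        (SmoothSec.mdiff (contMDiff_tensor_inner hp h2) x), add_apply, h3, h4]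
      ring
  | add Ψ Ψ' h1 h2 h3 h4 =>
    simp only [inner_add_left, tensorCov_add B A h1 h2]
    rw [mvfderiv_fun_add (SmoothSec.mdiff (contMDiff_tensor_inner h1 hΦ) x)
      (SmoothSec.mdiff (contMDiff_tensor_inner h2 hΦ) x), add_apply, h3, h4]
    ring

/-- The curvature of the tensor product connection. -/
theorem tensorCov_curvature [RiemannianBundle (TangentSpace (𝓡 4) : X → Type)]
    [IsContMDiffRiemannianBundle (𝓡 4) ∞ R4 (TangentSpace (𝓡 4) : X → Type)]
    (o : ManifoldOrientation X) {Ψ : Π x : X, S.fiber x ⊗[ℂ] E.fiber x}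
    (hΨ : Ψ ∈ tensorSections S E) {W Z : Π x : X, TangentSpace (𝓡 4) x} (hW : SmoothSec R4 W)
    (hZ : SmoothSec R4 Z) (x : X) :
    tensorCov B A (fun y ↦ tensorCov B A Ψ y (Z y)) x (W x)
        - tensorCov B A (fun y ↦ tensorCov B A Ψ y (W y)) x (Z x)
        - tensorCov B A Ψ x (VectorField.mlieBracket (𝓡 4) W Z x)
      = (TensorProduct.map (B.curvature x (W x) (Z x)) LinearMap.id
        + TensorProduct.map LinearMap.id (A.curvature x (W x) (Z x)) :
          End ℂ (S.fiber x ⊗[ℂ] E.fiber x)) (Ψ x) := by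
  induction hΨ using tensorSections_induction with
  | tmul φ g hφ hg =>
    -- The two mixed terms are exchanged when U and T are swapped, so the commutator retains only
    -- the curvatures of the factors.
    have key : ∀ {U T : Π x : X, TangentSpace (𝓡 4) x}, SmoothSec R4 U → SmoothSec R4 T →
        tensorCov B A (fun y ↦ tensorCov B A (fun y ↦ φ y ⊗ₜ[ℂ] g y) y (T y)) x (U x)
          = (B.cov (fun y ↦ B.cov φ y (T y)) x (U x) ⊗ₜ[ℂ] g x
            + B.cov φ x (T x) ⊗ₜ[ℂ] A.cov g x (U x))
          + (B.cov φ x (U x) ⊗ₜ[ℂ] A.cov g x (T x)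
            + φ x ⊗ₜ[ℂ] A.cov (fun y ↦ A.cov g y (T y)) x (U x)) := by
      intro U T hU hT
      have h1 := B.isSmoothCov _ _ hT hφ
      have h2 := A.isSmoothCov _ _ hT hg
      simp only [tensorCov_tmul B A hφ hg]
      rw [tensorCov_add B A (tmul_mem_tensorSections h1 hg) (tmul_mem_tensorSections hφ h2),
        tensorCov_tmul B A h1 hg, tensorCov_tmul B A hφ h2]
    rw [key hW hZ, key hZ hW, tensorCov_tmul B A hφ hg]
    simp only [LinearMap.add_apply, TensorProduct.map_tmul, LinearMap.id_apply]
    rw [B.curvature_apply o hW hZ hφ, A.curvature_apply o hW hZ hg]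
    simp only [covCurv, TensorProduct.sub_tmul, TensorProduct.tmul_sub]
    abel
  | add Ψ Φ h1 h2 h3 h4 =>
    simp only [tensorCov_add B A h1 h2]
    rw [tensorCov_add B A (tensorCov_mem B A h1 hZ) (tensorCov_mem B A h2 hZ),
      tensorCov_add B A (tensorCov_mem B A h1 hW) (tensorCov_mem B A h2 hW), map_add, ← h3, ← h4]
    abel

theorem sum_component_tmul (x₀ : X) {y : X}
    (hy : y ∈ (trivializationAt (Cn n) E.fiber x₀).baseSet) (t : S.fiber y ⊗[ℂ] E.fiber y) :
    ∑ j, TensorProduct.rid ℂ (S.fiber y) ((locCoord E x₀ j y).lTensor (S.fiber y) t)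
      ⊗ₜ[ℂ] locFrame E x₀ j y = t := by
  induction t with
  | zero => simp
  | tmul s e =>
    conv_rhs => rw [← sum_locCoord_smul x₀ hy e, TensorProduct.tmul_sum]
    refine Finset.sum_congr rfl fun j _ ↦ ?_
    rw [LinearMap.lTensor_tmul, TensorProduct.rid_tmul, TensorProduct.smul_tmul]
  | add s t hs ht =>
    simp only [map_add, TensorProduct.add_tmul, Finset.sum_add_distrib, hs, ht]

/-- The components in a local frame of E and the frame itself are cut off to global sections. This
gives arbitrary smooth sections of S ⊗ E access to induction on products. -/
theorem exists_tensorSections_eq {Ψ : Π x : X, S.fiber x ⊗[ℂ] E.fiber x} (hΨ : SmoothTensorSec Ψ)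
    (x₀ : X) : ∃ Φ ∈ tensorSections S E, ∀ᶠ y in 𝓝 x₀, Φ y = Ψ y := by
  obtain ⟨f, hf, hfe⟩ := exists_smooth_locFrame E x₀
  choose φ hφ hφe using fun j ↦ exists_smoothSec_eventuallyEq (baseSet_mem_nhds E x₀) (hΨ x₀ j)
  refine ⟨∑ j, fun y ↦ φ j y ⊗ₜ[ℂ] f j y,
    AddSubmonoid.sum_mem _ fun j _ ↦ tmul_mem_tensorSections (hφ j) (hf j), ?_⟩
  filter_upwards [hfe, Filter.eventually_all.2 hφe, baseSet_mem_nhds E x₀] with y h1 h2 h3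
  rw [Finset.sum_apply]
  simp only [h1, h2]
  exact sum_component_tmul x₀ h3 _

theorem SmoothTensorSec.diffSecAt_component {Ψ : Π x : X, S.fiber x ⊗[ℂ] E.fiber x}
    (hΨ : SmoothTensorSec Ψ) (x : X) (j : Fin n) : DiffSecAt (Cn m) (component Ψ x j) x :=
  ((hΨ x j).contMDiffAt (baseSet_mem_nhds E x)).mdifferentiableAt (by simp)

theorem exists_tensorSections_tensorCov {Ψ : Π x : X, S.fiber x ⊗[ℂ] E.fiber x}
    (hΨ : SmoothTensorSec Ψ) (x₀ : X) : ∃ Φ ∈ tensorSections S E,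
      ∀ᶠ y in 𝓝 x₀, Φ y = Ψ y ∧ tensorCov B A Φ y = tensorCov B A Ψ y := by
  obtain ⟨Φ, hΦ, h⟩ := exists_tensorSections_eq hΨ x₀
  refine ⟨Φ, hΦ, ?_⟩
  filter_upwards [eventually_eventually_nhds.2 h] with y hy
  exact ⟨hy.self_of_nhds, tensorCov_congr B A (UnMonopole.diffSecAt_component hΦ y)
    (hΨ.diffSecAt_component y) hy⟩

end TensorSections

/-! ### Clifford multiplication is parallel -/

section Clifford

variable {X : Type u} [TopologicalSpace X] [T2Space X] [ChartedSpace R4 X] [IsManifold (𝓡 4) ∞ X]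
  [RiemannianBundle (TangentSpace (𝓡 4) : X → Type)]
  [IsContMDiffRiemannianBundle (𝓡 4) ∞ R4 (TangentSpace (𝓡 4) : X → Type)]
  {o : ManifoldOrientation X} {𝔰 : SpinCStructure.{u, v} o} {n : ℕ}
  {E : HermitianBundle.{u, v} X n}

theorem clifford_mem {Ψ : Π x : X, 𝔰.plus.fiber x ⊗[ℂ] E.fiber x}
    (hΨ : Ψ ∈ tensorSections 𝔰.plus E) {W : Π x : X, TangentSpace (𝓡 4) x} (hW : SmoothSec R4 W) :
    (fun y ↦ (𝔰.gammaPlus y (W y)).rTensor (E.fiber y) (Ψ y)) ∈ tensorSections 𝔰.minus E := by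
  induction hΨ using tensorSections_induction with
  | tmul φ g hφ hg => exact tmul_mem_tensorSections (𝔰.smooth W φ hW hφ) hg
  | add Ψ Φ h1 h2 h3 h4 =>
    simp only [map_add]
    exact AddSubmonoid.add_mem _ h3 h4

theorem tensorCov_clifford (B : SpinCConnection 𝔰) (A : UnitaryConnection E)
    {Ψ : Π x : X, 𝔰.plus.fiber x ⊗[ℂ] E.fiber x} (hΨ : Ψ ∈ tensorSections 𝔰.plus E)
    {W : Π x : X, TangentSpace (𝓡 4) x} (hW : SmoothSec R4 W) (x : X)
    (w : TangentSpace (𝓡 4) x) :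
    tensorCov B.minus A (fun y ↦ (𝔰.gammaPlus y (W y)).rTensor (E.fiber y) (Ψ y)) x w
      = (𝔰.gammaPlus x (leviCivita W x w)).rTensor (E.fiber x) (Ψ x)
        + (𝔰.gammaPlus x (W x)).rTensor (E.fiber x) (tensorCov B.plus A Ψ x w) := by
  induction hΨ using tensorSections_induction with
  | tmul φ g hφ hg =>
    have h := tensorCov_tmul B.minus A (𝔰.smooth W φ hW hφ) hg x w
    simp only [LinearMap.rTensor_tmul]
    rw [h, B.parallel W φ x (hW.diffSecAt x) (hφ.diffSecAt x), tensorCov_tmul B.plus A hφ hg]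
    simp only [map_add, LinearMap.rTensor_tmul, TensorProduct.add_tmul]
    abel
  | add Ψ Φ h1 h2 h3 h4 =>
    simp only [map_add]
    rw [tensorCov_add B.minus A (clifford_mem h1 hW) (clifford_mem h2 hW), h3, h4,
      tensorCov_add B.plus A h1 h2, map_add]
    abel

/-- The curvatures of the connections on `S⁺`, `S⁻` and `TX` are intertwined by Clifford
multiplication. -/
theorem clifford_curvature (B : SpinCConnection 𝔰) {U W Z : Π x : X, TangentSpace (𝓡 4) x}
    (hU : SmoothSec R4 U) (hW : SmoothSec R4 W) (hZ : SmoothSec R4 Z) (x : X)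
    (s : 𝔰.plus.fiber x) :
    B.minus.curvature x (W x) (Z x) (𝔰.gammaPlus x (U x) s)
      = 𝔰.gammaPlus x (covCurv leviCivita W Z U x) s
        + 𝔰.gammaPlus x (U x) (B.plus.curvature x (W x) (Z x) s) := by
  obtain ⟨σ, hσ, rfl⟩ := exists_smoothSec_eq s
  have hL := isSmoothCov_leviCivita o
  rw [B.plus.curvature_apply o hW hZ hσ, B.minus.curvature_apply o hW hZ (𝔰.smooth U σ hU hσ)]
  have hp : ∀ {U : Π x : X, TangentSpace (𝓡 4) x} {σ : Π x : X, 𝔰.plus.fiber x},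
      SmoothSec R4 U → SmoothSec (Cn 2) σ → ∀ y w,
      B.minus.cov (fun y ↦ 𝔰.gammaPlus y (U y) (σ y)) y w
        = 𝔰.gammaPlus y (leviCivita U y w) (σ y) + 𝔰.gammaPlus y (U y) (B.plus.cov σ y w) :=
    fun hU hσ y w ↦ B.parallel _ _ y (hU.diffSecAt y) (hσ.diffSecAt y) w
  -- Second derivative of γ(U)σ. The two terms with one derivative on U and one on σ are symmetric
  -- in P and Q and disappear from the commutator.
  have key : ∀ {P Q : Π x : X, TangentSpace (𝓡 4) x}, SmoothSec R4 P → SmoothSec R4 Q →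
      B.minus.cov (fun y ↦ B.minus.cov (fun y ↦ 𝔰.gammaPlus y (U y) (σ y)) y (Q y)) x (P x)
        = (𝔰.gammaPlus x (leviCivita (fun y ↦ leviCivita U y (Q y)) x (P x)) (σ x)
          + 𝔰.gammaPlus x (leviCivita U x (Q x)) (B.plus.cov σ x (P x)))
        + (𝔰.gammaPlus x (leviCivita U x (P x)) (B.plus.cov σ x (Q x))
          + 𝔰.gammaPlus x (U x) (B.plus.cov (fun y ↦ B.plus.cov σ y (Q y)) x (P x))) := by
    intro P Q hP hQ
    have h1 := hL _ _ hQ hU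
    have h2 := B.plus.isSmoothCov _ _ hQ hσ
    simp only [hp hU hσ]
    rw [cov_add ((𝔰.smooth _ _ h1 hσ).diffSecAt x) ((𝔰.smooth _ _ hU h2).diffSecAt x), add_apply,
      hp h1 hσ, hp hU h2]
  simp only [covCurv]
  rw [key hW hZ, key hZ hW, hp hU hσ]
  simp only [map_sub, LinearMap.sub_apply]
  abel

end Clifford

/-! ### Lower bound for the quadratic map -/

section QuadraticMap

variable {S E : Type*} [NormedAddCommGroup S] [InnerProductSpace ℂ S] [FiniteDimensional ℂ S]
  [NormedAddCommGroup E] [InnerProductSpace ℂ E] [FiniteDimensional ℂ E]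

theorem glTensorMap_map (f : End ℂ S →ₗ[ℂ] End ℂ S) (g : End ℂ E →ₗ[ℂ] End ℂ E) (a : End ℂ S)
    (b : End ℂ E) :
    glTensorMap S E f g (TensorProduct.map a b) = TensorProduct.map (f a) (g b) := by
  have h : (homTensorHomEquiv ℂ S E S E).symm (TensorProduct.map a b) = a ⊗ₜ[ℂ] b := by
    rw [LinearEquiv.symm_apply_eq]
    simp
  simp only [glTensorMap, LinearMap.comp_apply, LinearEquiv.coe_coe, h, TensorProduct.map_tmul]
  simp

/-- Together with `glTensorMap_map` this evaluates `projP` and `projQ` on ΨΨ* term by term: once Ψ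
is a sum of two pure tensors, every piece is a tensor product of rank-one maps. -/
theorem outer_tmul (s s' : S) (e e' : E) :
    outer (s ⊗ₜ[ℂ] e) (s' ⊗ₜ[ℂ] e') = TensorProduct.map ((innerₛₗ ℂ s').smulRight s)
      ((innerₛₗ ℂ e').smulRight e) := by
  ext u w
  simp [outer, TensorProduct.inner_tmul, TensorProduct.smul_tmul', TensorProduct.tmul_smul,
    smul_smul, mul_comm]

theorem outer_add_left (Ψ Ψ' Φ : S ⊗[ℂ] E) : outer (Ψ + Ψ') Φ = outer Ψ Φ + outer Ψ' Φ := by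
  ext; simp [outer]

theorem outer_add_right (Ψ Φ Φ' : S ⊗[ℂ] E) : outer Ψ (Φ + Φ') = outer Ψ Φ + outer Ψ Φ' := by
  ext; simp [outer, add_smul]

theorem exists_eq_tmul_add_tmul (s : OrthonormalBasis (Fin 2) ℂ S) (Ψ : S ⊗[ℂ] E) :
    ∃ e f : E, Ψ = s 0 ⊗ₜ[ℂ] e + s 1 ⊗ₜ[ℂ] f := by
  induction Ψ with
  | zero => exact ⟨0, 0, by simp⟩
  | tmul u w =>
    refine ⟨⟪s 0, u⟫_ℂ • w, ⟪s 1, u⟫_ℂ • w, ?_⟩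
    conv_lhs => rw [← s.sum_repr' u]
    simp [TensorProduct.add_tmul, TensorProduct.smul_tmul]
  | add Ψ Φ h1 h2 =>
    obtain ⟨a, b, rfl⟩ := h1
    obtain ⟨c, d, rfl⟩ := h2
    exact ⟨a + c, b + d, by simp only [TensorProduct.tmul_add]; abel⟩

theorem scalarPart_rankOne (u w : E) : scalarPart E ((innerₛₗ ℂ w).smulRight u)
    = ((finrank ℂ E : ℂ)⁻¹ * ⟪w, u⟫_ℂ) • LinearMap.id := by
  simp [scalarPart, LinearMap.trace_smulRight]

theorem traceFreePart_rankOne (u w : E) : traceFreePart E ((innerₛₗ ℂ w).smulRight u)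
    = (innerₛₗ ℂ w).smulRight u - ((finrank ℂ E : ℂ)⁻¹ * ⟪w, u⟫_ℂ) • LinearMap.id := by
  simp [traceFreePart, scalarPart_rankOne]

/-- For `dim S = 2`, `dim E ≥ 2` and `τ ≥ 0`, the quadratic map is bounded below. -/
theorem norm_pow_four_le_mu (hS : finrank ℂ S = 2) (hE : 2 ≤ finrank ℂ E) {τ : ℝ} (hτ : 0 ≤ τ)
    (Ψ : S ⊗[ℂ] E) : ‖Ψ‖ ^ 4 / 4 ≤ (⟪Ψ, mu τ Ψ Ψ⟫_ℂ).re := by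
  obtain ⟨e, f, rfl⟩ := exists_eq_tmul_add_tmul
    ((stdOrthonormalBasis ℂ S).reindex (finCongr hS)) Ψ
  set s := (stdOrthonormalBasis ℂ S).reindex (finCongr hS)
  have h00 : ⟪s 0, s 0⟫_ℂ = 1 := by simp [inner_self_eq_norm_sq_to_K]
  have h11 : ⟪s 1, s 1⟫_ℂ = 1 := by simp [inner_self_eq_norm_sq_to_K]
  have h01 : ⟪s 0, s 1⟫_ℂ = 0 := s.orthonormal.2 (by decide)
  have h10 : ⟪s 1, s 0⟫_ℂ = 0 := s.orthonormal.2 (by decide)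
  obtain ⟨n, hn⟩ : ∃ n : ℝ, n = (finrank ℂ E : ℝ) := ⟨_, rfl⟩
  have hnc : (finrank ℂ E : ℂ) = (n : ℂ) := by simp [hn]
  have hn2 : 2 ≤ n := by simpa [hn] using hE
  have ha : ⟪e, e⟫_ℂ = ((‖e‖ ^ 2 : ℝ) : ℂ) := by simp [inner_self_eq_norm_sq_to_K]
  have hd : ⟪f, f⟫_ℂ = ((‖f‖ ^ 2 : ℝ) : ℂ) := by simp [inner_self_eq_norm_sq_to_K]
  have hbc : ⟪e, f⟫_ℂ * ⟪f, e⟫_ℂ = ((‖⟪e, f⟫_ℂ‖ ^ 2 : ℝ) : ℂ) := by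
    rw [← inner_conj_symm f e, Complex.mul_conj, Complex.normSq_eq_norm_sq]
  have hcs : ‖⟪e, f⟫_ℂ‖ ^ 2 ≤ ‖e‖ ^ 2 * ‖f‖ ^ 2 := by
    rw [← mul_pow]
    exact pow_le_pow_left₀ (norm_nonneg _) (norm_inner_le_norm _ _) 2
  have hnorm : ‖s 0 ⊗ₜ[ℂ] e + s 1 ⊗ₜ[ℂ] f‖ ^ 2 = ‖e‖ ^ 2 + ‖f‖ ^ 2 := by
    have h := inner_self_eq_norm_sq_to_K (𝕜 := ℂ) (s 0 ⊗ₜ[ℂ] e + s 1 ⊗ₜ[ℂ] f)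
    simp only [inner_add_left, inner_add_right, TensorProduct.inner_tmul, h00, h01, h10, h11, ha,
      hd] at h
    apply Complex.ofReal_injective
    push_cast at h ⊢
    simp only [Complex.coe_algebraMap] at h
    linear_combination -h
  -- p and q are the trace and the squared Hilbert–Schmidt norm of the Gram matrix of e and f, a
  -- positive 2×2 matrix; hence p²/2 ≤ q ≤ p².
  set p := ‖e‖ ^ 2 + ‖f‖ ^ 2 with hp
  set q := (‖e‖ ^ 2) ^ 2 + (‖f‖ ^ 2) ^ 2 + 2 * ‖⟪e, f⟫_ℂ‖ ^ 2 with hq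
  have key : ⟪s 0 ⊗ₜ[ℂ] e + s 1 ⊗ₜ[ℂ] f, mu τ (s 0 ⊗ₜ[ℂ] e + s 1 ⊗ₜ[ℂ] f)
      (s 0 ⊗ₜ[ℂ] e + s 1 ⊗ₜ[ℂ] f)⟫_ℂ
      = (((p ^ 2 - q / 2 - q * n⁻¹ + p ^ 2 / 2 * n⁻¹) + τ * ((q - p ^ 2 / 2) * n⁻¹) : ℝ) : ℂ) := by
    have hq' : (q : ℂ) = ⟪e, e⟫_ℂ ^ 2 + ⟪f, f⟫_ℂ ^ 2 + 2 * (⟪e, f⟫_ℂ * ⟪f, e⟫_ℂ) := by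
      rw [ha, hd, hbc, hq]
      push_cast
      ring
    have hp' : (p : ℂ) = ⟪e, e⟫_ℂ + ⟪f, f⟫_ℂ := by
      rw [ha, hd, hp]
      push_cast
      ring
    push_cast
    rw [hq', hp']
    simp only [mu, projP, projQ, outer_add_left, outer_add_right, outer_tmul, map_add,
      glTensorMap_map, traceFreePart_rankOne, scalarPart_rankOne, LinearMap.add_apply,
      LinearMap.smul_apply, TensorProduct.map_tmul, LinearMap.sub_apply, LinearMap.id_apply,
      LinearMap.smulRight_apply, innerₛₗ_apply_apply, h00, h01, h10, h11, hS, hnc, inner_add_left,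
      inner_add_right, inner_smul_right, inner_sub_right, TensorProduct.inner_tmul]
    push_cast
    ring
  rw [key, Complex.ofReal_re]
  have h4 : ‖s 0 ⊗ₜ[ℂ] e + s 1 ⊗ₜ[ℂ] f‖ ^ 4 = p ^ 2 := by rw [← hnorm]; ring
  rw [h4]
  -- By q ≤ p² (Cauchy–Schwarz) the P-part is at least p²/2 − p²/(2n), which is at least p²/4 as n ≥
  -- 2. The Q-part is nonnegative by p²/2 ≤ q.
  have hqp : q ≤ p ^ 2 := by rw [hq, hp]; nlinarith
  have hqp' : p ^ 2 / 2 ≤ q := by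
    rw [hq, hp]; nlinarith [sq_nonneg (‖e‖ ^ 2 - ‖f‖ ^ 2), sq_nonneg ‖⟪e, f⟫_ℂ‖]
  have hi : n⁻¹ ≤ 1 / 2 := by rw [inv_le_comm₀ (by linarith) (by norm_num)]; linarith
  have hi0 : 0 ≤ n⁻¹ := by positivity
  have h5 : 0 ≤ τ * ((q - p ^ 2 / 2) * n⁻¹) :=
    mul_nonneg hτ (mul_nonneg (by linarith) hi0)
  nlinarith [mul_le_mul_of_nonneg_right hqp hi0, mul_le_mul_of_nonneg_left hi (sq_nonneg p)]

end QuadraticMap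

/-! ### Contractions in orthonormal bases -/

section OrthonormalBases

variable {H L ι ι' : Type*} [NormedAddCommGroup H] [InnerProductSpace ℝ H] [AddCommGroup L]
  [Fintype ι] [Fintype ι'] {b : H → H → L}

/-- The contraction of a balanced biadditive map in an orthonormal basis does not depend on the
basis. -/
theorem sum_orthonormalBasis_eq (hl : ∀ v v' w, b (v + v') w = b v w + b v' w)
    (hr : ∀ v w w', b v (w + w') = b v w + b v w') (hb : ∀ (r : ℝ) v w, b (r • v) w = b v (r • w))
    (e : OrthonormalBasis ι ℝ H) (f : OrthonormalBasis ι' ℝ H) :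
    ∑ a, b (e a) (e a) = ∑ a, b (f a) (f a) := by
  let B : H →+ H →+ L := AddMonoidHom.mk' (fun v ↦ AddMonoidHom.mk' (b v) (hr v))
    (fun v v' ↦ by ext w; exact hl v v' w)
  have hB : ∀ v w, b v w = B v w := fun _ _ ↦ rfl
  have h1 : ∀ a, b (f a) (f a) = ∑ c, b (e c) (⟪f a, e c⟫_ℝ • f a) := by
    intro a
    have h := congrArg (fun v ↦ B v (f a)) (e.sum_repr' (f a))
    simp only [map_sum, AddMonoidHom.finsetSum_apply] at h
    rw [hB, ← h]
    refine Finset.sum_congr rfl fun c _ ↦ ?_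
    rw [← hB, hb, real_inner_comm]
  simp only [h1]
  rw [Finset.sum_comm]
  refine Finset.sum_congr rfl fun c _ ↦ ?_
  simp only [hB]
  rw [← map_sum, f.sum_repr']

/-- Expand m in the basis and move its skew coefficients to the other argument. With m the covariant
derivatives of an orthonormal frame, this shifts a derivative of the frame from the Clifford factor
to the direction of differentiation. -/
theorem sum_orthonormalBasis_skew (hl : ∀ v v' w, b (v + v') w = b v w + b v' w)
    (hr : ∀ v w w', b v (w + w') = b v w + b v w') (hb : ∀ (r : ℝ) v w, b (r • v) w = b v (r • w))
    (e : OrthonormalBasis ι ℝ H) {m : ι → H} (hm : ∀ i j, ⟪m i, e j⟫_ℝ = -⟪e i, m j⟫_ℝ) :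
    ∑ a, b (m a) (e a) = -∑ a, b (e a) (m a) := by
  let B : H →+ H →+ L := AddMonoidHom.mk' (fun v ↦ AddMonoidHom.mk' (b v) (hr v))
    (fun v v' ↦ by ext w; exact hl v v' w)
  have hB : ∀ v w, b v w = B v w := fun _ _ ↦ rfl
  have h1 : ∀ a, b (m a) (e a) = ∑ c, b (e c) (-(⟪e a, m c⟫_ℝ • e a)) := by
    intro a
    conv_lhs => rw [hB, ← e.sum_repr' (m a), map_sum, AddMonoidHom.finsetSum_apply]
    refine Finset.sum_congr rfl fun c _ ↦ ?_
    rw [← hB, hb, real_inner_comm, hm, neg_smul]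
  simp only [h1]
  rw [Finset.sum_comm, ← Finset.sum_neg_distrib]
  refine Finset.sum_congr rfl fun c _ ↦ ?_
  simp only [hB]
  rw [← map_sum, ← map_neg, Finset.sum_neg_distrib, e.sum_repr']

end OrthonormalBases

/-! ### The Weitzenböck formula -/

section Weitzenbock

/-- The algebra of the Weitzenböck formula, with T the second covariant derivative and C its
commutator. Writing G a b (T b a) through G b a by the Clifford relation produces two copies of the
vanishing double sum and twice the trace of T. -/
theorem sum_clifford_eq {L ι : Type*} [AddCommGroup L] [Module ℂ L] [Fintype ι] [DecidableEq ι]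
    {G : ι → ι → End ℂ L} (hG : ∀ a b t, G a b t + G b a t = if a = b then (-2 : ℂ) • t else 0)
    {T C : ι → ι → L} (hT : ∀ a b, T a b - T b a = C a b) (h0 : ∑ a, ∑ b, G a b (T a b) = 0) :
    ∑ a, T a a = (2⁻¹ : ℂ) • ∑ a, ∑ b, G a b (C a b) := by
  have h1 : ∑ a, ∑ b, G b a (T b a) = 0 := by rw [Finset.sum_comm]; exact h0
  have h2 : ∑ a, ∑ b, G a b (C a b) = ∑ a, ∑ b, (G a b (T a b) + G b a (T b a)
      - (if a = b then (-2 : ℂ) • T b a else 0)) := by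
    refine Finset.sum_congr rfl fun a _ ↦ Finset.sum_congr rfl fun b _ ↦ ?_
    rw [← hT, map_sub, ← hG]
    abel
  rw [h2]
  simp only [Finset.sum_sub_distrib, Finset.sum_add_distrib, h0, h1]
  simp [← Finset.smul_sum, smul_smul]

variable {X : Type u} [TopologicalSpace X] [ChartedSpace R4 X] [IsManifold (𝓡 4) ∞ X]
  [RiemannianBundle (TangentSpace (𝓡 4) : X → Type)]
  {o : ManifoldOrientation X} {𝔰 : SpinCStructure.{u, v} o} {n : ℕ}
  {E : HermitianBundle.{u, v} X n}

theorem clifford_polarized (x : X) (w z : TangentSpace (𝓡 4) x) (s : 𝔰.plus.fiber x) :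
    𝔰.gammaMinus x w (𝔰.gammaPlus x z s) + 𝔰.gammaMinus x z (𝔰.gammaPlus x w s)
      = ((-2 * ⟪w, z⟫_ℝ : ℝ) : ℂ) • s := by
  have h := 𝔰.clifford x (w + z) s
  have h1 := 𝔰.clifford x w s
  have h2 := 𝔰.clifford x z s
  simp only [map_add, LinearMap.add_apply, h1, h2, norm_add_sq_real] at h
  have h3 : 𝔰.gammaMinus x w (𝔰.gammaPlus x z s) + 𝔰.gammaMinus x z (𝔰.gammaPlus x w s)
      = -((‖w‖ ^ 2 + 2 * ⟪w, z⟫_ℝ + ‖z‖ ^ 2 : ℝ) : ℂ) • s + ((‖w‖ ^ 2 : ℝ) : ℂ) • s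
        + ((‖z‖ ^ 2 : ℝ) : ℂ) • s := by
    rw [← h]
    module
  rw [h3]
  push_cast
  module

theorem tensorCov_smul_right {m : ℕ} {S : HermitianBundle.{u, v} X m} (B : UnitaryConnection S)
    (A : UnitaryConnection E) (Ψ : Π x : X, S.fiber x ⊗[ℂ] E.fiber x) (x : X) (r : ℝ)
    (w : TangentSpace (𝓡 4) x) :
    tensorCov B A Ψ x (r • w) = (r : ℂ) • tensorCov B A Ψ x w := by
  have h := tensorCov_sum_smul B A Ψ x Finset.univ (fun _ : Fin 1 ↦ r) (fun _ ↦ w)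
  simpa using h

theorem gammaPlus_rTensor_smul (x : X) (r : ℝ) (w : TangentSpace (𝓡 4) x)
    (t : 𝔰.plus.fiber x ⊗[ℂ] E.fiber x) :
    (𝔰.gammaPlus x (r • w)).rTensor (E.fiber x) t
      = (𝔰.gammaPlus x w).rTensor (E.fiber x) ((r : ℂ) • t) := by
  have h : 𝔰.gammaPlus x (r • w) = (r : ℂ) • 𝔰.gammaPlus x w := by
    rw [(𝔰.gammaPlus x).map_smul]
    ext s
    simp
  rw [h, LinearMap.rTensor_smul, LinearMap.smul_apply, map_smul]

theorem gammaPlus_rTensor_add (x : X) (w z : TangentSpace (𝓡 4) x)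
    (t : 𝔰.plus.fiber x ⊗[ℂ] E.fiber x) :
    (𝔰.gammaPlus x (w + z)).rTensor (E.fiber x) t
      = (𝔰.gammaPlus x w).rTensor (E.fiber x) t + (𝔰.gammaPlus x z).rTensor (E.fiber x) t := by
  rw [map_add, LinearMap.rTensor_add, LinearMap.add_apply]

variable [IsContMDiffRiemannianBundle (𝓡 4) ∞ R4 (TangentSpace (𝓡 4) : X → Type)]

/-- Replaces the pointwise choice `onb` by a smooth frame, without which the Dirac equation could
not be differentiated term by term. -/
theorem dirac_eq_sum (B : SpinCConnection 𝔰) (A : UnitaryConnection E)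
    (Ψ : Π x : X, 𝔰.plus.fiber x ⊗[ℂ] E.fiber x) (x : X)
    (e : OrthonormalBasis (Fin 4) ℝ (TangentSpace (𝓡 4) x)) :
    dirac B A Ψ x
      = ∑ a, (𝔰.gammaPlus x (e a)).rTensor (E.fiber x) (tensorCov B.plus A Ψ x (e a)) :=
  sum_orthonormalBasis_eq
    (b := fun v w ↦ (𝔰.gammaPlus x v).rTensor (E.fiber x) (tensorCov B.plus A Ψ x w))
    (fun _ _ _ ↦ gammaPlus_rTensor_add x _ _ _)
    (fun _ _ _ ↦ by rw [tensorCov_add_right, map_add])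
    (fun _ _ _ ↦ by rw [gammaPlus_rTensor_smul, tensorCov_smul_right]) _ e

variable [T2Space X]

theorem tensorCov_zero {m : ℕ} {S : HermitianBundle.{u, v} X m} (B : UnitaryConnection S)
    (A : UnitaryConnection E) (x : X) (w : TangentSpace (𝓡 4) x) :
    tensorCov B A (fun _ ↦ 0) x w = 0 := by
  have h := tensorCov_add B A (AddSubmonoid.zero_mem (tensorSections S E))
    (AddSubmonoid.zero_mem (tensorSections S E)) x w
  have h0 : (fun y ↦ (0 : Π x : X, S.fiber x ⊗[ℂ] E.fiber x) y
      + (0 : Π x : X, S.fiber x ⊗[ℂ] E.fiber x) y) = fun _ ↦ 0 := by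
    funext y
    simp
  rw [h0] at h
  exact left_eq_add.1 h

theorem tensorCov_sum {m : ℕ} {S : HermitianBundle.{u, v} X m} (B : UnitaryConnection S)
    (A : UnitaryConnection E) {ι : Type*} (s : Finset ι)
    {Ψ : ι → Π x : X, S.fiber x ⊗[ℂ] E.fiber x} (hΨ : ∀ i, Ψ i ∈ tensorSections S E) (x : X)
    (w : TangentSpace (𝓡 4) x) :
    (fun y ↦ ∑ i ∈ s, Ψ i y) ∈ tensorSections S E ∧
      tensorCov B A (fun y ↦ ∑ i ∈ s, Ψ i y) x w = ∑ i ∈ s, tensorCov B A (Ψ i) x w := by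
  classical
  induction s using Finset.induction_on with
  | empty => exact ⟨AddSubmonoid.zero_mem _, by simpa using tensorCov_zero B A x w⟩
  | insert i s hi ih =>
    simp only [Finset.sum_insert hi]
    exact ⟨AddSubmonoid.add_mem _ (hΨ i) ih.1, by rw [tensorCov_add B A (hΨ i) ih.1, ih.2]⟩

/-- The second covariant derivative `∇²_{w, z} Ψ` at `x`, for `z` extended to the vector field
`Z`. -/
def secondCov {m : ℕ} {S : HermitianBundle.{u, v} X m} (B : UnitaryConnection S)
    (A : UnitaryConnection E) (Ψ : Π x : X, S.fiber x ⊗[ℂ] E.fiber x)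
    (Z : Π x : X, TangentSpace (𝓡 4) x) (x : X) (w : TangentSpace (𝓡 4) x) :
    S.fiber x ⊗[ℂ] E.fiber x :=
  tensorCov B A (fun y ↦ tensorCov B A Ψ y (Z y)) x w - tensorCov B A Ψ x (leviCivita Z x w)

theorem secondCov_sub {m : ℕ} {S : HermitianBundle.{u, v} X m} (B : UnitaryConnection S)
    (A : UnitaryConnection E) (o : ManifoldOrientation X)
    {Ψ : Π x : X, S.fiber x ⊗[ℂ] E.fiber x} (hΨ : Ψ ∈ tensorSections S E)
    {W Z : Π x : X, TangentSpace (𝓡 4) x} (hW : SmoothSec R4 W) (hZ : SmoothSec R4 Z) (x : X) :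
    secondCov B A Ψ Z x (W x) - secondCov B A Ψ W x (Z x)
      = (TensorProduct.map (B.curvature x (W x) (Z x)) LinearMap.id
        + TensorProduct.map LinearMap.id (A.curvature x (W x) (Z x)) :
          End ℂ (S.fiber x ⊗[ℂ] E.fiber x)) (Ψ x) := by
  rw [← tensorCov_curvature B A o hΨ hW hZ, ← leviCivita_torsion (hW.diffSecAt x) (hZ.diffSecAt x),
    tensorCov_sub_right, secondCov, secondCov]
  abel

/-- The Dirac equation differentiated along w. Since γ is parallel, the derivative falls either on
the spinor or on the frame vector inside γ; by skewness of the frame's connection matrix, the second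
contribution is the correction term of `secondCov`. -/
theorem sum_clifford_secondCov (B : SpinCConnection 𝔰) (A : UnitaryConnection E)
    {Ψ : Π x : X, 𝔰.plus.fiber x ⊗[ℂ] E.fiber x} (hΨ : Ψ ∈ tensorSections 𝔰.plus E) {x₀ : X}
    (hD : ∀ᶠ y in 𝓝 x₀, dirac B A Ψ y = 0) {e : Fin 4 → Π x : X, TangentSpace (𝓡 4) x}
    (he : ∀ a, SmoothSec R4 (e a)) (hon : ∀ᶠ y in 𝓝 x₀,
      ∃ f : OrthonormalBasis (Fin 4) ℝ (TangentSpace (𝓡 4) y), ∀ a, e a y = f a)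
    (w : TangentSpace (𝓡 4) x₀) :
    ∑ b, (𝔰.gammaPlus x₀ (e b x₀)).rTensor (E.fiber x₀) (secondCov B.plus A Ψ (e b) x₀ w) = 0 := by
  have hm : ∀ b, (fun y ↦ (𝔰.gammaPlus y (e b y)).rTensor (E.fiber y)
      (tensorCov B.plus A Ψ y (e b y))) ∈ tensorSections 𝔰.minus E := fun b ↦
    clifford_mem (tensorCov_mem B.plus A hΨ (he b)) (he b)
  have hs := tensorCov_sum B.minus A Finset.univ hm x₀ w
  have h0 : tensorCov B.minus A (fun y ↦ ∑ b, (𝔰.gammaPlus y (e b y)).rTensor (E.fiber y)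
      (tensorCov B.plus A Ψ y (e b y))) x₀ = tensorCov B.minus A (fun _ ↦ 0) x₀ := by
    refine tensorCov_congr B.minus A (diffSecAt_component hs.1 x₀)
      (diffSecAt_component (AddSubmonoid.zero_mem _) x₀) ?_
    filter_upwards [hD, hon] with y h1 h2
    obtain ⟨f, hf⟩ := h2
    simp only [hf]
    rw [← dirac_eq_sum, h1]
  rw [h0, tensorCov_zero] at hs
  have hs2 := hs.2
  simp only [tensorCov_clifford B A (tensorCov_mem B.plus A hΨ (he _)) (he _),
    Finset.sum_add_distrib] at hs2
  obtain ⟨f, hf⟩ := hon.self_of_nhds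
  -- The inner products of the frame vectors are constant near `x₀`, so their derivatives vanish.
  have hskew : ∀ a b, ⟪leviCivita (e a) x₀ w, f b⟫_ℝ = -⟪f a, leviCivita (e b) x₀ w⟫_ℝ := by
    intro a b
    obtain ⟨W, hW, rfl⟩ := exists_smooth_tangent w
    have h1 := leviCivita_metric (hW.diffSecAt x₀) ((he a).diffSecAt x₀) ((he b).diffSecAt x₀)
    have h2 : mvfderiv (𝓡 4) (fun y ↦ ⟪e a y, e b y⟫_ℝ) x₀ = 0 := by
      rw [mvfderiv_congr (g := fun _ ↦ if a = b then (1 : ℝ) else 0)]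
      · exact mvfderiv_const _
      · filter_upwards [hon] with y hy
        obtain ⟨g, hg⟩ := hy
        rw [hg, hg, orthonormal_iff_ite.1 g.orthonormal]
    rw [h2, hf, hf] at h1
    simp only [zero_apply] at h1
    linarith
  have h2 := sum_orthonormalBasis_skew (m := fun b ↦ leviCivita (e b) x₀ w)
    (b := fun v z ↦ (𝔰.gammaPlus x₀ v).rTensor (E.fiber x₀) (tensorCov B.plus A Ψ x₀ z))
    (fun _ _ _ ↦ gammaPlus_rTensor_add x₀ _ _ _)
    (fun _ _ _ ↦ by rw [tensorCov_add_right, map_add])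
    (fun _ _ _ ↦ by rw [gammaPlus_rTensor_smul, tensorCov_smul_right]) f hskew
  simp only [hf] at hs2 ⊢
  rw [h2] at hs2
  simp only [secondCov, map_sub, Finset.sum_sub_distrib]
  rw [sub_eq_add_neg, add_comm]
  exact hs2.symm

/-- The Weitzenböck formula for solutions of the Dirac equation. -/
theorem sum_secondCov_eq (B : SpinCConnection 𝔰) (A : UnitaryConnection E)
    {Ψ : Π x : X, 𝔰.plus.fiber x ⊗[ℂ] E.fiber x} (hΨ : Ψ ∈ tensorSections 𝔰.plus E) {x₀ : X}
    (hD : ∀ᶠ y in 𝓝 x₀, dirac B A Ψ y = 0) {e : Fin 4 → Π x : X, TangentSpace (𝓡 4) x}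
    (he : ∀ a, SmoothSec R4 (e a)) (hon : ∀ᶠ y in 𝓝 x₀,
      ∃ f : OrthonormalBasis (Fin 4) ℝ (TangentSpace (𝓡 4) y), ∀ a, e a y = f a) :
    ∑ a, secondCov B.plus A Ψ (e a) x₀ (e a x₀)
      = (2⁻¹ : ℂ) • ∑ a, ∑ b, (gammaTwo 𝔰 x₀ (e a x₀) (e b x₀)).rTensor (E.fiber x₀)
        ((TensorProduct.map (B.plus.curvature x₀ (e a x₀) (e b x₀)) LinearMap.id
          + TensorProduct.map LinearMap.id (A.curvature x₀ (e a x₀) (e b x₀)) :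
            End ℂ (𝔰.plus.fiber x₀ ⊗[ℂ] E.fiber x₀)) (Ψ x₀)) := by
  refine sum_clifford_eq (T := fun a b ↦ secondCov B.plus A Ψ (e b) x₀ (e a x₀)) ?_
    (fun a b ↦ secondCov_sub B.plus A o hΨ (he a) (he b) x₀) ?_
  · intro a b t
    obtain ⟨f, hf⟩ := hon.self_of_nhds
    rw [← LinearMap.add_apply, ← LinearMap.rTensor_add]
    have h1 : gammaTwo 𝔰 x₀ (e a x₀) (e b x₀) + gammaTwo 𝔰 x₀ (e b x₀) (e a x₀)
        = (if a = b then (-2 : ℂ) else 0) • LinearMap.id := by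
      ext s
      simp only [gammaTwo, LinearMap.add_apply, LinearMap.comp_apply, clifford_polarized, hf,
        orthonormal_iff_ite.1 f.orthonormal]
      split_ifs <;> simp
    rw [h1, LinearMap.rTensor_smul, LinearMap.rTensor_id]
    split_ifs <;> simp
  · refine Finset.sum_eq_zero fun a _ ↦ ?_
    -- The differentiated Dirac equation in direction e_a, multiplied by γ(e_a) on S⁻; the sum over
    -- a is D*D in frame notation, up to sign.
    have h := congrArg ((𝔰.gammaMinus x₀ (e a x₀)).rTensor (E.fiber x₀))
      (sum_clifford_secondCov B A hΨ hD he hon (e a x₀))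
    rw [map_sum, map_zero] at h
    simpa only [gammaTwo, LinearMap.rTensor_comp, LinearMap.comp_apply] using h

end Weitzenbock

/-! ### Second derivative test along integral curves -/

section MaximumPrinciple

variable {X : Type u} [TopologicalSpace X] [ChartedSpace R4 X] [IsManifold (𝓡 4) ∞ X] [T2Space X]

/-- Along an integral curve γ of W, the derivatives of f ∘ γ are the iterated derivatives of f along
W, so the statement reduces to one real variable. -/
theorem mvfderiv_eq_zero_of_isLocalMax {f : X → ℝ} (hf : ContMDiff (𝓡 4) 𝓘(ℝ, ℝ) ∞ f) {x₀ : X}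
    (hmax : IsLocalMax f x₀) {W : Π x : X, TangentSpace (𝓡 4) x} (hW : SmoothSec R4 W) :
    mvfderiv (𝓡 4) f x₀ (W x₀) = 0 ∧
      mvfderiv (𝓡 4) (fun y ↦ mvfderiv (𝓡 4) f y (W y)) x₀ (W x₀) ≤ 0 := by
  obtain ⟨γ, h0, hγ⟩ := exists_isMIntegralCurveAt_of_contMDiffAt_boundaryless (t₀ := 0)
    ((hW x₀).of_le (m := 1) (by simp))
  have hder : ∀ {h : X → ℝ}, ContMDiff (𝓡 4) 𝓘(ℝ, ℝ) ∞ h → ∀ᶠ t in 𝓝 (0 : ℝ),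
      HasDerivAt (h ∘ γ) (mvfderiv (𝓡 4) h (γ t) (W (γ t))) t := by
    intro h hh
    filter_upwards [hγ] with t ht
    have h1 := (SmoothSec.mdiff hh (γ t)).hasMFDerivAt.comp t ht
    have h2 : HasFDerivAt (h ∘ γ) ((mvfderiv (𝓡 4) h (γ t)).comp
      ((1 : ℝ →L[ℝ] ℝ).smulRight (W (γ t)))) t := h1.hasFDerivAt
    have h3 := h2.hasDerivAt
    have h4 : (mvfderiv (𝓡 4) h (γ t)).comp ((1 : ℝ →L[ℝ] ℝ).smulRight (W (γ t))) 1
        = mvfderiv (𝓡 4) h (γ t) (W (γ t)) := by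
      rw [ContinuousLinearMap.comp_apply, ContinuousLinearMap.smulRight_apply]
      simp
    rwa [h4] at h3
  have hd1 := hder hf
  have hd2 := (hder (contMDiff_mvfderiv_apply hf hW)).self_of_nhds
  have hcont : ContinuousAt γ 0 := hγ.self_of_nhds.continuousAt
  have hm : IsLocalMax (f ∘ γ) 0 := by
    have h1 : ∀ᶠ y in 𝓝 (γ 0), f y ≤ f (γ 0) := by rw [h0]; exact hmax
    exact hcont.eventually h1
  have hz := hm.deriv_eq_zero
  have hdd : deriv (f ∘ γ) =ᶠ[𝓝 0] (fun y ↦ mvfderiv (𝓡 4) f y (W y)) ∘ γ :=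
    hd1.mono fun t ht ↦ ht.deriv
  have hz' := hd1.self_of_nhds.deriv
  rw [hz, h0] at hz'
  refine ⟨hz'.symm, le_of_not_gt fun hpos ↦ ?_⟩
  have h2 : deriv (deriv (f ∘ γ)) 0 =
      mvfderiv (𝓡 4) (fun y ↦ mvfderiv (𝓡 4) f y (W y)) x₀ (W x₀) := by
    rw [hdd.deriv_eq, hd2.deriv, h0]
  -- A positive second derivative would make 0 a local minimum as well; f ∘ γ would then be locally
  -- constant, with second derivative zero.
  have hmin := isLocalMin_of_deriv_deriv_pos (h2 ▸ hpos) hz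
    hd1.self_of_nhds.continuousAt
  have hc : (f ∘ γ) =ᶠ[𝓝 0] fun _ ↦ (f ∘ γ) 0 := by
    filter_upwards [hm, hmin] with t h3 h4 using le_antisymm h3 h4
  have h5 : deriv (deriv (f ∘ γ)) 0 = 0 := by
    rw [hc.deriv.deriv_eq]
    simp
  rw [h2] at h5
  linarith

end MaximumPrinciple

/-! ### The Riemann tensor and the scalar curvature -/

section Riemann

/-- The pair symmetry of tensors with the symmetries of the Riemann tensor. -/
theorem pair_symm {α : Type*} {r : α → α → α → α → ℝ} (h1 : ∀ a b c d, r a b c d = -r b a c d)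
    (h2 : ∀ a b c d, r a b c d = -r a b d c)
    (h3 : ∀ a b c d, r a b c d + r b c a d + r c a b d = 0) (a b c d : α) :
    r a b c d = r c d a b := by
  -- The classical combination of four Bianchi identities; the skew symmetries serve only to
  -- normalize the order of the indices.
  linarith [h3 a b c d, h3 b c d a, h3 c d a b, h3 d a b c, h1 a b c d, h2 a b c d, h1 b c a d,
    h2 b c a d, h1 c a b d, h2 c a b d, h1 b c d a, h2 b c d a, h1 c d b a, h2 c d b a,
    h1 d b c a, h2 d b c a, h1 c d a b, h2 c d a b, h1 d a c b, h2 d a c b, h1 a c d b, h2 a c d b,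
    h1 d a b c, h2 d a b c, h1 a b d c, h2 a b d c, h1 b d a c, h2 b d a c]

variable {X : Type u} [TopologicalSpace X] [ChartedSpace R4 X] [IsManifold (𝓡 4) ∞ X]
  [RiemannianBundle (TangentSpace (𝓡 4) : X → Type)]
  [IsContMDiffRiemannianBundle (𝓡 4) ∞ R4 (TangentSpace (𝓡 4) : X → Type)]

/-- The Riemann tensor `⟨R(w, z) u, v⟩`. -/
def riemann (x : X) (w z u v : TangentSpace (𝓡 4) x) : ℝ :=
  ⟪curv leviCivita (FiberBundle.extend R4 u) x w z, v⟫_ℝ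

theorem riemann_add_right (x : X) (w z u v v' : TangentSpace (𝓡 4) x) :
    riemann x w z u (v + v') = riemann x w z u v + riemann x w z u v' :=
  inner_add_right _ _ _

theorem riemann_smul_right (x : X) (r : ℝ) (w z u v : TangentSpace (𝓡 4) x) :
    riemann x w z u (r • v) = r * riemann x w z u v :=
  real_inner_smul_right _ _ _

variable [T2Space X]

theorem exists_riemann_eq (o : ManifoldOrientation X) (x : X) (u : TangentSpace (𝓡 4) x) :
    ∃ U : Π x : X, TangentSpace (𝓡 4) x, SmoothSec R4 U ∧ U x = u ∧ ∀ w z v,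
      riemann x w z u v = ⟪curv leviCivita U x w z, v⟫_ℝ := by
  obtain ⟨N, hN, h⟩ := FiberBundle.exists_contMDiffOn_extend (𝓡 4) R4 (k := ∞)
    (V := (TangentSpace (𝓡 4) : X → Type)) u
  obtain ⟨σ, hσ, hσe⟩ := exists_smoothSec_eventuallyEq hN h
  refine ⟨σ, hσ, by rw [hσe.self_of_nhds, FiberBundle.extend_apply_self], fun w z v ↦ ?_⟩
  rw [riemann, curv_congr o (isSmoothCov_leviCivita o) hσ hN h hσe]

/-- Independence of the extension of the third argument needs no new computation: pair symmetry
moves U into the first slot, where tensoriality is already known. -/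
theorem riemann_apply (o : ManifoldOrientation X) {W Z U V : Π x : X, TangentSpace (𝓡 4) x} (hW : SmoothSec R4 W)
    (hZ : SmoothSec R4 Z) (hU : SmoothSec R4 U) (hV : SmoothSec R4 V) (x : X) :
    riemann x (W x) (Z x) (U x) (V x) = ⟪covCurv leviCivita W Z U x, V x⟫_ℝ := by
  have hL := isSmoothCov_leviCivita o
  have hps : ∀ {W Z U V : Π x : X, TangentSpace (𝓡 4) x}, SmoothSec R4 W → SmoothSec R4 Z →
      SmoothSec R4 U → SmoothSec R4 V →
      ⟪covCurv leviCivita W Z U x, V x⟫_ℝ = ⟪covCurv leviCivita U V W x, Z x⟫_ℝ := by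
    intro W Z U V hW hZ hU hV
    refine pair_symm (α := {W : Π x : X, TangentSpace (𝓡 4) x // SmoothSec R4 W})
      (r := fun W Z U V ↦ ⟪covCurv leviCivita W.1 Z.1 U.1 x, V.1 x⟫_ℝ) ?_ ?_ ?_
      ⟨W, hW⟩ ⟨Z, hZ⟩ ⟨U, hU⟩ ⟨V, hV⟩
    · intro W Z U V
      rw [covCurv_swap, inner_neg_left]
    · intro W Z U V
      have h := leviCivita_curv_skew o W.2 Z.2 U.2 V.2 x
      rw [real_inner_comm (covCurv _ _ _ _ _) (U.1 x)] at h
      linarith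
    · intro W Z U V
      rw [← inner_add_left, ← inner_add_left, leviCivita_bianchi o W.2 Z.2 U.2, inner_zero_left]
  obtain ⟨U', hU', he, h⟩ := exists_riemann_eq o x (U x)
  rw [h, curv_eq_covCurv o hL hU' (hW.diffSecAt x) (hZ.diffSecAt x), hps hW hZ hU' hV,
    hps hW hZ hU hV, ← curv_eq_covCurv o hL hW (hU.diffSecAt x) (hV.diffSecAt x),
    ← curv_eq_covCurv o hL hW (hU'.diffSecAt x) (hV.diffSecAt x), he]

theorem riemann_swap (o : ManifoldOrientation X) (x : X) (w z u v : TangentSpace (𝓡 4) x) :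
    riemann x w z u v = -riemann x z w u v := by
  obtain ⟨W, hW, rfl⟩ := exists_smooth_tangent w
  obtain ⟨Z, hZ, rfl⟩ := exists_smooth_tangent z
  obtain ⟨U, hU, rfl⟩ := exists_smooth_tangent u
  obtain ⟨V, hV, rfl⟩ := exists_smooth_tangent v
  rw [riemann_apply o hW hZ hU hV, riemann_apply o hZ hW hU hV, covCurv_swap, inner_neg_left]

theorem riemann_skew (o : ManifoldOrientation X) (x : X) (w z u v : TangentSpace (𝓡 4) x) :
    riemann x w z u v = -riemann x w z v u := by
  obtain ⟨W, hW, rfl⟩ := exists_smooth_tangent w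
  obtain ⟨Z, hZ, rfl⟩ := exists_smooth_tangent z
  obtain ⟨U, hU, rfl⟩ := exists_smooth_tangent u
  obtain ⟨V, hV, rfl⟩ := exists_smooth_tangent v
  rw [riemann_apply o hW hZ hU hV, riemann_apply o hW hZ hV hU]
  have h := leviCivita_curv_skew o hW hZ hU hV x
  rw [real_inner_comm (covCurv _ _ _ _ _) (U x)] at h
  linarith

theorem riemann_bianchi (o : ManifoldOrientation X) (x : X) (w z u v : TangentSpace (𝓡 4) x) :
    riemann x w z u v + riemann x z u w v + riemann x u w z v = 0 := by
  obtain ⟨W, hW, rfl⟩ := exists_smooth_tangent w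
  obtain ⟨Z, hZ, rfl⟩ := exists_smooth_tangent z
  obtain ⟨U, hU, rfl⟩ := exists_smooth_tangent u
  obtain ⟨V, hV, rfl⟩ := exists_smooth_tangent v
  rw [riemann_apply o hW hZ hU hV, riemann_apply o hZ hU hW hV, riemann_apply o hU hW hZ hV,
    ← inner_add_left, ← inner_add_left, leviCivita_bianchi o hW hZ hU, inner_zero_left]

theorem riemann_add_left (o : ManifoldOrientation X) (x : X) (w w' z u v : TangentSpace (𝓡 4) x) :
    riemann x (w + w') z u v = riemann x w z u v + riemann x w' z u v := by
  obtain ⟨U, hU, rfl, h⟩ := exists_riemann_eq o x u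
  obtain ⟨B, hB⟩ := exists_curv_bilinear o (isSmoothCov_leviCivita o) hU x
  simp only [h, hB, map_add, LinearMap.add_apply, inner_add_left]

theorem riemann_smul_left (o : ManifoldOrientation X) (x : X) (r : ℝ) (w z u v : TangentSpace (𝓡 4) x) :
    riemann x (r • w) z u v = r * riemann x w z u v := by
  obtain ⟨U, hU, rfl, h⟩ := exists_riemann_eq o x u
  obtain ⟨B, hB⟩ := exists_curv_bilinear o (isSmoothCov_leviCivita o) hU x
  simp only [h, hB, map_smul, LinearMap.smul_apply, real_inner_smul_left]

/-- The basis is changed in one contracted pair of slots at a time; the two skew symmetries bring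
the other pair into position. -/
theorem scalarCurvature_eq (o : ManifoldOrientation X) (x : X) (e : OrthonormalBasis (Fin 4) ℝ (TangentSpace (𝓡 4) x)) :
    scalarCurvature x = ∑ a, ∑ b, riemann x (e a) (e b) (e b) (e a) := by
  have h1 : ∀ f f' : OrthonormalBasis (Fin 4) ℝ (TangentSpace (𝓡 4) x), ∀ b,
      ∑ a, riemann x (f a) b b (f a) = ∑ a, riemann x (f' a) b b (f' a) := fun f f' b ↦
    sum_orthonormalBasis_eq (b := fun v w ↦ riemann x v b b w)
      (fun _ _ _ ↦ riemann_add_left o x _ _ _ _ _) (fun _ _ _ ↦ riemann_add_right x _ _ _ _ _)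
      (fun _ _ _ ↦ by rw [riemann_smul_left o, riemann_smul_right]) f f'
  have h2 : ∀ w z, riemann x w z z w = riemann x z w w z := fun w z ↦ by
    rw [riemann_swap o, riemann_skew o, neg_neg]
  calc scalarCurvature x = ∑ a, ∑ b, riemann x (onb x a) (onb x b) (onb x b) (onb x a) := rfl
    _ = ∑ b, ∑ a, riemann x (e a) (onb x b) (onb x b) (e a) := by
        rw [Finset.sum_comm]
        exact Finset.sum_congr rfl fun b _ ↦ h1 _ _ _
    _ = _ := by
        rw [Finset.sum_comm]
        refine Finset.sum_congr rfl fun a _ ↦ ?_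
        simp only [h2 (e a)]
        exact h1 _ _ _

end Riemann

/-! ### Quaternion relations on a two-dimensional space -/

section Quaternion

variable {V : Type*} [AddCommGroup V] [Module ℂ V]

/-- Endomorphisms `I`, `J`, `K` which satisfy the relations of the imaginary quaternions. -/
structure IsQuaternionic (I J K : End ℂ V) : Prop where
  II : I * I = -1
  JJ : J * J = -1
  KK : K * K = -1
  IJ : I * J = K
  JI : J * I = -K
  JK : J * K = I
  KJ : K * J = -I
  KI : K * I = J
  IK : I * K = -J

variable {I J K : End ℂ V} [FiniteDimensional ℂ V]

theorem IsQuaternionic.trace_eq_zero (h : IsQuaternionic I J K) :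
    LinearMap.trace ℂ V I = 0 ∧ LinearMap.trace ℂ V J = 0 ∧ LinearMap.trace ℂ V K = 0 := by
  have key : ∀ {A B C : End ℂ V}, A * B = C → B * A = -C → LinearMap.trace ℂ V C = 0 := by
    intro A B C h1 h2
    have h3 := LinearMap.trace_mul_comm ℂ A B
    rw [h1, h2, map_neg] at h3
    linear_combination h3 / 2
  exact ⟨key h.JK h.KJ, key h.KI h.IK, key h.IJ h.JI⟩

/-- Schur's lemma by hand. An eigenspace of T is stable under I and J; if it were a line, they would
act on it by scalars α, β with α² = β² = −1 and αβ = −βα, which is impossible. -/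
theorem IsQuaternionic.exists_eq_smul (h : IsQuaternionic I J K) (hV : finrank ℂ V = 2)
    {T : End ℂ V} (hI : T * I = I * T) (hJ : T * J = J * T) : ∃ c : ℂ, T = c • 1 := by
  have hnt : Nontrivial V := Module.nontrivial_of_finrank_pos (R := ℂ) (by omega)
  obtain ⟨c, hc⟩ := Module.End.exists_eigenvalue T
  refine ⟨c, ?_⟩
  have hmem : ∀ {A : End ℂ V}, T * A = A * T → ∀ v ∈ T.eigenspace c, A v ∈ T.eigenspace c := by
    intro A hA v hv
    rw [Module.End.mem_eigenspace_iff] at hv ⊢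
    rw [← Module.End.mul_apply, hA, Module.End.mul_apply, hv, map_smul]
  suffices ht : T.eigenspace c = ⊤ by
    ext v
    have hv : v ∈ T.eigenspace c := ht ▸ Submodule.mem_top
    simpa using Module.End.mem_eigenspace_iff.1 hv
  obtain ⟨v, hv, hv0⟩ := (Submodule.ne_bot_iff _).1 hc
  by_contra hne
  have hlt := Submodule.finrank_lt hne
  have hpos : 0 < finrank ℂ (T.eigenspace c) :=
    Module.finrank_pos_iff_exists_ne_zero.2 ⟨⟨v, hv⟩, by simpa [Subtype.ext_iff] using hv0⟩
  have h1 : finrank ℂ (T.eigenspace c) = 1 := by omega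
  have hsp := (finrank_eq_one_iff_of_nonzero' (⟨v, hv⟩ : T.eigenspace c)
    (by simpa [Subtype.ext_iff] using hv0)).1 h1
  obtain ⟨α, hα⟩ := hsp ⟨I v, hmem hI v hv⟩
  obtain ⟨β, hβ⟩ := hsp ⟨J v, hmem hJ v hv⟩
  have hα' : I v = α • v := (congrArg Subtype.val hα).symm
  have hβ' : J v = β • v := (congrArg Subtype.val hβ).symm
  have h2 := congrArg (fun A ↦ A v) h.II
  have h3 := congrArg (fun A ↦ A v) h.JJ
  have h4 := congrArg (fun A ↦ A v) (h.IJ.trans (neg_eq_iff_eq_neg.2 h.JI).symm)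
  simp only [Module.End.mul_apply, LinearMap.neg_apply, Module.End.one_apply, hα', hβ', map_smul,
    smul_smul] at h2 h3 h4
  have e2 : α * α + 1 = 0 := by
    have : (α * α + 1) • v = 0 := by rw [add_smul, h2, one_smul, neg_add_cancel]
    exact (smul_eq_zero.1 this).resolve_right hv0
  have e3 : β * β + 1 = 0 := by
    have : (β * β + 1) • v = 0 := by rw [add_smul, h3, one_smul, neg_add_cancel]
    exact (smul_eq_zero.1 this).resolve_right hv0
  have e4 : β * α + α * β = 0 := by
    have : (β * α + α * β) • v = 0 := by rw [add_smul, h4, neg_add_cancel]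
    exact (smul_eq_zero.1 this).resolve_right hv0
  have e5 : α * β = 0 := by linear_combination e4 / 2
  have e6 : (α * α) * (β * β) = 0 := by linear_combination α * β * e5
  have e7 : (1 : ℂ) = 0 := by linear_combination e6 - β * β * e2 + e3
  exact one_ne_zero e7

/-- An endomorphism of a two-dimensional space is determined by its trace and its commutators with
the imaginary quaternions. -/
theorem IsQuaternionic.eq_of_commutator (h : IsQuaternionic I J K) (hV : finrank ℂ V = 2)
    {T : End ℂ V} {ρ₁ ρ₂ ρ₃ : ℂ} (hI : T * I - I * T = ρ₃ • J - ρ₂ • K)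
    (hJ : T * J - J * T = ρ₁ • K - ρ₃ • I) :
    T = (2⁻¹ : ℂ) • (ρ₁ • I + ρ₂ • J + ρ₃ • K) + (2⁻¹ * LinearMap.trace ℂ V T) • 1 := by
  -- The subtracted combination has exactly the prescribed commutators, so T' commutes with I and J
  -- and is scalar; as I, J, K are trace-free, the scalar is half the trace of T.
  set T' := T - (2⁻¹ : ℂ) • (ρ₁ • I + ρ₂ • J + ρ₃ • K) with hT'
  have h1 : T' * I = I * T' := by
    rw [← sub_eq_zero]
    have : T' * I - I * T' = (T * I - I * T) - (ρ₃ • J - ρ₂ • K) := by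
      simp only [hT', sub_mul, mul_sub, smul_mul_assoc, mul_smul_comm, add_mul, mul_add, h.II,
        h.JI, h.KI, h.IJ, h.IK]
      module
    rw [this, hI, sub_self]
  have h2 : T' * J = J * T' := by
    rw [← sub_eq_zero]
    have : T' * J - J * T' = (T * J - J * T) - (ρ₁ • K - ρ₃ • I) := by
      simp only [hT', sub_mul, mul_sub, smul_mul_assoc, mul_smul_comm, add_mul, mul_add, h.JJ,
        h.JI, h.KJ, h.IJ, h.JK]
      module
    rw [this, hJ, sub_self]
  obtain ⟨c, hc⟩ := h.exists_eq_smul hV h1 h2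
  have h3 : T = (2⁻¹ : ℂ) • (ρ₁ • I + ρ₂ • J + ρ₃ • K) + c • 1 := by
    rw [← hc, hT']
    abel
  have h4 : LinearMap.trace ℂ V T = c * 2 := by
    obtain ⟨t1, t2, t3⟩ := h.trace_eq_zero
    rw [h3]
    simp only [map_add, map_smul, t1, t2, t3, LinearMap.trace_one, hV]
    simp
  rw [h4, show (2⁻¹ * (c * 2) : ℂ) = c by ring]
  exact h3

/-- Off-diagonal terms cancel because A is symmetric and I, J, K anticommute; the squares contribute
minus the trace of A. -/
theorem IsQuaternionic.sum_mul_eq (h : IsQuaternionic I J K) {A : Fin 3 → Fin 3 → ℂ} {s : ℂ}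
    (h01 : A 0 1 = A 1 0) (h02 : A 0 2 = A 2 0) (h12 : A 1 2 = A 2 1)
    (hs : A 0 0 + A 1 1 + A 2 2 = -s) :
    I * (A 0 0 • I + A 0 1 • J + A 0 2 • K) + J * (A 1 0 • I + A 1 1 • J + A 1 2 • K)
      + K * (A 2 0 • I + A 2 1 • J + A 2 2 • K) = s • 1 := by
  have hs' : s = -(A 0 0 + A 1 1 + A 2 2) := by rw [hs, neg_neg]
  simp only [mul_add, mul_smul_comm, h.II, h.JJ, h.KK, h.IJ, h.JI, h.JK, h.KJ, h.KI, h.IK, hs',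
    h01, h02, h12]
  module

end Quaternion

/-! ### Clifford relations on the positive spinors -/

section Clifford

theorem HermitianBundle.finrank_fiber {X : Type u} [TopologicalSpace X] [ChartedSpace R4 X] {n : ℕ}
    (V : HermitianBundle.{u, v} X n) (x : X) : finrank ℂ (V.fiber x) = n := by
  rw [((trivializationAt (Cn n) V.fiber x).continuousLinearEquivAt ℂ x
    (FiberBundle.mem_baseSet_trivializationAt' x)).toLinearEquiv.finrank_eq,
    finrank_euclideanSpace_fin]

variable {X : Type u} [TopologicalSpace X] [ChartedSpace R4 X] [IsManifold (𝓡 4) ∞ X]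
  [RiemannianBundle (TangentSpace (𝓡 4) : X → Type)]
  {o : ManifoldOrientation X} {𝔰 : SpinCStructure.{u, v} o} {n : ℕ}
  {E : HermitianBundle.{u, v} X n} {x : X}

/-- The Clifford relation is assumed on S⁺ only. For a unit vector, γ(w) from S⁺ to S⁻ is injective,
hence surjective by equality of ranks, and this transfers the relation to S⁻. -/
theorem clifford_minus {w : TangentSpace (𝓡 4) x} (hw : ‖w‖ = 1) (t : 𝔰.minus.fiber x) :
    𝔰.gammaPlus x w (𝔰.gammaMinus x w t) = -t := by
  have h1 : ∀ s, 𝔰.gammaMinus x w (𝔰.gammaPlus x w s) = -s := fun s ↦ by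
    rw [𝔰.clifford, hw]
    simp
  have hinj : Function.Injective (𝔰.gammaPlus x w) := fun s s' h ↦ by
    have h2 := h1 s
    rw [h, h1 s'] at h2
    exact (neg_injective h2).symm
  have hsurj := (LinearMap.injective_iff_surjective_of_finrank_eq_finrank
    ((𝔰.plus.finrank_fiber x).trans (𝔰.minus.finrank_fiber x).symm)).1 hinj
  obtain ⟨s, rfl⟩ := hsurj t
  rw [h1, map_neg]

variable (𝔰) in
theorem gammaTwo_mul_gammaTwo (w z v : TangentSpace (𝓡 4) x) (hz : ‖z‖ = 1) :
    gammaTwo 𝔰 x w z * gammaTwo 𝔰 x z v = -gammaTwo 𝔰 x w v := by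
  ext s
  simp only [gammaTwo, Module.End.mul_apply, LinearMap.comp_apply, clifford_minus hz, map_neg,
    LinearMap.neg_apply]

theorem gammaTwo_add_gammaTwo (e : OrthonormalBasis (Fin 4) ℝ (TangentSpace (𝓡 4) x))
    (a b : Fin 4) : gammaTwo 𝔰 x (e a) (e b) + gammaTwo 𝔰 x (e b) (e a)
      = (if a = b then (-2 : ℂ) else 0) • (1 : End ℂ (𝔰.plus.fiber x)) := by
  ext s
  simp only [gammaTwo, LinearMap.add_apply, LinearMap.comp_apply, clifford_polarized,
    orthonormal_iff_ite.1 e.orthonormal]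
  split_ifs <;> simp

theorem gammaTwo_self (e : OrthonormalBasis (Fin 4) ℝ (TangentSpace (𝓡 4) x)) (a : Fin 4) :
    gammaTwo 𝔰 x (e a) (e a) = -1 := by
  have h := gammaTwo_add_gammaTwo (𝔰 := 𝔰) e a a
  rw [if_pos rfl, ← two_smul ℂ] at h
  have h2 := congrArg (fun A ↦ (2⁻¹ : ℂ) • A) h
  simp only [smul_smul] at h2
  norm_num at h2
  exact h2

theorem gammaTwo_swap (e : OrthonormalBasis (Fin 4) ℝ (TangentSpace (𝓡 4) x)) {a b : Fin 4}
    (h : a ≠ b) : gammaTwo 𝔰 x (e a) (e b) = -gammaTwo 𝔰 x (e b) (e a) := by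
  have h1 := gammaTwo_add_gammaTwo (𝔰 := 𝔰) e a b
  rw [if_neg h, zero_smul] at h1
  exact eq_neg_of_add_eq_zero_left h1

/-- In a positively oriented orthonormal basis, self-dual forms act on the positive spinors by the
imaginary quaternions. -/
theorem gammaTwo_quaternionic {e : OrthonormalBasis (Fin 4) ℝ (TangentSpace (𝓡 4) x)}
    (he : e.toBasis.orientation = o.orient x) :
    IsQuaternionic (gammaTwo 𝔰 x (e 0) (e 1)) (gammaTwo 𝔰 x (e 0) (e 2))
      (gammaTwo 𝔰 x (e 0) (e 3)) ∧
    gammaTwo 𝔰 x (e 2) (e 3) = gammaTwo 𝔰 x (e 0) (e 1) ∧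
    gammaTwo 𝔰 x (e 1) (e 3) = -gammaTwo 𝔰 x (e 0) (e 2) ∧
    gammaTwo 𝔰 x (e 1) (e 2) = gammaTwo 𝔰 x (e 0) (e 3) := by
  -- Anticommuting brings two factors γ(e₀) together, which collapse; thus products of I, J, K are
  -- again products of two Clifford factors.
  have hm : ∀ a b, gammaTwo 𝔰 x (e 0) (e a) * gammaTwo 𝔰 x (e 0) (e b)
      = if a = 0 then -gammaTwo 𝔰 x (e 0) (e b) else gammaTwo 𝔰 x (e a) (e b) := by
    intro a b
    split_ifs with h
    · rw [h, gammaTwo_self, neg_one_mul]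
    · rw [gammaTwo_swap e (Ne.symm h), neg_mul, gammaTwo_mul_gammaTwo 𝔰 _ _ _ (by simp), neg_neg]
  set I := gammaTwo 𝔰 x (e 0) (e 1) with hI
  set J := gammaTwo 𝔰 x (e 0) (e 2) with hJ
  set K := gammaTwo 𝔰 x (e 0) (e 3) with hK
  have II : I * I = -1 := by rw [hI, hm]; simp [gammaTwo_self]
  have JJ : J * J = -1 := by rw [hJ, hm]; simp [gammaTwo_self]
  have KK : K * K = -1 := by rw [hK, hm]; simp [gammaTwo_self]
  have IJ : I * J = gammaTwo 𝔰 x (e 1) (e 2) := by rw [hI, hJ, hm]; simp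
  have IK : I * K = gammaTwo 𝔰 x (e 1) (e 3) := by rw [hI, hK, hm]; simp
  have JK : J * K = gammaTwo 𝔰 x (e 2) (e 3) := by rw [hJ, hK, hm]; simp
  have JI : J * I = -(I * J) := by
    rw [IJ, ← gammaTwo_swap e (by decide), hI, hJ, hm]
    simp
  have KI : K * I = -(I * K) := by
    rw [IK, ← gammaTwo_swap e (by decide), hI, hK, hm]
    simp
  have KJ : K * J = -(J * K) := by
    rw [JK, ← gammaTwo_swap e (by decide), hJ, hK, hm]
    simp
  -- The orientation condition is IJK = −1. It fixes the sign in JK = ±I and so identifies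
  -- γ(e₂)γ(e₃) with γ(e₀)γ(e₁).
  have ho : I * (J * K) = -1 := by
    rw [JK]
    ext s
    exact 𝔰.oriented x e he s
  have JK' : J * K = I := by
    have h := congrArg (fun A ↦ I * A) ho
    simp only [← mul_assoc, II, mul_neg, mul_one] at h
    simpa [mul_assoc] using h
  have IK' : I * K = -J := by
    rw [← JK', mul_assoc, KK, mul_neg, mul_one]
  have IJ' : I * J = K := by
    rw [← JK', mul_assoc, KJ, mul_neg, ← mul_assoc, JJ]
    simp
  rw [← JK, ← IK, ← IJ]
  exact ⟨⟨II, JJ, KK, IJ', by rw [JI, IJ'], JK', by rw [KJ, JK'], by rw [KI, IK', neg_neg], IK'⟩,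
    JK', IK', IJ'⟩

theorem gammaTwo_inner (w z : TangentSpace (𝓡 4) x) (s t : 𝔰.plus.fiber x) :
    ⟪gammaTwo 𝔰 x w z s, t⟫_ℂ = ⟪s, gammaTwo 𝔰 x z w t⟫_ℂ := by
  simp only [gammaTwo, LinearMap.comp_apply]
  rw [← neg_neg ⟪s, _⟫_ℂ, ← 𝔰.skew, ← inner_conj_symm, ← neg_neg ⟪t, _⟫_ℂ, ← 𝔰.skew, map_neg,
    inner_conj_symm]

end Clifford

/-! ### Contractions of two bilinear maps -/

section OrthonormalBases

/-- One index at a time by `sum_orthonormalBasis_eq`. Different choices of the balanced pairing P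
cover the norm of a form, the Hodge star and both Clifford actions. -/
theorem sum_sum_orthonormalBasis_eq {H L M N ι ι' : Type*} [NormedAddCommGroup H]
    [InnerProductSpace ℝ H] [AddCommGroup L] [AddCommGroup M] [Module ℝ M] [AddCommGroup N]
    [Module ℝ N] [Fintype ι] [Fintype ι'] {θ : H → H → M} {g : H → H → N} (hθ : IsBilinearMap ℝ θ)
    (hg : IsBilinearMap ℝ g) {P : M → N → L} (hl : ∀ m m' n, P (m + m') n = P m n + P m' n)
    (hr : ∀ m n n', P m (n + n') = P m n + P m n')
    (hb : ∀ (r : ℝ) m n, P (r • m) n = P m (r • n)) (e : OrthonormalBasis ι ℝ H)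
    (f : OrthonormalBasis ι' ℝ H) :
    ∑ a, ∑ b, P (θ (e a) (e b)) (g (e a) (e b)) = ∑ a, ∑ b, P (θ (f a) (f b)) (g (f a) (f b)) := by
  have h1 : ∀ v, ∑ b, P (θ v (e b)) (g v (e b)) = ∑ b, P (θ v (f b)) (g v (f b)) := fun v ↦
    sum_orthonormalBasis_eq (b := fun w z ↦ P (θ v w) (g v z))
      (fun _ _ _ ↦ by rw [hθ.add_right, hl]) (fun _ _ _ ↦ by rw [hg.add_right, hr])
      (fun _ _ _ ↦ by rw [hθ.smul_right, hb, hg.smul_right]) e f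
  have h2 : ∀ v, ∑ b, P (θ (e b) v) (g (e b) v) = ∑ b, P (θ (f b) v) (g (f b) v) := fun v ↦
    sum_orthonormalBasis_eq (b := fun w z ↦ P (θ w v) (g z v))
      (fun _ _ _ ↦ by rw [hθ.add_left, hl]) (fun _ _ _ ↦ by rw [hg.add_left, hr])
      (fun _ _ _ ↦ by rw [hθ.smul_left, hb, hg.smul_left]) e f
  simp only [h1]
  rw [Finset.sum_comm]
  simp only [h2]
  exact Finset.sum_comm

end OrthonormalBases

/-! ### Hodge star and self-dual part in an oriented basis -/

section TwoForms

variable {X : Type u} [TopologicalSpace X] [ChartedSpace R4 X] [IsManifold (𝓡 4) ∞ X]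
  [RiemannianBundle (TangentSpace (𝓡 4) : X → Type)]
  {o : ManifoldOrientation X} {x : X}

theorem formNorm_sq_eq {θ : TangentSpace (𝓡 4) x → TangentSpace (𝓡 4) x → ℂ}
    (hθ : IsBilinearMap ℝ θ) (e : OrthonormalBasis (Fin 4) ℝ (TangentSpace (𝓡 4) x)) :
    formNorm θ ^ 2 = ∑ a, ∑ b, ‖θ (e a) (e b)‖ ^ 2 := by
  rw [formNorm, Real.sq_sqrt (by positivity)]
  have h := sum_sum_orthonormalBasis_eq hθ hθ (P := fun z w ↦ (starRingEnd ℂ z * w).re)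
    (fun _ _ _ ↦ by rw [map_add, add_mul, Complex.add_re])
    (fun _ _ _ ↦ by rw [mul_add, Complex.add_re]) (fun _ _ _ ↦ by simp; ring) (onb x) e
  simpa only [Complex.conj_mul', ← Complex.ofReal_pow, Complex.ofReal_re] using h

theorem isBilinearMap_volumeForm (w z : TangentSpace (𝓡 4) x) :
    IsBilinearMap ℝ (fun v v' ↦ (o.orient x).volumeForm ![w, z, v, v']) := by
  have h : ∀ v v', (o.orient x).volumeForm ![w, z, v, v']
      = (((((o.orient x).volumeForm.curryLeft w).curryLeft z).curryLeft v).curryLeft v') ![] :=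
    fun _ _ ↦ rfl
  constructor <;> intros <;> simp only [h] <;> simp

variable {A : Type*} [AddCommGroup A] [Module ℝ A]
  {θ : TangentSpace (𝓡 4) x → TangentSpace (𝓡 4) x → A}

theorem hodgeStar_eq (hθ : IsBilinearMap ℝ θ) (w z : TangentSpace (𝓡 4) x)
    (e : OrthonormalBasis (Fin 4) ℝ (TangentSpace (𝓡 4) x)) :
    hodgeStar o θ w z = (2⁻¹ : ℝ) • ∑ a, ∑ b,
      (o.orient x).volumeForm ![w, z, e a, e b] • θ (e a) (e b) := by
  rw [hodgeStar, sum_sum_orthonormalBasis_eq (isBilinearMap_volumeForm w z) hθ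
    (P := fun (r : ℝ) (t : A) ↦ r • t) (fun _ _ _ ↦ add_smul _ _ _) (fun _ _ _ ↦ smul_add _ _ _)
    (fun _ _ _ ↦ by rw [smul_eq_mul, mul_smul, smul_comm]) (onb x) e]

theorem isBilinearMap_hodgeStar : IsBilinearMap ℝ (hodgeStar o θ) := by
  have h : ∀ w z v v', (o.orient x).volumeForm ![w, z, v, v']
      = (((((o.orient x).volumeForm.curryLeft w).curryLeft z).curryLeft v).curryLeft v') ![] :=
    fun _ _ _ _ ↦ rfl
  constructor <;> intros <;> simp only [hodgeStar, h]
  · simp [add_smul, Finset.sum_add_distrib]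
  · simp only [map_smul, AlternatingMap.curryLeft_smul, AlternatingMap.smul_apply,
      LinearMap.smul_apply, smul_eq_mul, mul_smul, ← Finset.smul_sum]
    rw [smul_comm]
  · simp [add_smul, Finset.sum_add_distrib]
  · simp only [map_smul, AlternatingMap.curryLeft_smul, AlternatingMap.smul_apply,
      LinearMap.smul_apply, smul_eq_mul, mul_smul, ← Finset.smul_sum]
    rw [smul_comm]

theorem hodgeStar_swap (w z : TangentSpace (𝓡 4) x) :
    hodgeStar o θ w z = -hodgeStar o θ z w := by
  have h : ∀ v v', (o.orient x).volumeForm ![w, z, v, v']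
      = -(o.orient x).volumeForm ![z, w, v, v'] := by
    intro v v'
    rw [← (o.orient x).volumeForm.map_swap _ (show (0 : Fin 4) ≠ 1 by decide)]
    congr 1
    funext i
    fin_cases i <;> rfl
  simp only [hodgeStar, h, neg_smul, Finset.sum_neg_distrib, smul_neg]

theorem isBilinearMap_selfDualPart (hθ : IsBilinearMap ℝ θ) :
    IsBilinearMap ℝ (selfDualPart o θ) := by
  have h := isBilinearMap_hodgeStar (o := o) (θ := θ)
  constructor <;> intros <;> simp only [selfDualPart]
  · rw [hθ.add_left, h.add_left]; module
  · rw [hθ.smul_left, h.smul_left]; module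
  · rw [hθ.add_right, h.add_right]; module
  · rw [hθ.smul_right, h.smul_right]; module

theorem selfDualPart_swap (hs : ∀ w z, θ w z = -θ z w) (w z : TangentSpace (𝓡 4) x) :
    selfDualPart o θ w z = -selfDualPart o θ z w := by
  rw [selfDualPart, hs, hodgeStar_swap, selfDualPart]
  module

/-- The determinant is the sign of the index tuple, or 0 if an index repeats. So is the Vandermonde
product of the indices divided by 12, its value at 0, 1, 2, 3. The integer identity is a finite
check. -/
theorem det_indicator (a b c d : Fin 4) :
    Matrix.det (Matrix.of fun i j ↦ if ![a, b, c, d] j = i then (1 : ℤ) else 0) * 12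
      = (b.val - a.val : ℤ) * (c.val - a.val) * (d.val - a.val) * (c.val - b.val)
        * (d.val - b.val) * (d.val - c.val) := by
  revert a b c d
  decide

/-- The values of the volume form on the vectors of a positively oriented orthonormal basis. -/
theorem volumeForm_basis {e : OrthonormalBasis (Fin 4) ℝ (TangentSpace (𝓡 4) x)}
    (he : e.toBasis.orientation = o.orient x) (a b c d : Fin 4) :
    (o.orient x).volumeForm ![e a, e b, e c, e d]
      = ((b.val - a.val : ℝ) * (c.val - a.val) * (d.val - a.val) * (c.val - b.val)
        * (d.val - b.val) * (d.val - c.val)) / 12 := by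
  rw [eq_div_iff (by norm_num), (o.orient x).volumeForm_robust e he, Basis.det_apply]
  have h : e.toBasis.toMatrix ![e a, e b, e c, e d] = (Int.castRingHom ℝ).mapMatrix
      (Matrix.of fun i j ↦ if ![a, b, c, d] j = i then (1 : ℤ) else 0) := by
    ext i j
    have h : ![e a, e b, e c, e d] j = e (![a, b, c, d] j) := by fin_cases j <;> rfl
    rw [Basis.toMatrix_apply, h]
    simp [eq_comm]
  have h2 := det_indicator a b c d
  rw [h, ← RingHom.map_det, eq_intCast]
  generalize Matrix.det (Matrix.of fun i j ↦ if ![a, b, c, d] j = i then (1 : ℤ) else 0) = D at h2 ⊢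
  have h3 := congrArg (Int.cast (R := ℝ)) h2
  push_cast at h3
  exact h3

theorem hodgeStar_basis (hθ : IsBilinearMap ℝ θ) (hs : ∀ w z, θ w z = -θ z w)
    {e : OrthonormalBasis (Fin 4) ℝ (TangentSpace (𝓡 4) x)}
    (he : e.toBasis.orientation = o.orient x) :
    hodgeStar o θ (e 0) (e 1) = θ (e 2) (e 3) ∧ hodgeStar o θ (e 0) (e 2) = -θ (e 1) (e 3) ∧
    hodgeStar o θ (e 0) (e 3) = θ (e 1) (e 2) ∧ hodgeStar o θ (e 2) (e 3) = θ (e 0) (e 1) ∧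
    hodgeStar o θ (e 1) (e 3) = -θ (e 0) (e 2) ∧ hodgeStar o θ (e 1) (e 2) = θ (e 0) (e 3) := by
  refine ⟨?_, ?_, ?_, ?_, ?_, ?_⟩ <;>
  · rw [hodgeStar_eq hθ _ _ e]
    simp only [volumeForm_basis he, Fin.sum_univ_four]
    norm_num
    simp only [hs (e 1) (e 0), hs (e 2) (e 0), hs (e 3) (e 0), hs (e 2) (e 1), hs (e 3) (e 1),
      hs (e 3) (e 2)]
    module

end TwoForms

/-! ### Clifford action of 2-forms -/

section CliffordForms

variable {X : Type u} [TopologicalSpace X] [ChartedSpace R4 X] [IsManifold (𝓡 4) ∞ X]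
  [RiemannianBundle (TangentSpace (𝓡 4) : X → Type)]
  {o : ManifoldOrientation X} {𝔰 : SpinCStructure.{u, v} o} {n : ℕ}
  {E : HermitianBundle.{u, v} X n} {x : X}

theorem isBilinearMap_gammaTwo : IsBilinearMap ℝ (gammaTwo 𝔰 x) := by
  constructor <;> intros <;> ext <;> simp [gammaTwo]

theorem gammaForm_eq {θ : TangentSpace (𝓡 4) x → TangentSpace (𝓡 4) x → ℂ}
    (hθ : IsBilinearMap ℝ θ) (e : OrthonormalBasis (Fin 4) ℝ (TangentSpace (𝓡 4) x)) :
    gammaForm 𝔰 θ = (2⁻¹ : ℂ) • ∑ a, ∑ b, θ (e a) (e b) • gammaTwo 𝔰 x (e a) (e b) := by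
  rw [gammaForm, sum_sum_orthonormalBasis_eq hθ isBilinearMap_gammaTwo
    (P := fun (r : ℂ) (t : End ℂ (𝔰.plus.fiber x)) ↦ r • t) (fun _ _ _ ↦ add_smul _ _ _)
    (fun _ _ _ ↦ smul_add _ _ _) (fun _ _ _ ↦ by rw [smul_assoc, smul_comm]) (onb x) e]

theorem gammaEndForm_eq {θ : TangentSpace (𝓡 4) x → TangentSpace (𝓡 4) x → End ℂ (E.fiber x)}
    (hθ : IsBilinearMap ℝ θ) (e : OrthonormalBasis (Fin 4) ℝ (TangentSpace (𝓡 4) x)) :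
    gammaEndForm 𝔰 E θ
      = (2⁻¹ : ℂ) • ∑ a, ∑ b, TensorProduct.map (gammaTwo 𝔰 x (e a) (e b)) (θ (e a) (e b)) := by
  have hs : ∀ (r : ℝ) (f : End ℂ (𝔰.plus.fiber x)) (g : End ℂ (E.fiber x)),
      TensorProduct.map (r • f) g = TensorProduct.map f (r • g) := by
    intro r f g
    have h1 : r • f = (r : ℂ) • f := by ext; simp
    have h2 : r • g = (r : ℂ) • g := by ext; simp
    rw [h1, h2, TensorProduct.map_smul_left, TensorProduct.map_smul_right]
  rw [gammaEndForm, sum_sum_orthonormalBasis_eq isBilinearMap_gammaTwo hθ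
    (P := fun (f : End ℂ (𝔰.plus.fiber x)) (g : End ℂ (E.fiber x)) ↦ TensorProduct.map f g)
    (fun _ _ _ ↦ TensorProduct.map_add_left _ _ _) (fun _ _ _ ↦ TensorProduct.map_add_right _ _ _)
    hs (onb x) e]

/-- On S⁺ the six products γ(e_a)γ(e_b), a < b, coincide in pairs up to sign, so only the three
self-dual combinations of coefficients remain. -/
theorem gammaForm_eq_quaternion {θ : TangentSpace (𝓡 4) x → TangentSpace (𝓡 4) x → ℂ}
    (hθ : IsBilinearMap ℝ θ) (hs : ∀ w z, θ w z = -θ z w)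
    {e : OrthonormalBasis (Fin 4) ℝ (TangentSpace (𝓡 4) x)}
    (he : e.toBasis.orientation = o.orient x) :
    gammaForm 𝔰 θ = (θ (e 0) (e 1) + θ (e 2) (e 3)) • gammaTwo 𝔰 x (e 0) (e 1)
      + (θ (e 0) (e 2) - θ (e 1) (e 3)) • gammaTwo 𝔰 x (e 0) (e 2)
      + (θ (e 0) (e 3) + θ (e 1) (e 2)) • gammaTwo 𝔰 x (e 0) (e 3) := by
  obtain ⟨-, h23, h13, h12⟩ := gammaTwo_quaternionic (𝔰 := 𝔰) he
  have h0 : ∀ w, θ w w = 0 := fun w ↦ self_eq_neg.1 (hs w w)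
  rw [gammaForm_eq hθ e]
  simp only [Fin.sum_univ_four, h0, hs (e 1) (e 0), hs (e 2) (e 0), hs (e 3) (e 0),
    hs (e 2) (e 1), hs (e 3) (e 1), hs (e 3) (e 2),
    gammaTwo_swap e (show (1 : Fin 4) ≠ 0 by decide),
    gammaTwo_swap e (show (2 : Fin 4) ≠ 0 by decide),
    gammaTwo_swap e (show (3 : Fin 4) ≠ 0 by decide),
    gammaTwo_swap e (show (2 : Fin 4) ≠ 1 by decide),
    gammaTwo_swap e (show (3 : Fin 4) ≠ 1 by decide),
    gammaTwo_swap e (show (3 : Fin 4) ≠ 2 by decide), h23, h13, h12]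
  module

theorem gammaEndForm_eq_quaternion
    {θ : TangentSpace (𝓡 4) x → TangentSpace (𝓡 4) x → End ℂ (E.fiber x)}
    (hθ : IsBilinearMap ℝ θ) (hs : ∀ w z, θ w z = -θ z w)
    {e : OrthonormalBasis (Fin 4) ℝ (TangentSpace (𝓡 4) x)}
    (he : e.toBasis.orientation = o.orient x) :
    gammaEndForm 𝔰 E θ
      = TensorProduct.map (gammaTwo 𝔰 x (e 0) (e 1)) (θ (e 0) (e 1) + θ (e 2) (e 3))
      + TensorProduct.map (gammaTwo 𝔰 x (e 0) (e 2)) (θ (e 0) (e 2) - θ (e 1) (e 3))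
      + TensorProduct.map (gammaTwo 𝔰 x (e 0) (e 3)) (θ (e 0) (e 3) + θ (e 1) (e 2)) := by
  obtain ⟨-, h23, h13, h12⟩ := gammaTwo_quaternionic (𝔰 := 𝔰) he
  have h0 : ∀ w, θ w w = 0 := fun w ↦ by
    have h := hs w w
    rw [eq_neg_iff_add_eq_zero, ← two_smul ℂ] at h
    exact (smul_eq_zero.1 h).resolve_left two_ne_zero
  have hn : ∀ (f : End ℂ (𝔰.plus.fiber x)) (g : End ℂ (E.fiber x)),
      TensorProduct.map (-f) g = -TensorProduct.map f g := fun f g ↦ by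
    rw [eq_neg_iff_add_eq_zero, ← TensorProduct.map_add_left, neg_add_cancel,
      TensorProduct.map_zero_left]
  have hn' : ∀ (f : End ℂ (𝔰.plus.fiber x)) (g : End ℂ (E.fiber x)),
      TensorProduct.map f (-g) = -TensorProduct.map f g := fun f g ↦ by
    rw [eq_neg_iff_add_eq_zero, ← TensorProduct.map_add_right, neg_add_cancel,
      TensorProduct.map_zero_right]
  rw [gammaEndForm_eq hθ e]
  simp only [Fin.sum_univ_four, h0, hs (e 1) (e 0), hs (e 2) (e 0), hs (e 3) (e 0),
    hs (e 2) (e 1), hs (e 3) (e 1), hs (e 3) (e 2),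
    gammaTwo_swap e (show (1 : Fin 4) ≠ 0 by decide),
    gammaTwo_swap e (show (2 : Fin 4) ≠ 0 by decide),
    gammaTwo_swap e (show (3 : Fin 4) ≠ 0 by decide),
    gammaTwo_swap e (show (2 : Fin 4) ≠ 1 by decide),
    gammaTwo_swap e (show (3 : Fin 4) ≠ 1 by decide),
    gammaTwo_swap e (show (3 : Fin 4) ≠ 2 by decide), h23, h13, h12, hn, hn', sub_eq_add_neg,
    TensorProduct.map_add_right, TensorProduct.map_zero_right]
  module

/-- Averaging with the Hodge star leaves the three self-dual combinations of coefficients unchanged,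
and γ sees nothing else on S⁺. -/
theorem gammaForm_selfDualPart {θ : TangentSpace (𝓡 4) x → TangentSpace (𝓡 4) x → ℂ}
    (hθ : IsBilinearMap ℝ θ) (hs : ∀ w z, θ w z = -θ z w)
    {e : OrthonormalBasis (Fin 4) ℝ (TangentSpace (𝓡 4) x)}
    (he : e.toBasis.orientation = o.orient x) :
    gammaForm 𝔰 (selfDualPart o θ) = gammaForm 𝔰 θ := by
  obtain ⟨h01, h02, h03, h23, h13, h12⟩ := hodgeStar_basis hθ hs he
  rw [gammaForm_eq_quaternion hθ hs he,
    gammaForm_eq_quaternion (isBilinearMap_selfDualPart hθ) (selfDualPart_swap hs) he]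
  simp only [selfDualPart, h01, h02, h03, h23, h13, h12]
  congr 1
  · congr 1 <;> congr 1 <;> module
  · congr 1
    module

theorem gammaEndForm_selfDualPart
    {θ : TangentSpace (𝓡 4) x → TangentSpace (𝓡 4) x → End ℂ (E.fiber x)}
    (hθ : IsBilinearMap ℝ θ) (hs : ∀ w z, θ w z = -θ z w)
    {e : OrthonormalBasis (Fin 4) ℝ (TangentSpace (𝓡 4) x)}
    (he : e.toBasis.orientation = o.orient x) :
    gammaEndForm 𝔰 E (selfDualPart o θ) = gammaEndForm 𝔰 E θ := by
  obtain ⟨h01, h02, h03, h23, h13, h12⟩ := hodgeStar_basis hθ hs he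
  rw [gammaEndForm_eq_quaternion hθ hs he,
    gammaEndForm_eq_quaternion (isBilinearMap_selfDualPart hθ) (selfDualPart_swap hs) he]
  simp only [selfDualPart, h01, h02, h03, h23, h13, h12]
  congr 1
  · congr 1 <;> congr 1 <;> module
  · congr 1
    module

theorem inner_map_id_left {S E : Type*} [NormedAddCommGroup S] [InnerProductSpace ℂ S]
    [NormedAddCommGroup E] [InnerProductSpace ℂ E] {f g : End ℂ S}
    (h : ∀ s t, ⟪f s, t⟫_ℂ = ⟪s, g t⟫_ℂ) (Ψ Φ : S ⊗[ℂ] E) :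
    ⟪TensorProduct.map f LinearMap.id Ψ, Φ⟫_ℂ = ⟪Ψ, TensorProduct.map g LinearMap.id Φ⟫_ℂ := by
  induction Ψ with
  | zero => simp
  | add Ψ Ψ' h1 h2 => rw [map_add, inner_add_left, inner_add_left, h1, h2]
  | tmul s e =>
    induction Φ with
    | zero => simp
    | add Ψ Ψ' h1 h2 => rw [map_add, inner_add_right, inner_add_right, h1, h2]
    | tmul t f' => simp [TensorProduct.inner_tmul, h]

/-- An imaginary-valued 2-form `θ` acts on `S⁺ ⊗ E` with norm at most `|θ|`. -/
theorem norm_gammaForm_le {θ : TangentSpace (𝓡 4) x → TangentSpace (𝓡 4) x → ℂ}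
    (hθ : IsBilinearMap ℝ θ) (hs : ∀ w z, θ w z = -θ z w) (him : ∀ w z, (θ w z).re = 0)
    {e : OrthonormalBasis (Fin 4) ℝ (TangentSpace (𝓡 4) x)}
    (he : e.toBasis.orientation = o.orient x) (Ψ : 𝔰.plus.fiber x ⊗[ℂ] E.fiber x) :
    ‖TensorProduct.map (gammaForm 𝔰 θ) LinearMap.id Ψ‖ ≤ formNorm θ * ‖Ψ‖ := by
  obtain ⟨hQ, -⟩ := gammaTwo_quaternionic (𝔰 := 𝔰) he
  have hc : ∀ w z, starRingEnd ℂ (θ w z) = -θ w z := fun w z ↦ by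
    apply Complex.ext <;> simp [him]
  have hG := gammaForm_eq_quaternion (𝔰 := 𝔰) hθ hs he
  have hadj : ∀ (a : Fin 4), 0 ≠ a → ∀ s t, ⟪gammaTwo 𝔰 x (e 0) (e a) s, t⟫_ℂ
      = -⟪s, gammaTwo 𝔰 x (e 0) (e a) t⟫_ℂ := by
    intro a ha s t
    rw [gammaTwo_inner, gammaTwo_swap e ha.symm, LinearMap.neg_apply, inner_neg_right]
  -- Imaginary coefficients times skew-adjoint quaternions give a self-adjoint operator.
  have hsa : ∀ s t, ⟪gammaForm 𝔰 θ s, t⟫_ℂ = ⟪s, gammaForm 𝔰 θ t⟫_ℂ := by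
    intro s t
    rw [hG]
    simp only [LinearMap.add_apply, LinearMap.smul_apply, inner_add_left, inner_add_right,
      inner_smul_left, inner_smul_right, map_add, map_sub, hc, hadj 1 (by decide),
      hadj 2 (by decide), hadj 3 (by decide)]
    ring
  -- Anticommutation removes the cross terms, so the square is scalar. With self-adjointness, γ(θ)
  -- scales every norm by √q.
  have hsq : gammaForm 𝔰 θ * gammaForm 𝔰 θ = (-((θ (e 0) (e 1) + θ (e 2) (e 3)) ^ 2
      + (θ (e 0) (e 2) - θ (e 1) (e 3)) ^ 2 + (θ (e 0) (e 3) + θ (e 1) (e 2)) ^ 2)) • 1 := by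
    rw [hG]
    simp only [mul_add, add_mul, smul_mul_assoc, mul_smul_comm, hQ.II, hQ.JJ, hQ.KK, hQ.IJ, hQ.JI,
      hQ.JK, hQ.KJ, hQ.KI, hQ.IK]
    module
  have him' : ∀ w z, θ w z = (θ w z).im * Complex.I := fun w z ↦ by
    apply Complex.ext <;> simp [him]
  have hn : ∀ w z, ‖θ w z‖ ^ 2 = (θ w z).im ^ 2 := fun w z ↦ by
    rw [← Complex.normSq_eq_norm_sq, Complex.normSq_apply, him]
    ring
  set q : ℝ := ((θ (e 0) (e 1)).im + (θ (e 2) (e 3)).im) ^ 2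
      + ((θ (e 0) (e 2)).im - (θ (e 1) (e 3)).im) ^ 2
      + ((θ (e 0) (e 3)).im + (θ (e 1) (e 2)).im) ^ 2 with hq
  have hqc : -((θ (e 0) (e 1) + θ (e 2) (e 3)) ^ 2
      + (θ (e 0) (e 2) - θ (e 1) (e 3)) ^ 2 + (θ (e 0) (e 3) + θ (e 1) (e 2)) ^ 2) = (q : ℂ) := by
    rw [him' (e 0) (e 1), him' (e 0) (e 2), him' (e 0) (e 3), him' (e 2) (e 3), him' (e 1) (e 3),
      him' (e 1) (e 2), hq]
    push_cast
    linear_combination (-(((θ (e 0) (e 1)).im + (θ (e 2) (e 3)).im : ℂ) ^ 2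
      + ((θ (e 0) (e 2)).im - (θ (e 1) (e 3)).im : ℂ) ^ 2
      + ((θ (e 0) (e 3)).im + (θ (e 1) (e 2)).im : ℂ) ^ 2)) * Complex.I_sq
  -- (u ± v)² ≤ 2u² + 2v², and `formNorm` counts each coefficient with a < b twice.
  have hle : q ≤ formNorm θ ^ 2 := by
    rw [formNorm_sq_eq hθ e]
    simp only [Fin.sum_univ_four, hn, hs (e 1) (e 0), hs (e 2) (e 0), hs (e 3) (e 0),
      hs (e 2) (e 1), hs (e 3) (e 1), hs (e 3) (e 2), Complex.neg_im]
    nlinarith [sq_nonneg ((θ (e 0) (e 1)).im - (θ (e 2) (e 3)).im),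
      sq_nonneg ((θ (e 0) (e 2)).im + (θ (e 1) (e 3)).im),
      sq_nonneg ((θ (e 0) (e 3)).im - (θ (e 1) (e 2)).im), sq_nonneg (θ (e 0) (e 0)).im,
      sq_nonneg (θ (e 1) (e 1)).im, sq_nonneg (θ (e 2) (e 2)).im, sq_nonneg (θ (e 3) (e 3)).im]
  have hnorm : ‖TensorProduct.map (gammaForm 𝔰 θ) LinearMap.id Ψ‖ ^ 2 = q * ‖Ψ‖ ^ 2 := by
    apply Complex.ofReal_injective
    have h1 := inner_self_eq_norm_sq_to_K (𝕜 := ℂ) (TensorProduct.map (gammaForm 𝔰 θ)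
      (LinearMap.id : End ℂ (E.fiber x)) Ψ)
    have h2 := inner_self_eq_norm_sq_to_K (𝕜 := ℂ) Ψ
    rw [inner_map_id_left hsa, ← LinearMap.comp_apply, ← TensorProduct.map_comp,
      LinearMap.id_comp, ← Module.End.mul_eq_comp, hsq, hqc, TensorProduct.map_smul_left,
      LinearMap.smul_apply, inner_smul_right] at h1
    have h3 : TensorProduct.map (1 : End ℂ (𝔰.plus.fiber x)) (LinearMap.id : End ℂ (E.fiber x)) Ψ
        = Ψ := by
      rw [Module.End.one_eq_id, TensorProduct.map_id, LinearMap.id_apply]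
    rw [h3, h2] at h1
    push_cast
    simpa using h1.symm
  have h0 : 0 ≤ formNorm θ := Real.sqrt_nonneg _
  refine (pow_le_pow_iff_left₀ (norm_nonneg _) (mul_nonneg h0 (norm_nonneg _)) two_ne_zero).1 ?_
  rw [hnorm, mul_pow]
  exact mul_le_mul_of_nonneg_right hle (sq_nonneg _)

end CliffordForms

/-! ### Curvature of the positive spinor bundle -/

section SpinorCurvature

variable {X : Type u} [TopologicalSpace X] [ChartedSpace R4 X] [IsManifold (𝓡 4) ∞ X]
  [RiemannianBundle (TangentSpace (𝓡 4) : X → Type)]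
  [IsContMDiffRiemannianBundle (𝓡 4) ∞ R4 (TangentSpace (𝓡 4) : X → Type)] [T2Space X]
  {o : ManifoldOrientation X} {𝔰 : SpinCStructure.{u, v} o} (B : SpinCConnection 𝔰) {x : X}

theorem curvature_gammaPlus (e : OrthonormalBasis (Fin 4) ℝ (TangentSpace (𝓡 4) x))
    (w z u : TangentSpace (𝓡 4) x) (s : 𝔰.plus.fiber x) :
    B.minus.curvature x w z (𝔰.gammaPlus x u s)
      = 𝔰.gammaPlus x (∑ d, riemann x w z u (e d) • e d) s
        + 𝔰.gammaPlus x u (B.plus.curvature x w z s) := by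
  obtain ⟨W, hW, rfl⟩ := exists_smooth_tangent w
  obtain ⟨Z, hZ, rfl⟩ := exists_smooth_tangent z
  obtain ⟨U, hU, rfl⟩ := exists_smooth_tangent u
  rw [clifford_curvature B hU hW hZ, ← e.sum_repr' (covCurv leviCivita W Z U x)]
  congr 3
  refine Finset.sum_congr rfl fun d _ ↦ ?_
  obtain ⟨V, hV, hVe⟩ := exists_smooth_tangent (e d)
  rw [← hVe, riemann_apply o hW hZ hU hV, real_inner_comm]

/-- The adjoint of `curvature_gammaPlus`: up to sign γ on S⁻ is the adjoint of γ on S⁺, and both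
curvatures are skew-Hermitian. -/
theorem curvature_gammaMinus (e : OrthonormalBasis (Fin 4) ℝ (TangentSpace (𝓡 4) x))
    (w z u : TangentSpace (𝓡 4) x) (t : 𝔰.minus.fiber x) :
    B.plus.curvature x w z (𝔰.gammaMinus x u t)
      = 𝔰.gammaMinus x (∑ d, riemann x w z u (e d) • e d) t
        + 𝔰.gammaMinus x u (B.minus.curvature x w z t) := by
  refine ext_inner_left ℂ fun s ↦ ?_
  have h := congrArg (fun r ↦ ⟪r, t⟫_ℂ) (curvature_gammaPlus B e w z u s)
  simp only [inner_add_left, 𝔰.skew, B.minus.curvature_skew o w z] at h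
  rw [inner_add_right]
  have h2 := B.plus.curvature_skew o w z s (𝔰.gammaMinus x u t)
  linear_combination -h + h2

theorem curvature_gammaTwo (e : OrthonormalBasis (Fin 4) ℝ (TangentSpace (𝓡 4) x))
    (w z : TangentSpace (𝓡 4) x) (a b : Fin 4) :
    B.plus.curvature x w z * gammaTwo 𝔰 x (e a) (e b)
        - gammaTwo 𝔰 x (e a) (e b) * B.plus.curvature x w z
      = ∑ d, ((riemann x w z (e a) (e d) : ℂ) • gammaTwo 𝔰 x (e d) (e b)
        + (riemann x w z (e b) (e d) : ℂ) • gammaTwo 𝔰 x (e a) (e d)) := by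
  ext s
  simp only [LinearMap.sub_apply, Module.End.mul_apply, gammaTwo, LinearMap.comp_apply,
    curvature_gammaMinus B e, curvature_gammaPlus B e, map_add, map_sum, map_smul,
    LinearMap.sum_apply, LinearMap.smul_apply, LinearMap.add_apply, Finset.sum_add_distrib,
    Complex.coe_smul]
  simp only [LinearMap.map_smul_of_tower]
  abel

/-- The curvature of a `Spin^c` connection is determined by the Riemann tensor and its trace. -/
theorem curvature_eq {e : OrthonormalBasis (Fin 4) ℝ (TangentSpace (𝓡 4) x)}
    (he : e.toBasis.orientation = o.orient x) (w z : TangentSpace (𝓡 4) x) :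
    B.plus.curvature x w z = (2⁻¹ : ℂ) •
        (((riemann x w z (e 0) (e 1) + riemann x w z (e 2) (e 3) : ℝ) : ℂ)
            • gammaTwo 𝔰 x (e 0) (e 1)
          + ((riemann x w z (e 0) (e 2) - riemann x w z (e 1) (e 3) : ℝ) : ℂ)
            • gammaTwo 𝔰 x (e 0) (e 2)
          + ((riemann x w z (e 0) (e 3) + riemann x w z (e 1) (e 2) : ℝ) : ℂ)
            • gammaTwo 𝔰 x (e 0) (e 3))
      + (2⁻¹ * LinearMap.trace ℂ _ (B.plus.curvature x w z)) • 1 := by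
  obtain ⟨hQ, h23, h13, h12⟩ := gammaTwo_quaternionic (𝔰 := 𝔰) he
  have hr := fun a b ↦ riemann_skew o x w z (e a) (e b)
  have h0 : ∀ a, riemann x w z (e a) (e a) = 0 := fun a ↦ self_eq_neg.1 (hr a a)
  -- Only the commutators with γ(e₀)γ(e₁) and γ(e₀)γ(e₂) have to be computed; `curvature_gammaTwo`
  -- expresses them by the Riemann tensor.
  refine hQ.eq_of_commutator (𝔰.plus.finrank_fiber x) ?_ ?_ <;>
  · rw [curvature_gammaTwo B e]
    simp only [Fin.sum_univ_four, h0, hr 1 0, hr 2 0, hr 3 0, hr 2 1, hr 3 1, hr 3 2,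
      gammaTwo_self, gammaTwo_swap e (show (1 : Fin 4) ≠ 0 by decide),
      gammaTwo_swap e (show (2 : Fin 4) ≠ 0 by decide),
      gammaTwo_swap e (show (3 : Fin 4) ≠ 0 by decide),
      gammaTwo_swap e (show (2 : Fin 4) ≠ 1 by decide),
      gammaTwo_swap e (show (3 : Fin 4) ≠ 1 by decide),
      gammaTwo_swap e (show (3 : Fin 4) ≠ 2 by decide), h23, h13, h12]
    push_cast
    module

theorem isBilinearMap_curvature {n : ℕ} {V : HermitianBundle.{u, v} X n}
    (o : ManifoldOrientation X) (A : UnitaryConnection V) (x : X) :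
    IsBilinearMap ℝ (A.curvature x) := by
  obtain ⟨C, hC⟩ := A.exists_curvature_bilinear o x
  constructor <;> intros <;> simp only [hC] <;> simp

/-- The block of a curvature tensor which maps self-dual forms to self-dual forms. -/
def selfDualBlock (r : Fin 4 → Fin 4 → Fin 4 → Fin 4 → ℝ) (i j : Fin 3) : ℝ :=
  let α : Fin 4 → Fin 4 → ℝ := fun c d ↦
    ![r 0 1 c d + r 2 3 c d, r 0 2 c d - r 1 3 c d, r 0 3 c d + r 1 2 c d] i
  ![α 0 1 + α 2 3, α 0 2 - α 1 3, α 0 3 + α 1 2] j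

theorem selfDualBlock_symm {r : Fin 4 → Fin 4 → Fin 4 → Fin 4 → ℝ}
    (hps : ∀ a b c d, r a b c d = r c d a b) :
    selfDualBlock r 0 1 = selfDualBlock r 1 0 ∧ selfDualBlock r 0 2 = selfDualBlock r 2 0 ∧
      selfDualBlock r 1 2 = selfDualBlock r 2 1 := by
  simp only [selfDualBlock, Matrix.cons_val]
  refine ⟨?_, ?_, ?_⟩
  · linarith [hps 0 1 0 2, hps 0 1 1 3, hps 2 3 0 2, hps 2 3 1 3]
  · linarith [hps 0 1 0 3, hps 0 1 1 2, hps 2 3 0 3, hps 2 3 1 2]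
  · linarith [hps 0 2 0 3, hps 0 2 1 2, hps 1 3 0 3, hps 1 3 1 2]

/-- The terms r a b a b with a < b add up to minus half the full contraction. The terms with four
distinct indices form twice a Bianchi sum and vanish. -/
theorem selfDualBlock_trace {r : Fin 4 → Fin 4 → Fin 4 → Fin 4 → ℝ}
    (h1 : ∀ a b c d, r a b c d = -r b a c d) (h2 : ∀ a b c d, r a b c d = -r a b d c)
    (h3 : ∀ a b c d, r a b c d + r b c a d + r c a b d = 0) :
    selfDualBlock r 0 0 + selfDualBlock r 1 1 + selfDualBlock r 2 2
      = -((∑ a, ∑ b, r a b b a) / 2) := by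
  have hps := pair_symm h1 h2 h3
  have h0 : ∀ a, r a a a a = 0 := fun a ↦ self_eq_neg.1 (h1 a a a a)
  have h4 : ∀ a b, r a b b a = -r a b a b := fun a b ↦ h2 _ _ _ _
  have h5 : ∀ a b, r a b a b = r b a b a := fun a b ↦ by rw [h1, h2, neg_neg]
  simp only [selfDualBlock, Matrix.cons_val, Fin.sum_univ_four]
  linarith [h4 0 1, h4 0 2, h4 0 3, h4 1 0, h4 1 2, h4 1 3, h4 2 0, h4 2 1, h4 2 3, h4 3 0, h4 3 1,
    h4 3 2, h0 0, h0 1, h0 2, h0 3, h5 0 1, h5 0 2, h5 0 3, h5 1 2, h5 1 3, h5 2 3, h3 0 1 2 3,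
    h1 2 0 1 3, hps 0 1 2 3, hps 0 2 1 3, hps 0 3 1 2]

theorem isBilinearMap_trace_curvature (x : X) :
    IsBilinearMap ℝ (fun w z ↦ LinearMap.trace ℂ (𝔰.plus.fiber x) (B.plus.curvature x w z)) := by
  have hB := isBilinearMap_curvature o B.plus x
  constructor <;> intros
  · rw [hB.add_left, map_add]
  · rw [hB.smul_left, LinearMap.map_smul_of_tower]
  · rw [hB.add_right, map_add]
  · rw [hB.smul_right, LinearMap.map_smul_of_tower]

theorem trace_curvature_swap (x : X) (w z : TangentSpace (𝓡 4) x) :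
    LinearMap.trace ℂ (𝔰.plus.fiber x) (B.plus.curvature x w z)
      = -LinearMap.trace ℂ (𝔰.plus.fiber x) (B.plus.curvature x z w) := by
  rw [B.plus.curvature_swap o, map_neg]

theorem sum_gammaTwo_mul {e : OrthonormalBasis (Fin 4) ℝ (TangentSpace (𝓡 4) x)}
    (he : e.toBasis.orientation = o.orient x)
    {F : TangentSpace (𝓡 4) x → TangentSpace (𝓡 4) x → End ℂ (𝔰.plus.fiber x)}
    (hs : ∀ w z, F w z = -F z w) :
    (2⁻¹ : ℂ) • ∑ a, ∑ b, gammaTwo 𝔰 x (e a) (e b) * F (e a) (e b)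
      = gammaTwo 𝔰 x (e 0) (e 1) * (F (e 0) (e 1) + F (e 2) (e 3))
        + gammaTwo 𝔰 x (e 0) (e 2) * (F (e 0) (e 2) - F (e 1) (e 3))
        + gammaTwo 𝔰 x (e 0) (e 3) * (F (e 0) (e 3) + F (e 1) (e 2)) := by
  obtain ⟨-, h23, h13, h12⟩ := gammaTwo_quaternionic (𝔰 := 𝔰) he
  have hF0 : ∀ w, F w w = 0 := fun w ↦ by
    have h := hs w w
    rw [eq_neg_iff_add_eq_zero, ← two_smul ℂ] at h
    exact (smul_eq_zero.1 h).resolve_left two_ne_zero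
  simp only [Fin.sum_univ_four, hF0, hs (e 1) (e 0), hs (e 2) (e 0), hs (e 3) (e 0),
    hs (e 2) (e 1), hs (e 3) (e 1), hs (e 3) (e 2),
    gammaTwo_swap e (show (1 : Fin 4) ≠ 0 by decide),
    gammaTwo_swap e (show (2 : Fin 4) ≠ 0 by decide),
    gammaTwo_swap e (show (3 : Fin 4) ≠ 0 by decide),
    gammaTwo_swap e (show (2 : Fin 4) ≠ 1 by decide),
    gammaTwo_swap e (show (3 : Fin 4) ≠ 1 by decide),
    gammaTwo_swap e (show (3 : Fin 4) ≠ 2 by decide), h23, h13, h12, mul_add, mul_sub, neg_mul,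
    mul_neg, neg_neg, mul_zero]
  module

/-- The zeroth order term of the Weitzenböck formula which comes from the `Spin^c` connection. -/
theorem sum_gammaTwo_mul_curvature {e : OrthonormalBasis (Fin 4) ℝ (TangentSpace (𝓡 4) x)}
    (he : e.toBasis.orientation = o.orient x) :
    (2⁻¹ : ℂ) • ∑ a, ∑ b, gammaTwo 𝔰 x (e a) (e b) * B.plus.curvature x (e a) (e b)
      = ((scalarCurvature x / 4 : ℝ) : ℂ) • 1 + (2⁻¹ : ℂ) • gammaForm 𝔰
        (fun w z ↦ LinearMap.trace ℂ (𝔰.plus.fiber x) (B.plus.curvature x w z)) := by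
  obtain ⟨hQ, -⟩ := gammaTwo_quaternionic (𝔰 := 𝔰) he
  have h1 := fun a b c d ↦ riemann_swap o x (e a) (e b) (e c) (e d)
  have h2 := fun a b c d ↦ riemann_skew o x (e a) (e b) (e c) (e d)
  have h3 := fun a b c d ↦ riemann_bianchi o x (e a) (e b) (e c) (e d)
  obtain ⟨h01, h02, h12⟩ := selfDualBlock_symm
    (r := fun a b c d ↦ riemann x (e a) (e b) (e c) (e d)) (pair_symm h1 h2 h3)
  have htr := selfDualBlock_trace (r := fun a b c d ↦ riemann x (e a) (e b) (e c) (e d)) h1 h2 h3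
  rw [← scalarCurvature_eq o x e] at htr
  set M : Fin 3 → Fin 3 → ℂ := fun i j ↦
    (selfDualBlock (fun a b c d ↦ riemann x (e a) (e b) (e c) (e d)) i j : ℂ) with hM
  have hc := curvature_eq B he
  have e1 : B.plus.curvature x (e 0) (e 1) + B.plus.curvature x (e 2) (e 3) = (2⁻¹ : ℂ) •
      (M 0 0 • gammaTwo 𝔰 x (e 0) (e 1) + M 0 1 • gammaTwo 𝔰 x (e 0) (e 2)
        + M 0 2 • gammaTwo 𝔰 x (e 0) (e 3)) + (2⁻¹ : ℂ) • (LinearMap.trace ℂ (𝔰.plus.fiber x)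
          (B.plus.curvature x (e 0) (e 1)) + LinearMap.trace ℂ (𝔰.plus.fiber x)
          (B.plus.curvature x (e 2) (e 3))) • (1 : End ℂ (𝔰.plus.fiber x)) := by
    simp only [hM, selfDualBlock, Matrix.cons_val]
    linear_combination (norm := (push_cast; module)) hc (e 0) (e 1) + hc (e 2) (e 3)
  have e2 : B.plus.curvature x (e 0) (e 2) - B.plus.curvature x (e 1) (e 3) = (2⁻¹ : ℂ) •
      (M 1 0 • gammaTwo 𝔰 x (e 0) (e 1) + M 1 1 • gammaTwo 𝔰 x (e 0) (e 2)
        + M 1 2 • gammaTwo 𝔰 x (e 0) (e 3)) + (2⁻¹ : ℂ) • (LinearMap.trace ℂ (𝔰.plus.fiber x)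
          (B.plus.curvature x (e 0) (e 2)) - LinearMap.trace ℂ (𝔰.plus.fiber x)
          (B.plus.curvature x (e 1) (e 3))) • (1 : End ℂ (𝔰.plus.fiber x)) := by
    simp only [hM, selfDualBlock, Matrix.cons_val]
    linear_combination (norm := (push_cast; module)) hc (e 0) (e 2) - hc (e 1) (e 3)
  have e3 : B.plus.curvature x (e 0) (e 3) + B.plus.curvature x (e 1) (e 2) = (2⁻¹ : ℂ) •
      (M 2 0 • gammaTwo 𝔰 x (e 0) (e 1) + M 2 1 • gammaTwo 𝔰 x (e 0) (e 2)
        + M 2 2 • gammaTwo 𝔰 x (e 0) (e 3)) + (2⁻¹ : ℂ) • (LinearMap.trace ℂ (𝔰.plus.fiber x)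
          (B.plus.curvature x (e 0) (e 3)) + LinearMap.trace ℂ (𝔰.plus.fiber x)
          (B.plus.curvature x (e 1) (e 2))) • (1 : End ℂ (𝔰.plus.fiber x)) := by
    simp only [hM, selfDualBlock, Matrix.cons_val]
    linear_combination (norm := (push_cast; module)) hc (e 0) (e 3) + hc (e 1) (e 2)
  -- The block is symmetric of trace −s/2 and so contributes s/2; the factor ½ in `curvature_eq`
  -- turns this into s/4.
  have hsum := hQ.sum_mul_eq (A := M) (s := ((scalarCurvature x / 2 : ℝ) : ℂ))
    (by simp only [hM, h01]) (by simp only [hM, h02]) (by simp only [hM, h12])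
    (by simp only [hM]; exact_mod_cast htr)
  rw [gammaForm_eq_quaternion (isBilinearMap_trace_curvature B x) (trace_curvature_swap B x) he,
    sum_gammaTwo_mul he (B.plus.curvature_swap o), e1, e2, e3]
  have hs : ((scalarCurvature x / 4 : ℝ) : ℂ)
      = 2⁻¹ * ((scalarCurvature x / 2 : ℝ) : ℂ) := by
    push_cast
    ring
  rw [hs, mul_smul, ← hsum]
  clear_value M
  clear e1 e2 e3 hc hsum
  simp only [mul_add, mul_smul_comm, mul_one]
  module

end SpinorCurvature

/-! ### The estimate at a maximum -/

section Estimate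

theorem re_inner_comm {V : Type*} [NormedAddCommGroup V] [InnerProductSpace ℂ V] (x y : V) :
    (⟪x, y⟫_ℂ).re = (⟪y, x⟫_ℂ).re := by
  rw [← inner_conj_symm, Complex.conj_re]

theorem re_inner_self {V : Type*} [NormedAddCommGroup V] [InnerProductSpace ℂ V] (x : V) :
    (⟪x, x⟫_ℂ).re = ‖x‖ ^ 2 :=
  inner_self_eq_norm_sq (𝕜 := ℂ) x

variable {X : Type u} [TopologicalSpace X] [ChartedSpace R4 X] [IsManifold (𝓡 4) ∞ X] [T2Space X]
  {m n : ℕ}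

theorem mvfderiv_re_tensor_inner {S : HermitianBundle.{u, v} X m} {E : HermitianBundle.{u, v} X n}
    (B : UnitaryConnection S) (A : UnitaryConnection E)
    {Ψ Φ : Π x : X, S.fiber x ⊗[ℂ] E.fiber x} (hΨ : Ψ ∈ tensorSections S E)
    (hΦ : Φ ∈ tensorSections S E) (x : X) (w : TangentSpace (𝓡 4) x) :
    mvfderiv (𝓡 4) (fun y ↦ (⟪Ψ y, Φ y⟫_ℂ).re) x w
      = (⟪tensorCov B A Ψ x w, Φ x⟫_ℂ).re + (⟪Ψ x, tensorCov B A Φ x w⟫_ℂ).re := by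
  rw [← Complex.add_re, ← tensorCov_unitary B A hΨ hΦ]
  exact mvfderiv_clm_comp Complex.reCLM (SmoothSec.mdiff (contMDiff_tensor_inner hΨ hΦ) x) w

/-- The second derivative of |Φ|² along W is 2 Re⟨Φ, ∇_W∇_WΦ⟩ + 2|∇_WΦ|², where the last term is
nonnegative and can be dropped. -/
theorem re_inner_tensorCov_of_isLocalMax {S : HermitianBundle.{u, v} X m}
    {E : HermitianBundle.{u, v} X n} (B : UnitaryConnection S) (A : UnitaryConnection E)
    {Φ : Π x : X, S.fiber x ⊗[ℂ] E.fiber x} (hΦ : Φ ∈ tensorSections S E) {x₀ : X}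
    (hmax : IsLocalMax (fun y ↦ ‖Φ y‖ ^ 2) x₀) {W : Π x : X, TangentSpace (𝓡 4) x}
    (hW : SmoothSec R4 W) :
    (⟪Φ x₀, tensorCov B A Φ x₀ (W x₀)⟫_ℂ).re = 0 ∧
      (⟪Φ x₀, tensorCov B A (fun y ↦ tensorCov B A Φ y (W y)) x₀ (W x₀)⟫_ℂ).re ≤ 0 := by
  have hf : (fun y ↦ ‖Φ y‖ ^ 2) = fun y ↦ (⟪Φ y, Φ y⟫_ℂ).re := by
    funext y
    exact (re_inner_self (Φ y)).symm
  have hsm : ContMDiff (𝓡 4) 𝓘(ℝ, ℝ) ∞ (fun y ↦ ‖Φ y‖ ^ 2) := by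
    rw [hf]
    exact contMDiff_re (contMDiff_tensor_inner hΦ hΦ)
  have hd : ∀ y, mvfderiv (𝓡 4) (fun y ↦ ‖Φ y‖ ^ 2) y (W y)
      = (⟪tensorCov B A Φ y (W y), Φ y⟫_ℂ).re + (⟪tensorCov B A Φ y (W y), Φ y⟫_ℂ).re := by
    intro y
    rw [hf, mvfderiv_re_tensor_inner B A hΦ hΦ]
    rw [re_inner_comm (Φ y)]
  have hmem := tensorCov_mem B A hΦ hW
  have hsm2 := SmoothSec.mdiff (contMDiff_re (contMDiff_tensor_inner hmem hΦ)) x₀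
  obtain ⟨h1, h2⟩ := mvfderiv_eq_zero_of_isLocalMax hsm hmax hW
  simp only [hd] at h1 h2
  rw [mvfderiv_fun_add hsm2 hsm2, add_apply, mvfderiv_re_tensor_inner B A hmem hΦ] at h2
  have h3 : (⟪tensorCov B A Φ x₀ (W x₀), Φ x₀⟫_ℂ).re
      = (⟪Φ x₀, tensorCov B A Φ x₀ (W x₀)⟫_ℂ).re := by
    rw [re_inner_comm (Φ x₀)]
  have h4 : (⟪tensorCov B A (fun y ↦ tensorCov B A Φ y (W y)) x₀ (W x₀), Φ x₀⟫_ℂ).re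
      = (⟪Φ x₀, tensorCov B A (fun y ↦ tensorCov B A Φ y (W y)) x₀ (W x₀)⟫_ℂ).re := by
    rw [re_inner_comm (Φ x₀)]
  have h5 : 0 ≤ (⟪tensorCov B A Φ x₀ (W x₀), tensorCov B A Φ x₀ (W x₀)⟫_ℂ).re := by
    rw [re_inner_self (tensorCov B A Φ x₀ (W x₀))]
    positivity
  exact ⟨by linarith, by linarith⟩

variable [RiemannianBundle (TangentSpace (𝓡 4) : X → Type)]
  {o : ManifoldOrientation X}

theorem re_selfDualPart {x : X} {θ : TangentSpace (𝓡 4) x → TangentSpace (𝓡 4) x → ℂ}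
    (h : ∀ w z, (θ w z).re = 0) (w z : TangentSpace (𝓡 4) x) : (selfDualPart o θ w z).re = 0 := by
  simp [selfDualPart, hodgeStar, h]

variable [IsContMDiffRiemannianBundle (𝓡 4) ∞ R4 (TangentSpace (𝓡 4) : X → Type)]

theorem re_trace_curvature (o : ManifoldOrientation X) {V : HermitianBundle.{u, v} X n}
    (A : UnitaryConnection V) (x : X) (w z : TangentSpace (𝓡 4) x) :
    (LinearMap.trace ℂ (V.fiber x) (A.curvature x w z)).re = 0 := by
  rw [LinearMap.trace_eq_sum_inner _ (stdOrthonormalBasis ℂ (V.fiber x)), Complex.re_sum]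
  refine Finset.sum_eq_zero fun i _ ↦ ?_
  have h := A.re_curvature_skew o w z (stdOrthonormalBasis ℂ (V.fiber x) i)
    (stdOrthonormalBasis ℂ (V.fiber x) i)
  have h2 : (⟪A.curvature x w z (stdOrthonormalBasis ℂ (V.fiber x) i),
      stdOrthonormalBasis ℂ (V.fiber x) i⟫_ℂ).re
      = (⟪stdOrthonormalBasis ℂ (V.fiber x) i,
        A.curvature x w z (stdOrthonormalBasis ℂ (V.fiber x) i)⟫_ℂ).re :=
    re_inner_comm _ _
  linarith

variable {𝔰 : SpinCStructure.{u, v} o} {E : HermitianBundle.{u, v} X n}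

theorem le_re_inner_gammaForm {x : X} {θ : TangentSpace (𝓡 4) x → TangentSpace (𝓡 4) x → ℂ}
    (hθ : IsBilinearMap ℝ θ) (hs : ∀ w z, θ w z = -θ z w) (him : ∀ w z, (θ w z).re = 0)
    {e : OrthonormalBasis (Fin 4) ℝ (TangentSpace (𝓡 4) x)}
    (he : e.toBasis.orientation = o.orient x) (Ψ : 𝔰.plus.fiber x ⊗[ℂ] E.fiber x) :
    -(formNorm θ * ‖Ψ‖ ^ 2)
      ≤ (⟪Ψ, TensorProduct.map (gammaForm 𝔰 θ) LinearMap.id Ψ⟫_ℂ).re := by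
  have h1 := norm_gammaForm_le hθ hs him he Ψ
  have h2 := (abs_le.1 ((Complex.abs_re_le_norm _).trans
    (norm_inner_le_norm (𝕜 := ℂ) Ψ (TensorProduct.map (gammaForm 𝔰 θ) LinearMap.id Ψ)))).1
  have h3 := mul_le_mul_of_nonneg_left h1 (norm_nonneg Ψ)
  nlinarith

/-- The Weitzenböck formula for a monopole in terms of the curvature of the metric, the `Spin^c`
connection and the perturbation. -/
theorem IsMonopole.sum_secondCov {B : SpinCConnection 𝔰} {η : ImagSelfDualForm o} {τ : ℝ}
    {Ψ : Π x : X, 𝔰.plus.fiber x ⊗[ℂ] E.fiber x} {A : UnitaryConnection E}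
    (h : IsMonopole B η τ Ψ A) {Φ : Π x : X, 𝔰.plus.fiber x ⊗[ℂ] E.fiber x}
    (hΦ : Φ ∈ tensorSections 𝔰.plus E) {x₀ : X}
    (hΦΨ : ∀ᶠ y in 𝓝 x₀, Φ y = Ψ y ∧ tensorCov B.plus A Φ y = tensorCov B.plus A Ψ y)
    {e : Fin 4 → Π x : X, TangentSpace (𝓡 4) x} (he : ∀ a, SmoothSec R4 (e a))
    (hon : ∀ᶠ y in 𝓝 x₀, ∃ f : OrthonormalBasis (Fin 4) ℝ (TangentSpace (𝓡 4) y),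
      (∀ a, e a y = f a) ∧ f.toBasis.orientation = o.orient y) :
    ∑ a, secondCov B.plus A Φ (e a) x₀ (e a x₀)
      = ((scalarCurvature x₀ / 4 : ℝ) : ℂ) • Φ x₀
        + (2⁻¹ : ℂ) • TensorProduct.map (gammaForm 𝔰 (selfDualPart o
          (fun w z ↦ LinearMap.trace ℂ (𝔰.plus.fiber x₀) (B.plus.curvature x₀ w z))))
            LinearMap.id (Φ x₀)
        + mu τ (Φ x₀) (Φ x₀)
        + TensorProduct.map (gammaForm 𝔰 (fun w z ↦ η.form x₀ w z)) LinearMap.id (Φ x₀) := by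
  have hD : ∀ᶠ y in 𝓝 x₀, dirac B A Φ y = 0 := hΦΨ.mono fun y hy ↦ by
    rw [← h.dirac_eq y, dirac, dirac, hy.2]
  rw [sum_secondCov_eq B A hΦ hD he (hon.mono fun y ⟨f, hf, _⟩ ↦ ⟨f, hf⟩)]
  obtain ⟨f, hf, hfo⟩ := hon.self_of_nhds
  have hbil := isBilinearMap_curvature o A x₀
  -- The Weitzenböck formula contains the full curvature and the monopole equation only its
  -- self-dual part; γ does not distinguish them on S⁺.
  have hend : gammaEndForm 𝔰 E (A.curvature x₀) = mu τ (Φ x₀)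
      + TensorProduct.map (gammaForm 𝔰 (fun w z ↦ η.form x₀ w z)) LinearMap.id := by
    rw [← gammaEndForm_selfDualPart hbil (A.curvature_swap o) hfo, hΦΨ.self_of_nhds.1,
      ← h.curvature_eq x₀]
    abel
  have hplus : (2⁻¹ : ℂ) • ∑ a, ∑ b, (gammaTwo 𝔰 x₀ (f a) (f b)).rTensor (E.fiber x₀)
      (TensorProduct.map (B.plus.curvature x₀ (f a) (f b)) LinearMap.id (Φ x₀))
      = ((scalarCurvature x₀ / 4 : ℝ) : ℂ) • Φ x₀
        + (2⁻¹ : ℂ) • TensorProduct.map (gammaForm 𝔰 (selfDualPart o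
          (fun w z ↦ LinearMap.trace ℂ (𝔰.plus.fiber x₀) (B.plus.curvature x₀ w z))))
            LinearMap.id (Φ x₀) := by
    rw [gammaForm_selfDualPart (isBilinearMap_trace_curvature B x₀) (trace_curvature_swap B x₀) hfo]
    have h1 := congrArg (fun T ↦ LinearMap.rTensorHom (E.fiber x₀) T (Φ x₀))
      (sum_gammaTwo_mul_curvature B hfo)
    simp only [map_smul, map_sum, map_add, LinearMap.smul_apply, LinearMap.sum_apply,
      LinearMap.add_apply, LinearMap.coe_rTensorHom, Module.End.mul_eq_comp, LinearMap.rTensor_comp,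
      LinearMap.comp_apply, Module.End.one_eq_id, LinearMap.rTensor_id, LinearMap.id_apply] at h1
    exact h1
  have hE : (2⁻¹ : ℂ) • ∑ a, ∑ b, (gammaTwo 𝔰 x₀ (f a) (f b)).rTensor (E.fiber x₀)
      (TensorProduct.map LinearMap.id (A.curvature x₀ (f a) (f b)) (Φ x₀))
      = gammaEndForm 𝔰 E (A.curvature x₀) (Φ x₀) := by
    rw [gammaEndForm_eq hbil f, LinearMap.smul_apply, LinearMap.sum_apply]
    congr 1
    refine Finset.sum_congr rfl fun a _ ↦ ?_
    rw [LinearMap.sum_apply]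
    refine Finset.sum_congr rfl fun b _ ↦ ?_
    rw [LinearMap.rTensor_def, ← LinearMap.comp_apply, ← TensorProduct.map_comp,
      LinearMap.comp_id, LinearMap.id_comp]
  simp only [hf, LinearMap.add_apply, map_add, Finset.sum_add_distrib, smul_add]
  rw [hplus, hE, hend, LinearMap.add_apply, ← add_assoc]

/-- The estimate at a local maximum of the norm of the spinor. -/
theorem IsMonopole.le_of_isLocalMax (hn : 2 ≤ n) {B : SpinCConnection 𝔰} {η : ImagSelfDualForm o}
    {τ : ℝ} (hτ : 0 ≤ τ) {Ψ : Π x : X, 𝔰.plus.fiber x ⊗[ℂ] E.fiber x} {A : UnitaryConnection E}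
    (h : IsMonopole B η τ Ψ A) {x₀ : X} (hmax : IsLocalMax (fun y ↦ ‖Ψ y‖ ^ 2) x₀) :
    ‖Ψ x₀‖ ^ 4 / 4 ≤ boundFunction B η x₀ * ‖Ψ x₀‖ ^ 2 := by
  obtain ⟨e, he, hon⟩ := exists_orthonormal_frame o x₀
  obtain ⟨Φ, hΦ, hΦΨ⟩ := exists_tensorSections_tensorCov B.plus A h.smooth x₀
  have hsum := h.sum_secondCov hΦ hΦΨ he hon
  have hx := hΦΨ.self_of_nhds.1
  have hmax' : IsLocalMax (fun y ↦ ‖Φ y‖ ^ 2) x₀ := by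
    filter_upwards [hmax, hΦΨ] with y h1 h2
    rw [h2.1, hx]
    exact h1
  obtain ⟨f, hf, hfo⟩ := hon.self_of_nhds
  have hle : (⟪Φ x₀, ∑ a, secondCov B.plus A Φ (e a) x₀ (e a x₀)⟫_ℂ).re ≤ 0 := by
    rw [inner_sum, Complex.re_sum]
    refine Finset.sum_nonpos fun a _ ↦ ?_
    -- The correction term of `secondCov` is a first derivative of Φ, so its real pairing with Φ
    -- vanishes at the maximum.
    obtain ⟨Z, hZ, hZe⟩ := exists_smooth_tangent (leviCivita (e a) x₀ (e a x₀))
    have h1 := (re_inner_tensorCov_of_isLocalMax B.plus A hΦ hmax' hZ).1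
    have h2 := (re_inner_tensorCov_of_isLocalMax B.plus A hΦ hmax' (he a)).2
    rw [secondCov, inner_sub_right, Complex.sub_re, ← hZe, h1, sub_zero]
    exact h2
  rw [hsum, hx] at hle
  simp only [inner_add_right, inner_smul_right (Ψ x₀), Complex.add_re, Complex.re_ofReal_mul] at hle
  have h1 := norm_pow_four_le_mu (𝔰.plus.finrank_fiber x₀) (by rw [E.finrank_fiber]; exact hn) hτ
    (Ψ x₀)
  have hη : IsBilinearMap ℝ (fun w z ↦ η.form x₀ w z) := by
    constructor <;> intros <;> simp
  have hηs : ∀ w z, η.form x₀ w z = -η.form x₀ z w := fun w z ↦ by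
    have h3 := η.alternating x₀ (w + z)
    simp only [map_add, LinearMap.add_apply, η.alternating] at h3
    linear_combination h3
  have h2 := le_re_inner_gammaForm hη hηs (η.imaginary x₀) hfo (Ψ x₀)
  have h3 := le_re_inner_gammaForm
    (isBilinearMap_selfDualPart (o := o) (isBilinearMap_trace_curvature B x₀))
    (selfDualPart_swap (trace_curvature_swap B x₀))
    (re_selfDualPart (re_trace_curvature o B.plus x₀)) hfo (Ψ x₀)
  have h4 : (⟪Ψ x₀, Ψ x₀⟫_ℂ).re = ‖Ψ x₀‖ ^ 2 := re_inner_self (Ψ x₀)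
  have h5 : ∀ z : ℂ, (2⁻¹ * z).re = 2⁻¹ * z.re := fun z ↦ by
    rw [show (2⁻¹ : ℂ) = ((2⁻¹ : ℝ) : ℂ) by push_cast; rfl, Complex.re_ofReal_mul]
  rw [h4, h5] at hle
  rw [boundFunction]
  nlinarith

end Estimate

/-! ### Continuity of the bound function -/

section Continuity

variable {X : Type u} [TopologicalSpace X] [ChartedSpace R4 X] [IsManifold (𝓡 4) ∞ X] [T2Space X]

theorem SmoothSec.covCurv {F : Type*} [NormedAddCommGroup F] [NormedSpace ℝ F] {V : X → Type*}
    [TopologicalSpace (TotalSpace F V)] [∀ x, AddCommGroup (V x)] [∀ x, Module ℝ (V x)]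
    [∀ x, TopologicalSpace (V x)] [∀ x, IsTopologicalAddGroup (V x)]
    [∀ x, ContinuousSMul ℝ (V x)] [FiberBundle F V] [VectorBundle ℝ F V]
    {D : CovariantDerivative (𝓡 4) F V} (hD : IsSmoothCov D) {W Z : Π x : X, TangentSpace (𝓡 4) x}
    {σ : Π x : X, V x} (hW : SmoothSec R4 W) (hZ : SmoothSec R4 Z) (hσ : SmoothSec F σ) :
    SmoothSec F (covCurv D W Z σ) :=
  ((hD _ _ hW (hD _ _ hZ hσ)).sub_section (hD _ _ hZ (hD _ _ hW hσ))).sub_section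
    (hD _ _ (hW.mlieBracket hZ) hσ)

theorem continuous_tensor_norm_sq {m n : ℕ} {S : HermitianBundle.{u, v} X m}
    {E : HermitianBundle.{u, v} X n} {Ψ : Π x : X, S.fiber x ⊗[ℂ] E.fiber x}
    (hΨ : SmoothTensorSec Ψ) : Continuous (fun y ↦ ‖Ψ y‖ ^ 2) := by
  rw [continuous_iff_continuousAt]
  intro x₀
  obtain ⟨Φ, hΦ, h⟩ := exists_tensorSections_eq hΨ x₀
  refine (contMDiff_re (contMDiff_tensor_inner hΦ hΦ)).continuous.continuousAt.congr ?_
  filter_upwards [h] with y hy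
  rw [re_inner_self (Φ y), hy]

theorem trace_eq_sum_locCoord {n : ℕ} (V : HermitianBundle.{u, v} X n) (x₀ : X) {y : X}
    (hy : y ∈ (trivializationAt (Cn n) V.fiber x₀).baseSet) (T : End ℂ (V.fiber y)) :
    LinearMap.trace ℂ (V.fiber y) T = ∑ j, locCoord V x₀ j y (T (locFrame V x₀ j y)) := by
  have h : T = ∑ j, (locCoord V x₀ j y).smulRight (T (locFrame V x₀ j y)) := by
    ext s
    conv_lhs => rw [← sum_locCoord_smul x₀ hy s, map_sum]
    rw [LinearMap.sum_apply]
    simp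
  conv_lhs => rw [h, map_sum]
  simp [LinearMap.trace_smulRight]

variable [RiemannianBundle (TangentSpace (𝓡 4) : X → Type)]
  {o : ManifoldOrientation X} {x₀ : X} {e : Fin 4 → Π x : X, TangentSpace (𝓡 4) x}

/-- `formNorm` uses the pointwise basis `onb`, which need not vary continuously; basis independence
replaces it by a smooth frame. -/
theorem continuousAt_formNorm {θ : Π x : X, TangentSpace (𝓡 4) x → TangentSpace (𝓡 4) x → ℂ}
    (hθ : ∀ x, IsBilinearMap ℝ (θ x))
    (hon : ∀ᶠ y in 𝓝 x₀, ∃ f : OrthonormalBasis (Fin 4) ℝ (TangentSpace (𝓡 4) y),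
      (∀ a, e a y = f a) ∧ f.toBasis.orientation = o.orient y)
    (hc : ∀ a b, ContinuousAt (fun y ↦ θ y (e a y) (e b y)) x₀) :
    ContinuousAt (fun y ↦ formNorm (θ y)) x₀ := by
  have h : ContinuousAt (fun y ↦ √(∑ a, ∑ b, ‖θ y (e a y) (e b y)‖ ^ 2)) x₀ := by
    refine Real.continuous_sqrt.continuousAt.comp ?_
    exact tendsto_finsetSum _ fun a _ ↦ tendsto_finsetSum _ fun b _ ↦ ((hc a b).norm.pow 2)
  refine h.congr ?_
  filter_upwards [hon] with y hy
  obtain ⟨f, hf, -⟩ := hy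
  simp only [hf]
  rw [← formNorm_sq_eq (hθ y) f]
  exact Real.sqrt_sq (Real.sqrt_nonneg _)

theorem continuousAt_selfDualPart
    {θ : Π x : X, TangentSpace (𝓡 4) x → TangentSpace (𝓡 4) x → ℂ}
    (hθ : ∀ x, IsBilinearMap ℝ (θ x))
    (hon : ∀ᶠ y in 𝓝 x₀, ∃ f : OrthonormalBasis (Fin 4) ℝ (TangentSpace (𝓡 4) y),
      (∀ a, e a y = f a) ∧ f.toBasis.orientation = o.orient y)
    (hc : ∀ a b, ContinuousAt (fun y ↦ θ y (e a y) (e b y)) x₀) (a b : Fin 4) :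
    ContinuousAt (fun y ↦ selfDualPart o (θ y) (e a y) (e b y)) x₀ := by
  -- On positively oriented orthonormal frames the volume form takes constant values, so its
  -- coefficients may be frozen at `x₀`.
  have h : ContinuousAt (fun y ↦ (2⁻¹ : ℝ) • (θ y (e a y) (e b y) + (2⁻¹ : ℝ) • ∑ c, ∑ d,
      (o.orient x₀).volumeForm ![e a x₀, e b x₀, e c x₀, e d x₀] • θ y (e c y) (e d y))) x₀ := by
    refine ((hc a b).add (ContinuousAt.const_smul ?_ (2⁻¹ : ℝ))).const_smul (2⁻¹ : ℝ)
    exact tendsto_finsetSum _ fun c _ ↦ tendsto_finsetSum _ fun d _ ↦ Filter.Tendsto.const_smul (hc c d) _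
  refine h.congr ?_
  obtain ⟨f₀, hf₀, ho₀⟩ := hon.self_of_nhds
  filter_upwards [hon] with y hy
  obtain ⟨f, hf, ho⟩ := hy
  simp only [hf, hf₀, volumeForm_basis ho₀, selfDualPart, hodgeStar_eq (hθ y) _ _ f,
    volumeForm_basis ho]

variable [IsContMDiffRiemannianBundle (𝓡 4) ∞ R4 (TangentSpace (𝓡 4) : X → Type)]

theorem continuous_scalarCurvature (o : ManifoldOrientation X) :
    Continuous (scalarCurvature (X := X)) := by
  rw [continuous_iff_continuousAt]
  intro x₀
  obtain ⟨e, he, hon⟩ := exists_orthonormal_frame o x₀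
  have hL := isSmoothCov_leviCivita o
  have h : ContinuousAt (fun y ↦ ∑ a, ∑ b, ⟪covCurv leviCivita (e a) (e b) (e b) y, e a y⟫_ℝ) x₀ :=
    tendsto_finsetSum _ fun a _ ↦ tendsto_finsetSum _ fun b _ ↦
      (SmoothSec.inner (SmoothSec.covCurv hL (he a) (he b) (he b)) (he a)).continuous.continuousAt
  refine h.congr ?_
  filter_upwards [hon] with y hy
  obtain ⟨f, hf, -⟩ := hy
  rw [scalarCurvature_eq o y f]
  refine Finset.sum_congr rfl fun a _ ↦ Finset.sum_congr rfl fun b _ ↦ ?_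
  rw [← riemann_apply o (he a) (he b) (he b) (he a), hf, hf]

theorem continuousAt_trace_curvature (o : ManifoldOrientation X) {n : ℕ}
    {V : HermitianBundle.{u, v} X n} (A : UnitaryConnection V)
    {W Z : Π x : X, TangentSpace (𝓡 4) x} (hW : SmoothSec R4 W) (hZ : SmoothSec R4 Z) (x₀ : X) :
    ContinuousAt (fun y ↦ LinearMap.trace ℂ (V.fiber y) (A.curvature y (W y) (Z y))) x₀ := by
  obtain ⟨f, hf, hfe⟩ := exists_smooth_locFrame V x₀
  have h : ContinuousAt (fun y ↦ ∑ j, locCoord V x₀ j y (covCurv A.cov W Z (f j) y)) x₀ :=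
    tendsto_finsetSum _ fun j _ ↦ (contMDiffAt_locCoord
      (FiberBundle.mem_baseSet_trivializationAt' x₀)
      (SmoothSec.covCurv A.isSmoothCov hW hZ (hf j) x₀)).continuousAt
  refine h.congr ?_
  filter_upwards [hfe, baseSet_mem_nhds V x₀] with y h1 h2
  rw [trace_eq_sum_locCoord V x₀ h2]
  refine Finset.sum_congr rfl fun j _ ↦ ?_
  rw [← h1 j, A.curvature_apply o hW hZ (hf j)]

/-- On a compact manifold this makes K an attained maximum and not just a supremum. -/
theorem continuous_boundFunction {𝔰 : SpinCStructure.{u, v} o} (B : SpinCConnection 𝔰)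
    (η : ImagSelfDualForm o) : Continuous (boundFunction B η) := by
  rw [continuous_iff_continuousAt]
  intro x₀
  obtain ⟨e, he, hon⟩ := exists_orthonormal_frame o x₀
  have h1 := (continuous_scalarCurvature o).continuousAt (x := x₀)
  have h2 : ContinuousAt (fun y ↦ formNorm (selfDualPart o
      (fun w z ↦ LinearMap.trace ℂ (𝔰.plus.fiber y) (B.plus.curvature y w z)))) x₀ :=
    continuousAt_formNorm
      (fun y ↦ isBilinearMap_selfDualPart (isBilinearMap_trace_curvature B y)) hon
      (continuousAt_selfDualPart (fun y ↦ isBilinearMap_trace_curvature B y) hon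
        fun a b ↦ continuousAt_trace_curvature o B.plus (he a) (he b) x₀)
  have h3 : ContinuousAt (fun y ↦ formNorm (fun w z ↦ η.form y w z)) x₀ :=
    continuousAt_formNorm (fun y ↦ by constructor <;> intros <;> simp) hon
      fun a b ↦ (η.smooth _ _ (he a) (he b)).continuous.continuousAt
  exact ((h1.neg.div_const 4).add (h2.div_const 2)).add h3

end Continuity
end UnMonopole
end

/-! ### The uniform bound -/

open UnMonopole in
theorem mainTheorem6 :
    ∃ c : ℝ, 0 < c ∧
      ∀ (X : Type u) [TopologicalSpace X] [T2Space X] [CompactSpace X] [Nonempty X]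
        [ChartedSpace R4 X] [IsManifold (𝓡 4) ∞ X]
        [RiemannianBundle (TangentSpace (𝓡 4) : X → Type)]
        [IsContMDiffRiemannianBundle (𝓡 4) ∞ R4 (TangentSpace (𝓡 4) : X → Type)]
        (o : ManifoldOrientation X) (𝔰 : SpinCStructure.{u, v} o) (B : SpinCConnection 𝔰)
        (η : ImagSelfDualForm o),
        ∃ K : ℝ, IsGreatest (Set.range (boundFunction B η)) K ∧
          ∀ (n : ℕ), 2 ≤ n → ∀ (E : HermitianBundle.{u, v} X n) (τ : ℝ), 0 ≤ τ →
            ∀ (Ψ : Π x : X, 𝔰.plus.fiber x ⊗[ℂ] E.fiber x) (A : UnitaryConnection E),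
              IsMonopole B η τ Ψ A →
                (∀ x, ‖Ψ x‖ ^ 2 ≤ max 0 (K / c ^ 2)) ∧ (K < 0 → ∀ x, Ψ x = 0) := by
  -- c² = 1/4 is the constant of `norm_pow_four_le_mu`.
  refine ⟨1 / 2, by norm_num, ?_⟩
  intro X _ _ _ _ _ _ _ _ o 𝔰 B η
  obtain ⟨z, -, hz⟩ := isCompact_univ.exists_isMaxOn Set.univ_nonempty
    (continuous_boundFunction B η).continuousOn
  refine ⟨boundFunction B η z, ⟨Set.mem_range_self z, ?_⟩, ?_⟩
  · rintro _ ⟨y, rfl⟩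
    exact hz (Set.mem_univ y)
  intro n hn E τ hτ Ψ A h
  obtain ⟨x₀, -, hx₀⟩ := isCompact_univ.exists_isMaxOn Set.univ_nonempty
    (continuous_tensor_norm_sq h.smooth).continuousOn
  have hle : ∀ x, ‖Ψ x‖ ^ 2 ≤ ‖Ψ x₀‖ ^ 2 := fun x ↦ hx₀ (Set.mem_univ x)
  have hest := h.le_of_isLocalMax hn hτ (Filter.Eventually.of_forall hle : IsLocalMax _ x₀)
  have hK : boundFunction B η x₀ ≤ boundFunction B η z := hz (Set.mem_univ x₀)
  -- The estimate can be divided by |Ψ|² at `x₀` unless Ψ vanishes there. The first alternative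
  -- accounts for the 0 in the bound and is the only one possible when K < 0.
  have hkey : ‖Ψ x₀‖ ^ 2 = 0 ∨ ‖Ψ x₀‖ ^ 2 ≤ 4 * boundFunction B η z := by
    rcases (sq_nonneg ‖Ψ x₀‖).eq_or_lt with h0 | h0
    · exact Or.inl h0.symm
    · refine Or.inr ?_
      have h1 : ‖Ψ x₀‖ ^ 2 * (‖Ψ x₀‖ ^ 2 / 4) ≤ ‖Ψ x₀‖ ^ 2 * boundFunction B η x₀ := by linarith
      linarith [le_of_mul_le_mul_left h1 h0]
  refine ⟨fun x ↦ (hle x).trans ?_, fun hneg x ↦ ?_⟩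
  · rcases hkey with h0 | h0
    · exact h0.le.trans (le_max_left _ _)
    · exact (h0.trans (by ring_nf; rfl)).trans (le_max_right _ _)
  · have h0 : ‖Ψ x₀‖ ^ 2 = 0 := hkey.resolve_right fun h1 ↦ by nlinarith [sq_nonneg ‖Ψ x₀‖]
    have h1 := hle x
    rw [h0] at h1
    exact norm_eq_zero.1 (pow_eq_zero_iff two_ne_zero |>.1 (le_antisymm h1 (sq_nonneg _)))
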